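/- **Setting.** Let $T$ be a locally finite simplicial tree with vertex set $VT$ and boundary (space of ends) $\partial T$, and let $\Gamma$ be a discrete non-elementary subgroup of the group of automorphisms of $T$, acting without edge inversions (non-elementary: $\Gamma$ preserves no point and no pair of points of $T\cup\partial T$). Let $0<\delta<+\infty$ and let $(\mu_x)_{x\in VT}$ be a Patterson–Sullivan measure of dimension $\delta$ for $\Gamma$, i.e. a family of finite Borel measures on $\partial T$ with $\gamma_*\mu_x=\mu_{\gamma x}$ for $\gamma\in\Gamma$ and $\frac{d\mu_x}{d\mu_y}(\xi)=e^{-\delta\beta_\xi(x,y)}$, where $\beta_\xi(x,y)=d(x,z)-d(z,y)$ for every vertex $z$ close enough to $\xi$. Assume that for every $\gamma\in\Gamma\setminus\{e\}$ having a fixed point in $T$, the set of fixed points of $\gamma$ in $\partial T$ is $\mu_x$-null. Let $\mathcal GT$ be the space of geodesic lines $\ell:\mathbb Z\to VT$ of $T$, with endpoints $\ell_-,\ell_+\in\partial T$. Let $\tilde\varphi(\ell)(t)=\ell(t+1)$, $N\ge 1$ and $\tilde\psi=\tilde\varphi^N$. Let $V'T\subset VT$ be a $\Gamma$-invariant set such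 that for every $\ell\in\mathcal G'T=\{\ell\in\mathcal GT:\ell(0)\in V'T\}$ and $t\in\mathbb Z$, one has $\ell(t)\in V'T$ if and only if $\ell(t)=(\tilde\psi^n\ell)(0)$ for some $n\in\mathbb Z$. Let $\tilde\mu_{BM}$ be the restriction to $\mathcal G'T$ of the Bowen–Margulis measure, which is $$\frac{d\mu_o(\ell_-)\,d\mu_o(\ell_+)\,dt}{d_o(\ell_-,\ell_+)^{2\delta}}$$ in the coordinates $(\ell_-,\ell_+,t)$, where $o$ is a base vertex (the measure does not depend on it), $\ell(t)$ is the point of $\ell$ closest to $o$, $dt$ is the counting measure on $\mathbb Z$, and $d_o(\xi,\eta)=e^{-u}$ with $u$ the length of $[o,\xi[\,\cap\,[o,\eta[$. A $\Gamma$-invariant measure $m$ on $\mathcal GT$ induces on $\Gamma\backslash\mathcal GT$ the measure $\bar m$ such that $\int\sum_{\gamma\in\Gamma}f(\gamma\ell)\,d\bar m(\Gamma\ell)=\int f\,dm$ for all measurable $f\ge 0$. Let $\mu_{BM}$ be the measure induced by $\tilde\mu_{BM}$ and $\psi$ the map induced by $\tilde\psi$. Assume that $(\Gamma\backslash\mathcal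 G'T,\psi,\mu_{BM})$ is a mixing probability measure preserving system. **Theorem.** For $x\in V'T$ let $\mathcal G'T(x)$ be the set of the $\ell\in\mathcal G'T$ such that $\ell(t)\in\Gamma x$ for infinitely many $t>0$ and infinitely many $t<0$. There is $x_0\in V'T$ such that $\mathcal G'T(x_0)$ has full $\tilde\mu_{BM}$-measure. For every such $x_0$, let $X_0\subset\Gamma\backslash\mathcal G'T$ be the image of $\tilde X_0=\{\ell\in\mathcal G'T(x_0):\ell(0)\in\Gamma x_0\}$, let $\psi_0$ be the first return map of $\psi$ to $X_0$, let $m_0'$ be the measure on $X_0$ induced by the restriction of $\tilde\mu_{BM}$ to $\tilde X_0$, and let $m_0=m_0'/m_0'(X_0)$. Let $$S=\{\gamma\in\Gamma\setminus\Gamma_{x_0}\;:\;]x_0,\gamma x_0[\,\cap\,\Gamma x_0=\emptyset\},$$ and for $\alpha,\beta\in S$ let $A_{\alpha,\beta}=1$ if $x_0\in[\alpha^{-1}x_0,\beta x_0]$ and $A_{\alpha,\beta}=0$ otherwise. Let $X_A=\{(s_i)\in S^{\mathbb Z}: A_{s_i,s_{i+1}}=1\ \forall i\in\mathbb Z\}$,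 with the left shift $\sigma$. For vertices $x,y$ let $\mathcal O_x(y)=\{\xi\in\partial T: y\in[x,\xi[\}$ (shadow of $y$ seen from $x$). Put $$\nu_\alpha=\frac{\mu_{x_0}(\mathcal O_{\alpha x_0}(x_0))\,\mu_{x_0}(\mathcal O_{x_0}(\alpha x_0))}{|\Gamma_{x_0}|^2\,m_0'(X_0)},\qquad \pi_{\alpha,\beta}=\frac{\mu_{x_0}(\mathcal O_{\alpha x_0}(\alpha\beta x_0))}{|\Gamma_{x_0}|\,\mu_{x_0}(\mathcal O_{x_0}(\alpha x_0))}\ \text{ if }A_{\alpha,\beta}=1,$$ and $\pi_{\alpha,\beta}=0$ if $A_{\alpha,\beta}=0$. Then: 1. $m_0$ is a well-defined probability measure, and $S$ is countable. 2. $\nu_\alpha>0$ for all $\alpha\in S$, and $\pi_{\alpha,\beta}>0$ if and only if $A_{\alpha,\beta}=1$. The matrix $\Pi=(\pi_{\alpha,\beta})$ is stochastic, and $\nu=(\nu_\alpha)$ is a probability on $S$ which is stationary for $\Pi$. 3. There is a Markov measure $\mu_\Pi$ on $(X_A,\sigma)$ associated with $(\Pi,\nu)$, i.e. a $\sigma$-invariant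 probability measure with $\mu_\Pi[s_0=\alpha_0,\dots,s_k=\alpha_k]=\nu_{\alpha_0}\prod_{i=0}^{k-1}\pi_{\alpha_i,\alpha_{i+1}}$ for all $k\in\mathbb N$ and $\alpha_0,\dots,\alpha_k\in S$. The system $(X_0,\psi_0,m_0)$ is a factor of $(X_A,\sigma,\mu_\Pi)$: there is a measurable surjective map $\Theta:X_A\to X_0$ with $\Theta\circ\sigma=\psi_0\circ\Theta$ on $X_A$ and $\Theta_*\mu_\Pi=m_0$. -/

import Mathlib

open MeasureTheory Filter Topology Set
open scoped ENNReal

noncomputable section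

namespace TreeCoding

variable {V : Type*} {T : SimpleGraph V}

/-! ### Geodesic lines, geodesic rays and the boundary of a tree -/

/-- A geodesic line of the tree `T`: an injective simplicial map `ℝ → T`, recorded by its values on
the vertex set `ℤ` of `ℝ`. -/
@[ext]
structure Geod (T : SimpleGraph V) where
  /-- the underlying map -/
  toFun : ℤ → V
  adj : ∀ n : ℤ, T.Adj (toFun n) (toFun (n + 1))
  inj : Function.Injective toFun

/-- A geodesic ray of the tree `T`. -/
@[ext]
structure Ray (T : SimpleGraph V) where
  /-- the underlying map -/
  toFun : ℕ → V
  adj : ∀ n : ℕ, T.Adj (toFun n) (toFun (n + 1))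
  inj : Function.Injective toFun

/-- The Borel `σ`-algebra of the compact-open topology on the space of geodesic lines: it is
generated by the evaluations at integer times (the set of vertices of a locally finite tree is
countable). -/
instance : MeasurableSpace (Geod T) :=
  MeasurableSpace.comap Geod.toFun (@MeasurableSpace.pi ℤ (fun _ => V) (fun _ => ⊤))

/-- Two rays define the same point at infinity if they eventually coincide, up to a shift of the
parametrisation. -/
instance raySetoid (T : SimpleGraph V) : Setoid (Ray T) where
  r r s := ∃ m n : ℕ, ∀ k : ℕ, r.toFun (m + k) = s.toFun (n + k)
  iseqv :=
    { refl := fun _ => ⟨0, 0, fun _ => rfl⟩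
      symm := fun ⟨m, n, h⟩ => ⟨n, m, fun k => (h k).symm⟩
      trans := by
        rintro r s t ⟨m, n, h⟩ ⟨m', n', h'⟩
        refine ⟨m + m', n' + n, fun k => ?_⟩
        have h1 := h (m' + k)
        have h2 := h' (n + k)
        rw [show m + m' + k = m + (m' + k) by ring, h1,
          show n + (m' + k) = m' + (n + k) by ring, h2,
          show n' + n + k = n' + (n + k) by ring] }

/-- The boundary `∂T` (the space of ends) of the tree `T`, as the set of asymptotic classes of
geodesic rays. -/
def Bdry (T : SimpleGraph V) : Type _ := Quotient (raySetoid T)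

/-- The point at infinity of a ray. -/
def Ray.endpoint (r : Ray T) : Bdry T := Quotient.mk (raySetoid T) r

/-- The vertex `y` lies on the geodesic ray `[x, ξ[`. -/
def OnRay (x : V) (ξ : Bdry T) (y : V) : Prop :=
  ∃ r : Ray T, r.toFun 0 = x ∧ r.endpoint = ξ ∧ ∃ n : ℕ, r.toFun n = y

/-- The shadow of the vertex `y` seen from the vertex `x`: the set of the points at infinity `ξ`
such that the ray `[x, ξ[` passes through `y`. If `x ≠ y` and `e` is the oriented edge of origin `y`
contained in the segment `[x, y]`, this is the set `∂_e T` of the origins of the geodesic lines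
which go through `e` in the direction of `e`. -/
def shadow (T : SimpleGraph V) (x y : V) : Set (Bdry T) := {ξ | OnRay x ξ y}

/-- The Borel `σ`-algebra of `∂T`: the (countably many) shadows are a basis of the topology. -/
instance : MeasurableSpace (Bdry T) :=
  MeasurableSpace.generateFrom {U | ∃ x y : V, U = shadow T x y}

/-- The origin `ℓ₋` in `∂T` of a geodesic line. -/
def Geod.bwd (l : Geod T) : Bdry T :=
  Ray.endpoint
    { toFun := fun n => l.toFun (-(n : ℤ))
      adj := fun n => by
        have h := l.adj (-((n : ℤ) + 1))
        rw [show -((n : ℤ) + 1) + 1 = -(n : ℤ) by ring] at h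
        push_cast
        exact h.symm
      inj := fun a b h => by
        have := l.inj h
        omega }

/-- The extremity `ℓ₊` in `∂T` of a geodesic line. -/
def Geod.fwd (l : Geod T) : Bdry T :=
  Ray.endpoint
    { toFun := fun n => l.toFun (n : ℤ)
      adj := fun n => by
        have h := l.adj (n : ℤ)
        push_cast
        exact h
      inj := fun a b h => by
        have := l.inj h
        omega }

/-- Translation at the source: `t ↦ ℓ (t + k)`. For `k = 1` it is the geodesic transformation. -/
def Geod.shift (k : ℤ) (l : Geod T) : Geod T where
  toFun t := l.toFun (t + k)
  adj n := by
    have h := l.adj (n + k)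
    rwa [show n + k + 1 = n + 1 + k by ring] at h
  inj a b h := by
    have := l.inj h
    omega

/-- Automorphisms of `T` act on the geodesic lines by composition at the target. -/
instance : MulAction (T ≃g T) (Geod T) where
  smul g l :=
    { toFun := fun t => g (l.toFun t)
      adj := fun n => g.map_adj_iff.2 (l.adj n)
      inj := g.injective.comp l.inj }
  one_smul _ := rfl
  mul_smul _ _ _ := rfl

/-- Image of a ray by an automorphism. -/
def Ray.map (g : T ≃g T) (r : Ray T) : Ray T where
  toFun n := g (r.toFun n)
  adj n := g.map_adj_iff.2 (r.adj n)
  inj := g.injective.comp r.inj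

/-- Action of an automorphism on the boundary. -/
def Bdry.map (g : T ≃g T) : Bdry T → Bdry T :=
  Quotient.map (Ray.map g) (by
    rintro r s ⟨m, n, h⟩
    exact ⟨m, n, fun k => congrArg g (h k)⟩)

/-! ### Discrete non elementary groups of automorphisms -/

/-- No element of `Γ` inverts an edge. -/
def WithoutInversion (Γ : Subgroup (T ≃g T)) : Prop :=
  ∀ g ∈ Γ, ∀ x y : V, T.Adj x y → ¬ (g x = y ∧ g y = x)

/-- `Γ` is discrete for the compact-open topology, that is, for the topology of pointwise
convergence on the discrete set of vertices. -/
def IsDiscrete (Γ : Subgroup (T ≃g T)) : Prop :=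
  @DiscreteTopology Γ (TopologicalSpace.induced (fun (g : Γ) (x : V) => (g : T ≃g T) x)
    (@Pi.topologicalSpace V (fun _ => V) (fun _ => ⊥)))

/-- `Γ` preserves no point and no pair of points of `T ∪ ∂T` (as no edge is inverted, it is enough
to consider vertices and points at infinity). -/
def NonElementary (Γ : Subgroup (T ≃g T)) : Prop :=
  (¬ ∃ s : Set V, s.Nonempty ∧ s.encard ≤ 2 ∧ ∀ g ∈ Γ, g '' s = s) ∧
  (¬ ∃ s : Set (Bdry T), s.Nonempty ∧ s.encard ≤ 2 ∧ ∀ g ∈ Γ, Bdry.map g '' s = s)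

/-! ### Patterson-Sullivan and Bowen-Margulis measures -/

/-- The Busemann function `β_ξ(x, y)`: the value of `d(x, z) - d(z, y)` for the vertices `z` close
enough to `ξ`. (The sequence below is eventually constant.) -/
def busemann (ξ : Bdry T) (x y : V) : ℝ :=
  limUnder atTop fun n : ℕ =>
    (T.dist x ((Quotient.out ξ : Ray T).toFun n) : ℝ)
      - (T.dist ((Quotient.out ξ : Ray T).toFun n) y : ℝ)

/-- `(μ_x)_{x ∈ VT}` is a Patterson-Sullivan measure of dimension `δ` for `Γ`. -/
structure IsPattersonSullivan (Γ : Subgroup (T ≃g T)) (δ : ℝ) (μ : V → Measure (Bdry T)) :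
    Prop where
  finite : ∀ x, IsFiniteMeasure (μ x)
  equivariant : ∀ g ∈ Γ, ∀ x, (μ x).map (Bdry.map g) = μ (g x)
  conformal : ∀ x y, μ x =
    (μ y).withDensity fun ξ => ENNReal.ofReal (Real.exp (-δ * busemann ξ x y))

open scoped Classical in
/-- The visual distance `d_o(ξ, η) = e^{-u}` on `∂T`, with `u` the length of the intersection of the
rays `[o, ξ[` and `[o, η[`. -/
def visualDist (o : V) (ξ η : Bdry T) : ℝ :=
  if ξ = η then 0
  else Real.exp (-((sSup {n : ℕ | ∃ y : V, OnRay o ξ y ∧ OnRay o η y ∧ T.dist o y = n} : ℕ) : ℝ))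

/-- The time `t` such that `ℓ(t)` is the point of `ℓ` which is closest to `o`. -/
def Geod.closestTime (o : V) (l : Geod T) : ℤ :=
  Function.argmin fun t : ℤ => T.dist o (l.toFun t)

/-- The Hopf parametrisation of the space of geodesic lines with respect to the base point `o`. -/
def hopf (o : V) (l : Geod T) : (Bdry T × Bdry T) × ℤ := ((l.bwd, l.fwd), l.closestTime o)

/-- The Bowen-Margulis measure on the space of geodesic lines associated with `(μ_x)`: in the Hopf
parametrisation it is `dμ_o(ℓ₋) dμ_o(ℓ₊) dt / d_o(ℓ₋, ℓ₊)^{2δ}`. -/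
def bowenMargulis (δ : ℝ) (μ : V → Measure (Bdry T)) (o : V) : Measure (Geod T) :=
  Measure.comap (hopf o)
    ((((μ o).prod (μ o)).withDensity fun p =>
      ENNReal.ofReal (1 / visualDist o p.1 p.2 ^ (2 * δ))).prod Measure.count)

/-! ### Quotients by the group -/

/-- The space `Γ\𝒢T`, with the quotient `σ`-algebra. -/
abbrev GeodQuot (Γ : Subgroup (T ≃g T)) : Type _ := Quotient (MulAction.orbitRel Γ (Geod T))

/-- The projection `π : 𝒢T → Γ\𝒢T`. -/
def proj (Γ : Subgroup (T ≃g T)) (l : Geod T) : GeodQuot Γ :=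
  Quotient.mk (MulAction.orbitRel Γ (Geod T)) l

/-- The transformation of `Γ\𝒢T` induced by the `N`-th iterate of the geodesic transformation. -/
def flow (Γ : Subgroup (T ≃g T)) (N : ℕ) : GeodQuot Γ → GeodQuot Γ :=
  Quotient.map (Geod.shift (N : ℤ)) (by
    rintro a b ⟨g, rfl⟩
    exact ⟨g, rfl⟩)

/-- The measure induced on `Γ\𝒢T` by a `Γ`-invariant measure `m` on `𝒢T`, where `Γ` is discrete:
the sum over the orbits of vertices `Γx` of `1 / |Γ_x|` times the image of the restriction of `m` to
the set of geodesic lines with origin `x`. It is the measure characterised by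
`∫ (∑_{γ ∈ Γ} f (γ ℓ)) d(quotientMeasure) = ∫ f dm` for all measurable `f ≥ 0`; if almost every
`ℓ` has a trivial stabiliser it is the restriction of `m` to any fundamental domain. -/
def quotientMeasure (Γ : Subgroup (T ≃g T)) (m : Measure (Geod T)) : Measure (GeodQuot Γ) :=
  Measure.sum fun c : MulAction.orbitRel.Quotient Γ V =>
    ((Nat.card (MulAction.stabilizer Γ (Quotient.out c : V)) : ℝ≥0∞)⁻¹) •
      (m.restrict {l | l.toFun 0 = (Quotient.out c : V)}).map (proj Γ)

/-! ### Ergodic theory -/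

/-- `(m, f)` is a mixing measure preserving system (with `m` a probability measure). -/
def IsMixing {α : Type*} [MeasurableSpace α] (f : α → α) (m : Measure α) : Prop :=
  MeasurePreserving f m m ∧
    ∀ A B : Set α, MeasurableSet A → MeasurableSet B →
      Tendsto (fun n : ℕ => m (A ∩ f^[n] ⁻¹' B)) atTop (𝓝 (m A * m B))

/-- The first return map of `f` to `A`: `x ↦ f^k x`, with `k ≥ 1` minimal such that
`f^k x ∈ A`. -/
def firstReturn {α : Type*} (f : α → α) (A : Set α) (x : α) : α :=
  f^[sInf {k : ℕ | 0 < k ∧ f^[k] x ∈ A}] x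

/-! ### The system of the geodesics starting in an orbit -/

/-- `𝒢'T`, the set of the geodesic lines with origin in `V'`. -/
def geodFrom (T : SimpleGraph V) (V' : Set V) : Set (Geod T) := {l | l.toFun 0 ∈ V'}

/-- `V'` is `Γ`-invariant and, for every `ℓ` with origin in `V'` and every `t`, the vertex `ℓ(t)`
belongs to `V'` if and only if it is the origin of the image of `ℓ` by some power (in `ℤ`) of the
`N`-th iterate of the geodesic transformation. -/
def IsAdapted (Γ : Subgroup (T ≃g T)) (N : ℕ) (V' : Set V) : Prop :=
  (∀ g ∈ Γ, ∀ x ∈ V', g x ∈ V') ∧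
  ∀ l ∈ geodFrom T V', ∀ t : ℤ,
    l.toFun t ∈ V' ↔ ∃ n : ℤ, (l.shift (n * (N : ℤ))).toFun 0 = l.toFun t

/-- `𝒢'T(x)`: the elements of `𝒢'T` which meet the orbit `Γx` at infinitely many positive times and
at infinitely many negative times. -/
def recurrent (Γ : Subgroup (T ≃g T)) (V' : Set V) (x : V) : Set (Geod T) :=
  {l | l ∈ geodFrom T V' ∧
    {t : ℤ | 0 < t ∧ l.toFun t ∈ MulAction.orbit Γ x}.Infinite ∧
    {t : ℤ | t < 0 ∧ l.toFun t ∈ MulAction.orbit Γ x}.Infinite}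

/-- The set of the elements of `𝒢'T(x₀)` with origin in `Γx₀`. -/
def preSection (Γ : Subgroup (T ≃g T)) (V' : Set V) (x₀ : V) : Set (Geod T) :=
  {l | l ∈ recurrent Γ V' x₀ ∧ l.toFun 0 ∈ MulAction.orbit Γ x₀}

/-- The image `X₀` in `Γ\𝒢T` of the set of the elements of `𝒢'T(x₀)` with origin in `Γx₀`. -/
def section₀ (Γ : Subgroup (T ≃g T)) (V' : Set V) (x₀ : V) : Set (GeodQuot Γ) :=
  proj Γ '' preSection Γ V' x₀

/-- The measure induced on `X₀` by the restriction of the measure `m` to the geodesic lines of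
`𝒢'T(x₀)` with origin in `Γx₀`, before normalisation. -/
def sectionMeasure (Γ : Subgroup (T ≃g T)) (V' : Set V) (x₀ : V) (m : Measure (Geod T)) :
    Measure (section₀ Γ V' x₀) :=
  (quotientMeasure Γ (m.restrict (preSection Γ V' x₀))).comap Subtype.val

/-- The probability measure `m₀` on `X₀`. -/
def sectionProb (Γ : Subgroup (T ≃g T)) (V' : Set V) (x₀ : V) (m : Measure (Geod T)) :
    Measure (section₀ Γ V' x₀) :=
  (sectionMeasure Γ V' x₀ m univ)⁻¹ • sectionMeasure Γ V' x₀ m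

/-! ### The Markov shift -/

/-- The vertex `z` lies on the geodesic segment `[x, y]`. -/
def OnSegment (T : SimpleGraph V) (x y z : V) : Prop := T.dist x z + T.dist z y = T.dist x y

/-- The alphabet `S`: the elements `γ` of `Γ` which do not fix `x₀` and such that the open segment
`]x₀, γx₀[` does not meet the orbit `Γx₀`. -/
def Alphabet (Γ : Subgroup (T ≃g T)) (x₀ : V) : Type _ :=
  {g : Γ // g ∉ MulAction.stabilizer Γ x₀ ∧
    ∀ z : V, OnSegment T x₀ (g • x₀) z → z ≠ x₀ → z ≠ g • x₀ → z ∉ MulAction.orbit Γ x₀}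

/-- The alphabet is a discrete space. -/
instance (Γ : Subgroup (T ≃g T)) (x₀ : V) : MeasurableSpace (Alphabet Γ x₀) := ⊤

/-- `A_{α,β} = 1` if and only if `x₀` belongs to the segment `[α⁻¹ x₀, β x₀]`. -/
def Allowed {Γ : Subgroup (T ≃g T)} {x₀ : V} (a b : Alphabet Γ x₀) : Prop :=
  OnSegment T (a.1⁻¹ • x₀) (b.1 • x₀) x₀

/-- The subshift `X_A`. -/
def Subshift {S : Type*} (A : S → S → Prop) : Type _ := {s : ℤ → S // ∀ i : ℤ, A (s i) (s (i + 1))}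

/-- The Borel `σ`-algebra of the subshift, for a (countable) discrete alphabet. -/
instance {S : Type*} [MeasurableSpace S] (A : S → S → Prop) : MeasurableSpace (Subshift A) :=
  inferInstanceAs (MeasurableSpace {s : ℤ → S // ∀ i : ℤ, A (s i) (s (i + 1))})

/-- The left shift `σ`. -/
def Subshift.shift {S : Type*} {A : S → S → Prop} (s : Subshift A) : Subshift A :=
  ⟨fun i => s.1 (i + 1), fun i => s.2 (i + 1)⟩

/-- `P` is a stochastic matrix, `ν` is a stationary probability vector of `P`. -/
def IsStochasticStationary {S : Type*} (P : S → S → ℝ≥0∞) (ν : S → ℝ≥0∞) : Prop :=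
  (∀ a, ∑' b, P a b = 1) ∧ ∑' a, ν a = 1 ∧ ∀ b, ∑' a, ν a * P a b = ν b

/-- `m` is the Markov measure on the subshift associated with the stochastic matrix `P` and the
stationary probability `ν`: the shift invariant probability measure with
`m [s_0 = w_0, …, s_k = w_k] = ν_{w_0} ∏_{i < k} P_{w_i, w_{i+1}}`. -/
def IsMarkovMeasure {S : Type*} [MeasurableSpace S] {A : S → S → Prop}
    (P : S → S → ℝ≥0∞) (ν : S → ℝ≥0∞) (m : Measure (Subshift A)) : Prop :=
  IsProbabilityMeasure m ∧ MeasurePreserving Subshift.shift m m ∧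
  ∀ (k : ℕ) (w : Fin (k + 1) → S),
    m {s | ∀ i : Fin (k + 1), s.1 ((i : ℕ) : ℤ) = w i} =
      ν (w 0) * ∏ i : Fin k, P (w i.castSucc) (w i.succ)

open scoped Classical in
/-- The transition probabilities
`π_{α,β} = μ_{x₀}(α ∂_{e_β^+}T) / (|Γ_{x₀}| μ_{x₀}(∂_{e_α^+}T))` if `A_{α,β} = 1`, and `0` otherwise.
Here `∂_{e_α^+}T` is the shadow of `αx₀` seen from `x₀`, and `α ∂_{e_β^+}T` is the shadow of `αβx₀`
seen from `αx₀`. -/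
def transProb (Γ : Subgroup (T ≃g T)) (μ : V → Measure (Bdry T)) (x₀ : V)
    (a b : Alphabet Γ x₀) : ℝ≥0∞ :=
  if Allowed a b then
    μ x₀ (shadow T (a.1 • x₀) ((a.1 * b.1) • x₀)) /
      ((Nat.card (MulAction.stabilizer Γ x₀) : ℝ≥0∞) * μ x₀ (shadow T x₀ (a.1 • x₀)))
  else 0

/-- The stationary weights: `ν_α` is proportional to `μ_{x₀}(∂_{e_α^-}T) μ_{x₀}(∂_{e_α^+}T)`, with
`∂_{e_α^-}T` the shadow of `x₀` seen from `αx₀` and `∂_{e_α^+}T` the shadow of `αx₀` seen from `x₀`.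
The constant is `1 / (|Γ_{x₀}|² M)`, where `M` is the total mass of the measure induced by `m` on
`X₀` before normalisation. -/
def statWeight (Γ : Subgroup (T ≃g T)) (μ : V → Measure (Bdry T)) (V' : Set V) (x₀ : V)
    (m : Measure (Geod T)) (a : Alphabet Γ x₀) : ℝ≥0∞ :=
  (μ x₀ (shadow T (a.1 • x₀) x₀) * μ x₀ (shadow T x₀ (a.1 • x₀))) /
    ((Nat.card (MulAction.stabilizer Γ x₀) : ℝ≥0∞) ^ 2 * sectionMeasure Γ V' x₀ m univ)

end TreeCoding

end

namespace TreeCoding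

/-! ### Geodesics in trees -/

section Tree

variable {V : Type*} {T : SimpleGraph V}

lemma parent_unique (hT : T.IsTree) {x y z z' : V} (h : T.Adj y z) (h' : T.Adj y z')
    (hd : T.dist x z + 1 = T.dist x y) (hd' : T.dist x z' + 1 = T.dist x y) : z = z' := by
  obtain ⟨p, hp⟩ := hT.connected.exists_walk_length_eq_dist x z
  obtain ⟨p', hp'⟩ := hT.connected.exists_walk_length_eq_dist x z'
  have h1 : (p.concat h.symm).IsPath :=
    SimpleGraph.Walk.isPath_of_length_eq_dist _ (by rw [SimpleGraph.Walk.length_concat]; omega)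
  have h2 : (p'.concat h'.symm).IsPath :=
    SimpleGraph.Walk.isPath_of_length_eq_dist _ (by rw [SimpleGraph.Walk.length_concat]; omega)
  have h3 := (hT.existsUnique_path x y).unique h1 h2
  have h4 := congrArg SimpleGraph.Walk.penultimate h3
  simpa using h4

lemma exists_parent (hT : T.IsTree) {x y : V} (h : x ≠ y) :
    ∃ z, T.Adj y z ∧ T.dist x z + 1 = T.dist x y := by
  obtain ⟨p, hp⟩ := hT.connected.exists_walk_length_eq_dist y x
  cases p with
  | nil => exact absurd rfl h
  | cons hadj q =>
    rename_i z
    refine ⟨z, hadj, ?_⟩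
    rw [SimpleGraph.Walk.length_cons] at hp
    have h1 := SimpleGraph.dist_le q
    have h2 : T.dist y x ≤ T.dist y z + T.dist z x := hT.connected.dist_triangle
    rw [SimpleGraph.dist_eq_one_iff_adj.2 hadj] at h2
    rw [SimpleGraph.dist_comm, SimpleGraph.dist_comm (u := x)]
    omega

lemma dist_tri (hT : T.IsTree) (x y z : V) : T.dist x z ≤ T.dist x y + T.dist y z :=
  hT.connected.dist_triangle

lemma dist_zero_iff (hT : T.IsTree) {x y : V} : T.dist x y = 0 ↔ x = y :=
  hT.connected.dist_eq_zero_iff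

lemma OnSegment.symm {x y z : V} (h : OnSegment T x y z) : OnSegment T y x z := by
  unfold OnSegment at *
  rw [SimpleGraph.dist_comm (u := y) (v := z), SimpleGraph.dist_comm (u := z) (v := x),
    SimpleGraph.dist_comm (u := y) (v := x)]
  omega

lemma onSegment_left (x y : V) : OnSegment T x y x := by simp [OnSegment]

lemma onSegment_right (x y : V) : OnSegment T x y y := by simp [OnSegment]

lemma OnSegment.eq_of_dist_eq (hT : T.IsTree) {x y z z' : V} (h : OnSegment T x y z)
    (h' : OnSegment T x y z') (hd : T.dist x z = T.dist x z') : z = z' := by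
  obtain ⟨n, hn⟩ : ∃ n, T.dist z y = n := ⟨_, rfl⟩
  induction n generalizing z z' with
  | zero =>
    have h0 : T.dist z' y = 0 := by unfold OnSegment at h h'; omega
    rw [(dist_zero_iff hT).1 hn, (dist_zero_iff hT).1 h0]
  | succ n ih =>
    have hn' : T.dist z' y = n + 1 := by unfold OnSegment at h h'; omega
    have key : ∀ u : V, OnSegment T x y u → T.dist u y = n + 1 → ∃ w, T.Adj w u ∧
        OnSegment T x y w ∧ T.dist x u + 1 = T.dist x w ∧ T.dist w y = n := by
      intro u hu hun
      have hne : y ≠ u := by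
        rintro rfl
        simp at hun
      obtain ⟨w, hw, hwd⟩ := exists_parent hT hne
      have h1 := SimpleGraph.dist_comm (G := T) (u := y) (v := w)
      have h2 := SimpleGraph.dist_comm (G := T) (u := y) (v := u)
      have h3 := hT.dist_eq_dist_add_one_of_adj x hw
      have h4 := dist_tri hT x w y
      unfold OnSegment at hu ⊢
      exact ⟨w, hw.symm, by omega, by omega, by omega⟩
    obtain ⟨w, hw, hws, hwd, hwn⟩ := key z h hn
    obtain ⟨w', hw', hws', hwd', hwn'⟩ := key z' h' hn'
    obtain rfl := ih hws hws' (by omega) hwn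
    exact parent_unique hT hw hw' hwd hwd'

lemma exists_onSegment (hT : T.IsTree) (x y : V) {n : ℕ} (hn : n ≤ T.dist x y) :
    ∃ z, OnSegment T x y z ∧ T.dist x z = n := by
  obtain ⟨k, hk⟩ := Nat.exists_eq_add_of_le hn
  induction k generalizing n with
  | zero => exact ⟨y, onSegment_right x y, hk⟩
  | succ k ih =>
    obtain ⟨w, hw, hwd⟩ := ih (n := n + 1) (by omega) (by omega)
    have hne : x ≠ w := by
      rintro rfl
      simp at hwd
    obtain ⟨z, hz, hzd⟩ := exists_parent hT hne
    refine ⟨z, ?_, by omega⟩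
    have h1 := dist_tri hT z w y
    have h2 := dist_tri hT x z y
    have h3 := SimpleGraph.dist_eq_one_iff_adj.2 hz.symm
    unfold OnSegment at hw ⊢
    omega

/-- The vertex at distance `n` from `x` on the segment `[x, y]`. -/
noncomputable def segPt (hT : T.IsTree) (x y : V) (n : ℕ) : V :=
  if hn : n ≤ T.dist x y then (exists_onSegment hT x y hn).choose else y

lemma segPt_spec (hT : T.IsTree) {x y : V} {n : ℕ} (hn : n ≤ T.dist x y) :
    OnSegment T x y (segPt hT x y n) ∧ T.dist x (segPt hT x y n) = n := by
  rw [segPt, dif_pos hn]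
  exact (exists_onSegment hT x y hn).choose_spec

lemma OnSegment.dist_le {x y z : V} (h : OnSegment T x y z) : T.dist x z ≤ T.dist x y := by
  unfold OnSegment at h; omega

/-- If `w ∈ [x, y]` and `z ∈ [x, w]`, then `z ∈ [x, y]` and `w ∈ [z, y]`. -/
lemma OnSegment.trans (hT : T.IsTree) {x y z w : V} (hw : OnSegment T x y w)
    (hz : OnSegment T x w z) : OnSegment T x y z ∧ OnSegment T z y w := by
  have h1 := dist_tri hT x z y
  have h2 := dist_tri hT z w y
  unfold OnSegment at *
  constructor <;> omega

lemma OnSegment.dist_between (hT : T.IsTree) {x y z w : V} (hw : OnSegment T x y w)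
    (hz : OnSegment T x y z) (h : T.dist x z ≤ T.dist x w) : OnSegment T x w z := by
  obtain ⟨z', hz', hd⟩ := exists_onSegment hT x w h
  have := hz.eq_of_dist_eq hT (hw.trans hT hz').1 hd.symm
  rwa [this]

/-- Gluing of two overlapping geodesic segments. -/
lemma glue (hT : T.IsTree) {a b c d : V} (hbc : b ≠ c) (h1 : OnSegment T a c b)
    (h2 : OnSegment T b d c) : OnSegment T a d c := by
  obtain ⟨n, hn⟩ : ∃ n, T.dist c d = n := ⟨_, rfl⟩
  induction n generalizing b c with
  | zero =>
    obtain rfl := (dist_zero_iff hT).1 hn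
    exact onSegment_right _ _
  | succ n ih =>
    have hne : d ≠ c := by
      rintro rfl
      simp at hn
    obtain ⟨v, hv, hvd⟩ := exists_parent hT hne
    obtain ⟨u, hu, hud⟩ := exists_parent hT hbc
    have e1 := SimpleGraph.dist_comm (G := T) (u := d) (v := v)
    have e2 := SimpleGraph.dist_comm (G := T) (u := d) (v := c)
    have e3 := dist_tri hT a b u
    have e4 := hT.dist_eq_dist_add_one_of_adj a hu
    have e5 := hT.dist_eq_dist_add_one_of_adj a hv
    have e6 := hT.dist_eq_dist_add_one_of_adj b hv
    have e7 := dist_tri hT b v d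
    have e8 := SimpleGraph.dist_eq_one_iff_adj.2 hv
    unfold OnSegment at *
    have e9 : T.dist a v = T.dist a c + 1 := by
      by_contra hcon
      have : v = u := parent_unique hT (x := a) hv hu (by omega) (by omega)
      subst this
      omega
    have := @ih c v hv.ne (by omega) (by omega) (by omega)
    omega

/-- A path without backtracking which once moves away from `x` moves away from `x` forever. -/
lemma dist_of_nonbacktracking (hT : T.IsTree) {f : ℕ → V} (hadj : ∀ n, T.Adj (f n) (f (n + 1)))
    (hf : ∀ n, f n ≠ f (n + 2)) {x : V} (h : T.dist x (f 1) = T.dist x (f 0) + 1) (n : ℕ) :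
    T.dist x (f n) = T.dist x (f 0) + n := by
  have key : ∀ n, T.dist x (f (n + 1)) = T.dist x (f n) + 1 := by
    intro n
    induction n with
    | zero => exact h
    | succ n ih =>
      have h1 := hT.dist_eq_dist_add_one_of_adj x (hadj (n + 1))
      by_contra hcon
      exact hf n (parent_unique hT (hadj n).symm (hadj (n + 1)) ih.symm
        (show T.dist x (f (n + 1 + 1)) + 1 = _ by omega))
  induction n with
  | zero => rfl
  | succ n ih => rw [key, ih]; omega

/-! ### Rays -/

lemma Ray.dist_zero (hT : T.IsTree) (r : Ray T) (n : ℕ) : T.dist (r.toFun 0) (r.toFun n) = n := by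
  have := dist_of_nonbacktracking hT r.adj (fun n h => by have := r.inj h; omega)
    (x := r.toFun 0) (by simpa using r.adj 0) n
  simpa using this

/-- The ray starting at time `n`. -/
def Ray.tail (r : Ray T) (n : ℕ) : Ray T where
  toFun k := r.toFun (n + k)
  adj k := r.adj (n + k)
  inj a b h := by have := r.inj h; omega

lemma Ray.tail_endpoint (r : Ray T) (n : ℕ) : (r.tail n).endpoint = r.endpoint :=
  Quotient.sound ⟨0, n, fun k => by simp [Ray.tail]⟩

lemma Ray.dist_add (hT : T.IsTree) (r : Ray T) (m n : ℕ) :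
    T.dist (r.toFun m) (r.toFun (m + n)) = n :=
  (r.tail m).dist_zero hT n

lemma Ray.onSegment (hT : T.IsTree) (r : Ray T) {m n : ℕ} (h : m ≤ n) :
    OnSegment T (r.toFun 0) (r.toFun n) (r.toFun m) := by
  obtain ⟨k, rfl⟩ := Nat.exists_eq_add_of_le h
  rw [OnSegment, r.dist_zero hT, r.dist_zero hT, r.dist_add hT]

lemma Ray.exists_of_adj (hT : T.IsTree) (r : Ray T) {x : V} (h : T.Adj x (r.toFun 0)) :
    ∃ q : Ray T, q.toFun 0 = x ∧ q.endpoint = r.endpoint := by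
  have h0 : T.dist x (r.toFun 0) = 1 := SimpleGraph.dist_eq_one_iff_adj.2 h
  rcases hT.dist_eq_dist_add_one_of_adj x (r.adj 0) with h1 | h1
  · refine ⟨r.tail 1, ((dist_zero_iff hT).1 ?_).symm, r.tail_endpoint 1⟩
    change T.dist x (r.toFun (0 + 1)) = 0
    omega
  · have key := dist_of_nonbacktracking hT r.adj (fun n h => by have := r.inj h; omega)
      (x := x) (by omega)
    have hx : ∀ n, r.toFun n ≠ x := by
      rintro n rfl
      have := key n
      simp at this
      omega
    refine ⟨⟨fun n => Nat.casesOn n x r.toFun, ?_, ?_⟩, rfl, ?_⟩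
    · rintro (_ | n)
      · exact h
      · exact r.adj n
    · rintro (_ | a) (_ | b) hab
      · rfl
      · exact absurd hab.symm (hx b)
      · exact absurd hab (hx a)
      · exact congrArg _ (r.inj hab)
    · exact Quotient.sound ⟨1, 0, fun k => by simp [Nat.add_comm 1 k]⟩

lemma exists_ray (hT : T.IsTree) (x : V) (ξ : Bdry T) :
    ∃ q : Ray T, q.toFun 0 = x ∧ q.endpoint = ξ := by
  obtain ⟨r, rfl⟩ := Quotient.exists_rep ξ
  obtain ⟨p⟩ := hT.connected.preconnected x (r.toFun 0)
  generalize hy : r.toFun 0 = y at p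
  induction p with
  | nil => exact ⟨r, hy, rfl⟩
  | cons h p ih =>
    obtain ⟨q, hq, hqe⟩ := ih hy
    obtain ⟨q', hq', hqe'⟩ := q.exists_of_adj hT (by rw [hq]; exact h)
    exact ⟨q', hq', hqe'.trans hqe⟩

lemma Ray.eq_of_endpoint_eq (hT : T.IsTree) {q q' : Ray T} (h0 : q.toFun 0 = q'.toFun 0)
    (he : q.endpoint = q'.endpoint) : q = q' := by
  obtain ⟨m, n, h⟩ := Quotient.exact he
  have hmn : m = n := by
    have h1 := q.dist_zero hT (m + 0)
    have h2 := q'.dist_zero hT (n + 0)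
    rw [← h 0, ← h0] at h2
    omega
  subst hmn
  ext i
  have h1 := q.onSegment hT (Nat.le_add_left i m)
  have h2 := q'.onSegment hT (Nat.le_add_left i m)
  rw [← h, ← h0] at h2
  refine h1.eq_of_dist_eq hT h2 ?_
  rw [q.dist_zero hT, h0, q'.dist_zero hT]

/-- The geodesic ray `[x, ξ[`. -/
noncomputable def rayTo (hT : T.IsTree) (x : V) (ξ : Bdry T) : Ray T := (exists_ray hT x ξ).choose

@[simp] lemma rayTo_zero (hT : T.IsTree) (x : V) (ξ : Bdry T) : (rayTo hT x ξ).toFun 0 = x :=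
  (exists_ray hT x ξ).choose_spec.1

@[simp] lemma rayTo_endpoint (hT : T.IsTree) (x : V) (ξ : Bdry T) :
    (rayTo hT x ξ).endpoint = ξ :=
  (exists_ray hT x ξ).choose_spec.2

lemma rayTo_eq (hT : T.IsTree) {x : V} {ξ : Bdry T} {r : Ray T} (h0 : r.toFun 0 = x)
    (he : r.endpoint = ξ) : rayTo hT x ξ = r :=
  Ray.eq_of_endpoint_eq hT (by simp [h0]) (by simp [he])

lemma onRay_iff (hT : T.IsTree) {x y : V} {ξ : Bdry T} :
    OnRay x ξ y ↔ (rayTo hT x ξ).toFun (T.dist x y) = y := by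
  constructor
  · rintro ⟨r, h0, he, n, rfl⟩
    have := r.dist_zero hT n
    rw [h0] at this
    rw [rayTo_eq hT h0 he, this]
  · intro h
    exact ⟨rayTo hT x ξ, by simp, by simp, _, h⟩

lemma rayTo_eq_iff (hT : T.IsTree) {x y : V} {ξ : Bdry T} {n : ℕ} :
    (rayTo hT x ξ).toFun n = y ↔ T.dist x y = n ∧ OnRay x ξ y := by
  constructor
  · rintro rfl
    have := (rayTo hT x ξ).dist_zero hT n
    rw [rayTo_zero] at this
    exact ⟨this, rayTo hT x ξ, by simp, by simp, n, rfl⟩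
  · rintro ⟨rfl, h⟩
    exact (onRay_iff hT).1 h

/-- The ray `[x, ξ[` passes through `y` if and only if `y` belongs to the segments from `x` to the
far away points of a given ray with endpoint `ξ`. -/
lemma onRay_iff_eventually (hT : T.IsTree) {x y : V} {r : Ray T} :
    OnRay x r.endpoint y ↔ ∀ᶠ n in atTop, OnSegment T x (r.toFun n) y := by
  set q := rayTo hT x r.endpoint with hq
  have hq0 : q.toFun 0 = x := by simp [hq]
  obtain ⟨m, n, h⟩ : (raySetoid T).r q r := Quotient.exact (by simp [hq] : q.endpoint = r.endpoint)
  constructor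
  · rintro hy
    rw [onRay_iff hT, ← hq] at hy
    filter_upwards [eventually_ge_atTop (n + T.dist x y)] with i hi
    obtain ⟨k, rfl⟩ := Nat.exists_eq_add_of_le (show n ≤ i by omega)
    have := q.onSegment hT (show T.dist x y ≤ m + k by omega)
    rwa [hy, h, hq0] at this
  · intro hy
    obtain ⟨i, hi, hyi⟩ := ((eventually_ge_atTop n).and hy).exists
    obtain ⟨k, rfl⟩ := Nat.exists_eq_add_of_le hi
    rw [← h] at hyi
    have hle := hyi.dist_le
    have hx := q.dist_zero hT
    rw [hq0] at hx
    rw [hx] at hle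
    have := q.onSegment hT hle
    rw [hq0] at this
    rw [onRay_iff hT, ← hq]
    exact this.eq_of_dist_eq hT hyi (hx _)

end Tree

/-! ### Geodesic lines -/

section Lines

variable {V : Type*} {T : SimpleGraph V}

lemma Geod.ext_iff_forall {l l' : Geod T} : l = l' ↔ ∀ t, l.toFun t = l'.toFun t :=
  ⟨fun h _ => h ▸ rfl, fun h => Geod.ext (funext h)⟩

/-- The ray followed by a geodesic line after the time `a`. -/
def Geod.rayFrom (l : Geod T) (a : ℤ) : Ray T where
  toFun n := l.toFun (a + n)
  adj n := by
    have h := l.adj (a + n)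
    push_cast
    rwa [← add_assoc]
  inj i j h := by have := l.inj h; omega

/-- The geodesic line with the reversed orientation. -/
def Geod.reverse (l : Geod T) : Geod T where
  toFun t := l.toFun (-t)
  adj n := by
    have h := l.adj (-(n + 1))
    rw [show -(n + 1) + 1 = -n by ring] at h
    exact h.symm
  inj a b h := by have := l.inj h; omega

@[simp] lemma Geod.rayFrom_apply (l : Geod T) (a : ℤ) (n : ℕ) :
    (l.rayFrom a).toFun n = l.toFun (a + n) := rfl

@[simp] lemma Geod.reverse_apply (l : Geod T) (t : ℤ) : l.reverse.toFun t = l.toFun (-t) := rfl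

@[simp] lemma Geod.shift_apply (l : Geod T) (k t : ℤ) :
    (l.shift k).toFun t = l.toFun (t + k) := rfl

@[simp] lemma Geod.smul_apply (g : T ≃g T) (l : Geod T) (t : ℤ) :
    (g • l).toFun t = g (l.toFun t) := rfl

lemma Geod.reverse_fwd (l : Geod T) : l.reverse.fwd = l.bwd := rfl

lemma Geod.rayFrom_endpoint (l : Geod T) (a : ℤ) : (l.rayFrom a).endpoint = l.fwd := by
  refine Quotient.sound ⟨(-a).toNat, a.toNat, fun k => ?_⟩
  change l.toFun _ = l.toFun _
  congr 1
  push_cast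
  omega

lemma Geod.dist_add (hT : T.IsTree) (l : Geod T) (a : ℤ) (n : ℕ) :
    T.dist (l.toFun a) (l.toFun (a + n)) = n := by
  simpa using (l.rayFrom a).dist_zero hT n

lemma Geod.dist_eq (hT : T.IsTree) (l : Geod T) (a b : ℤ) :
    T.dist (l.toFun a) (l.toFun b) = (b - a).natAbs := by
  rcases le_total a b with h | h
  · have := l.dist_add hT a (b - a).natAbs
    rwa [show a + ((b - a).natAbs : ℤ) = b by omega] at this
  · have := l.dist_add hT b (b - a).natAbs
    rwa [show b + ((b - a).natAbs : ℤ) = a by omega, SimpleGraph.dist_comm] at this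

lemma Geod.onSegment (hT : T.IsTree) (l : Geod T) {a b c : ℤ} (h : a ≤ b) (h' : b ≤ c) :
    OnSegment T (l.toFun a) (l.toFun c) (l.toFun b) := by
  rw [OnSegment, l.dist_eq hT, l.dist_eq hT, l.dist_eq hT]
  omega

lemma Geod.rayTo_fwd (hT : T.IsTree) (l : Geod T) (a : ℤ) :
    rayTo hT (l.toFun a) l.fwd = l.rayFrom a :=
  rayTo_eq hT (by simp) (l.rayFrom_endpoint a)

lemma Geod.rayTo_bwd (hT : T.IsTree) (l : Geod T) (a : ℤ) :
    rayTo hT (l.toFun a) l.bwd = l.reverse.rayFrom (-a) :=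
  rayTo_eq hT (by simp) (l.reverse.rayFrom_endpoint (-a))

lemma Geod.onRay_fwd_iff (hT : T.IsTree) (l : Geod T) {x y : V} :
    OnRay x l.fwd y ↔ ∀ᶠ n : ℕ in atTop, OnSegment T x (l.toFun n) y := by
  rw [← l.rayFrom_endpoint 0, onRay_iff_eventually hT]
  simp

lemma Geod.onRay_bwd_iff (hT : T.IsTree) (l : Geod T) {x y : V} :
    OnRay x l.bwd y ↔ ∀ᶠ n : ℕ in atTop, OnSegment T x (l.toFun (-n)) y :=
  l.reverse.onRay_fwd_iff hT

/-- The endpoints of a geodesic line. -/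
def Geod.ends (l : Geod T) : Bdry T × Bdry T := (l.bwd, l.fwd)

lemma Geod.eq_of_ends (hT : T.IsTree) {l l' : Geod T} (h0 : l.toFun 0 = l'.toFun 0)
    (h : l.ends = l'.ends) : l = l' := by
  obtain ⟨hb, hf⟩ := Prod.ext_iff.1 h
  simp only [Geod.ends] at hb hf
  have h1 := (l.rayTo_fwd hT 0).symm.trans ((congrArg₂ _ h0 hf).trans (l'.rayTo_fwd hT 0))
  have h2 := (l.rayTo_bwd hT 0).symm.trans ((congrArg₂ _ h0 hb).trans (l'.rayTo_bwd hT 0))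
  rw [Geod.ext_iff_forall]
  intro t
  rcases le_total 0 t with ht | ht
  · have := congrArg (fun r => r.toFun t.toNat) h1
    simpa [ht] using this
  · have := congrArg (fun r => r.toFun (-t).toNat) h2
    simpa [ht] using this

lemma Geod.fwd_ne_bwd (hT : T.IsTree) (l : Geod T) : l.fwd ≠ l.bwd := by
  intro h
  have h1 := l.rayTo_fwd hT 0
  rw [h, l.rayTo_bwd hT 0] at h1
  have h2 := congrArg (fun r => r.toFun 1) h1
  simp only [Geod.rayFrom_apply, Geod.reverse_apply] at h2
  have := l.inj h2
  omega

@[simp] lemma Geod.shift_fwd (l : Geod T) (k : ℤ) : (l.shift k).fwd = l.fwd := by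
  rw [← l.rayFrom_endpoint k, ← (l.shift k).rayFrom_endpoint 0]
  exact Quotient.sound ⟨0, 0, fun i => by simp [add_comm]⟩

@[simp] lemma Geod.shift_bwd (l : Geod T) (k : ℤ) : (l.shift k).bwd = l.bwd := by
  rw [← Geod.reverse_fwd, ← Geod.reverse_fwd, ← l.reverse.shift_fwd (-k)]
  congr 1
  rw [Geod.ext_iff_forall]
  intro t
  simp only [Geod.reverse_apply, Geod.shift_apply]
  congr 1
  ring

lemma Geod.smul_ends (g : T ≃g T) (l : Geod T) :
    (g • l).ends = Prod.map (Bdry.map g) (Bdry.map g) l.ends := rfl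

/-- A bi-infinite path without backtracking is a geodesic line. -/
def Geod.ofNonbacktracking (hT : T.IsTree) (f : ℤ → V) (hadj : ∀ n, T.Adj (f n) (f (n + 1)))
    (hf : ∀ n, f n ≠ f (n + 2)) : Geod T where
  toFun := f
  adj := hadj
  inj := by
    have key : ∀ (a : ℤ) (n : ℕ), T.dist (f a) (f (a + n)) = n := by
      intro a n
      have := dist_of_nonbacktracking hT (f := fun n : ℕ => f (a + n))
        (fun n => by push_cast; rw [← add_assoc]; exact hadj _)
        (fun n => by push_cast; rw [← add_assoc]; exact hf _)
        (x := f a) (by simpa using hadj a) n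
      simpa using this
    intro a b hab
    rcases le_total a b with h | h
    · have := key a (b - a).toNat
      rw [show a + ((b - a).toNat : ℤ) = b by omega, hab] at this
      simp at this
      omega
    · have := key b (a - b).toNat
      rw [show b + ((a - b).toNat : ℤ) = a by omega, hab] at this
      simp at this
      omega

/-- Two points at infinity whose rays from `x` have different first edges are the endpoints of
a geodesic line which passes through `x` at time `0`. -/
lemma exists_geod_of_rays (hT : T.IsTree) {x : V} {ξ η : Bdry T}
    (h : (rayTo hT x ξ).toFun 1 ≠ (rayTo hT x η).toFun 1) :
    ∃ l : Geod T, l.toFun 0 = x ∧ l.ends = (ξ, η) := by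
  set q := rayTo hT x ξ with hq
  set r := rayTo hT x η with hr
  have hq0 : q.toFun 0 = x := by simp [hq]
  have hr0 : r.toFun 0 = x := by simp [hr]
  let f : ℤ → V := fun t => if 0 ≤ t then r.toFun t.toNat else q.toFun (-t).toNat
  have f1 : ∀ n : ℕ, f n = r.toFun n := fun n => by simp [f]
  have f2 : ∀ n : ℕ, f (-n) = q.toFun n := fun n => by
    rcases Nat.eq_zero_or_pos n with rfl | hn
    · simp [f, hq0, hr0]
    · have : ¬ (0 : ℤ) ≤ -n := by omega
      simp [f, hn.ne']
  have cases : ∀ t : ℤ, (∃ n : ℕ, t = n) ∨ ∃ n : ℕ, t = -(n + 1 : ℕ) := by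
    intro t
    rcases le_or_gt 0 t with ht | ht
    · exact Or.inl ⟨t.toNat, by omega⟩
    · exact Or.inr ⟨(-t - 1).toNat, by push_cast; omega⟩
  let l : Geod T := Geod.ofNonbacktracking hT f (by
      intro t
      rcases cases t with ⟨n, rfl⟩ | ⟨n, rfl⟩
      · rw [show (n : ℤ) + 1 = (n + 1 : ℕ) by push_cast; rfl, f1, f1]
        exact r.adj n
      · rw [show -((n + 1 : ℕ) : ℤ) + 1 = -(n : ℕ) by push_cast; ring, f2, f2]
        exact (q.adj n).symm) (by
      intro t
      rcases cases t with ⟨n, rfl⟩ | ⟨n, rfl⟩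
      · rw [show (n : ℤ) + 2 = (n + 2 : ℕ) by push_cast; rfl, f1, f1]
        intro hn
        have := r.inj hn
        omega
      · rcases Nat.eq_zero_or_pos n with rfl | hn
        · rw [show -((0 + 1 : ℕ) : ℤ) + 2 = (1 : ℕ) by norm_num, f2, f1]
          exact h
        · rw [show -((n + 1 : ℕ) : ℤ) + 2 = -(n - 1 : ℕ) by omega, f2, f2]
          intro hn
          have := q.inj hn
          omega)
  have hl : ∀ t, l.toFun t = f t := fun t => rfl
  refine ⟨l, ?_, ?_⟩
  · have := f1 0
    rw [hl]
    simpa [hr0] using this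
  · have e1 : l.fwd = r.endpoint := Quotient.sound ⟨0, 0, fun k => by
      exact f1 (0 + k)⟩
    have e2 : l.bwd = q.endpoint := Quotient.sound ⟨0, 0, fun k => by
      exact f2 (0 + k)⟩
    rw [Geod.ends, e1, e2, hq, hr, rayTo_endpoint, rayTo_endpoint]

lemma Geod.rays_ne (hT : T.IsTree) (l : Geod T) :
    (rayTo hT (l.toFun 0) l.bwd).toFun 1 ≠ (rayTo hT (l.toFun 0) l.fwd).toFun 1 := by
  rw [l.rayTo_fwd hT, l.rayTo_bwd hT]
  intro h
  have := l.inj h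
  omega

/-! ### The projection of a vertex to a geodesic line -/

lemma Geod.dist_of_minimal (hT : T.IsTree) (l : Geod T) (o : V) {c : ℤ}
    (hc : ∀ t, T.dist o (l.toFun c) ≤ T.dist o (l.toFun t)) (t : ℤ) :
    T.dist o (l.toFun t) = T.dist o (l.toFun c) + (t - c).natAbs := by
  have key : ∀ (l : Geod T) (c : ℤ), (∀ t, T.dist o (l.toFun c) ≤ T.dist o (l.toFun t)) →
      ∀ n : ℕ, T.dist o (l.toFun (c + n)) = T.dist o (l.toFun c) + n := by
    intro l c hc n
    have h1 := hT.dist_eq_dist_add_one_of_adj o ((l.rayFrom c).adj 0)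
    have h2 := hc (c + 1)
    have := dist_of_nonbacktracking hT (l.rayFrom c).adj
      (fun n h => by have := (l.rayFrom c).inj h; omega) (x := o)
      (by simp at h1 ⊢; omega) n
    simpa using this
  rcases le_total c t with h | h
  · have := key l c hc (t - c).natAbs
    rwa [show c + ((t - c).natAbs : ℤ) = t by omega] at this
  · have := key l.reverse (-c) (by simpa using fun t => hc (-t)) (t - c).natAbs
    rw [Geod.reverse_apply, Geod.reverse_apply, neg_neg] at this
    rwa [show -(-c + ((t - c).natAbs : ℤ)) = t by omega] at this

lemma Geod.closestTime_le (o : V) (l : Geod T) (t : ℤ) :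
    T.dist o (l.toFun (l.closestTime o)) ≤ T.dist o (l.toFun t) :=
  Function.argmin_le (fun t : ℤ => T.dist o (l.toFun t)) t

lemma Geod.dist_closestTime (hT : T.IsTree) (l : Geod T) (o : V) (t : ℤ) :
    T.dist o (l.toFun t) = T.dist o (l.toFun (l.closestTime o)) + (t - l.closestTime o).natAbs :=
  l.dist_of_minimal hT o (l.closestTime_le o) t

lemma Geod.closestTime_eq_iff (hT : T.IsTree) (l : Geod T) (o : V) (c : ℤ) :
    l.closestTime o = c ↔ ∀ t, T.dist o (l.toFun c) ≤ T.dist o (l.toFun t) := by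
  constructor
  · rintro rfl
    exact l.closestTime_le o
  · intro h
    have h1 := h (l.closestTime o)
    have h2 := l.dist_closestTime hT o c
    omega

lemma Geod.onRay_fwd_of_ge (hT : T.IsTree) (l : Geod T) (o : V) {t : ℤ}
    (ht : l.closestTime o ≤ t) : OnRay o l.fwd (l.toFun t) := by
  rw [l.onRay_fwd_iff hT]
  filter_upwards [eventually_ge_atTop t.toNat] with n hn
  rw [OnSegment, l.dist_closestTime hT o t, l.dist_closestTime hT o n, l.dist_eq hT]
  omega

lemma Geod.onRay_bwd_of_le (hT : T.IsTree) (l : Geod T) (o : V) {t : ℤ}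
    (ht : t ≤ l.closestTime o) : OnRay o l.bwd (l.toFun t) := by
  rw [l.onRay_bwd_iff hT]
  filter_upwards [eventually_ge_atTop (-t).toNat] with n hn
  rw [OnSegment, l.dist_closestTime hT o t, l.dist_closestTime hT o (-n), l.dist_eq hT]
  omega

lemma Geod.visualDist_eq (hT : T.IsTree) (l : Geod T) (o : V) :
    visualDist o l.bwd l.fwd = Real.exp (-(T.dist o (l.toFun (l.closestTime o)) : ℝ)) := by
  rw [visualDist, if_neg (l.fwd_ne_bwd hT).symm]
  set c := l.closestTime o with hc
  set u := T.dist o (l.toFun c) with hu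
  congr 3
  have hg : IsGreatest {n : ℕ | ∃ y : V, OnRay o l.bwd y ∧ OnRay o l.fwd y ∧ T.dist o y = n} u := by
    refine ⟨⟨_, l.onRay_bwd_of_le hT o le_rfl, l.onRay_fwd_of_ge hT o le_rfl, rfl⟩, ?_⟩
    rintro n ⟨y, hb, hf, rfl⟩
    by_contra! hlt
    have d1 : T.dist o (l.toFun (c + (T.dist o y - u : ℕ))) = T.dist o y := by
      rw [l.dist_closestTime hT, ← hc, ← hu]; omega
    have d2 : T.dist o (l.toFun (c - (T.dist o y - u : ℕ))) = T.dist o y := by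
      rw [l.dist_closestTime hT, ← hc, ← hu]; omega
    have h1 := (onRay_iff hT).1 (l.onRay_fwd_of_ge hT o
      (show l.closestTime o ≤ c + (T.dist o y - u : ℕ) by omega))
    have h2 := (onRay_iff hT).1 (l.onRay_bwd_of_le hT o
      (show c - (T.dist o y - u : ℕ) ≤ l.closestTime o by omega))
    rw [d1, (onRay_iff hT).1 hf] at h1
    rw [d2, (onRay_iff hT).1 hb] at h2
    have := l.inj (h1.symm.trans h2)
    omega
  exact_mod_cast hg.csSup_eq

/-! ### The Busemann function -/

lemma busemann_eq {r : Ray T} {x y : V} {c : ℝ}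
    (h : ∀ᶠ n : ℕ in atTop, (T.dist x (r.toFun n) : ℝ) - T.dist (r.toFun n) y = c) :
    busemann r.endpoint x y = c := by
  obtain ⟨m, n, hmn⟩ : (raySetoid T).r (Quotient.out r.endpoint) r :=
    Quotient.exact (Quotient.out_eq r.endpoint)
  refine Tendsto.limUnder_eq (Tendsto.congr' ?_ tendsto_const_nhds)
  obtain ⟨N, hN⟩ := eventually_atTop.1 h
  filter_upwards [eventually_ge_atTop (m + N)] with i hi
  obtain ⟨k, rfl⟩ := Nat.exists_eq_add_of_le (show m ≤ i by omega)
  have h' := hmn k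
  rw [h']
  exact (hN (n + k) (by omega)).symm

lemma tendsto_busemann (hT : T.IsTree) (ξ : Bdry T) (x y : V) :
    Tendsto (fun n : ℕ => (n : ℝ) - T.dist ((rayTo hT x ξ).toFun n) y) atTop
      (𝓝 (busemann ξ x y)) := by
  obtain ⟨m, n, h⟩ : (raySetoid T).r (rayTo hT x ξ) (rayTo hT y ξ) :=
    Quotient.exact ((rayTo_endpoint hT x ξ).trans (rayTo_endpoint hT y ξ).symm)
  have hd : ∀ i, T.dist x ((rayTo hT x ξ).toFun i) = i := fun i => by
    simpa using (rayTo hT x ξ).dist_zero hT i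
  have key : ∀ᶠ i : ℕ in atTop, (i : ℝ) - T.dist ((rayTo hT x ξ).toFun i) y = m - n := by
    filter_upwards [eventually_ge_atTop m] with i hi
    obtain ⟨k, rfl⟩ := Nat.exists_eq_add_of_le hi
    have h2 := (rayTo hT y ξ).dist_zero hT (n + k)
    rw [rayTo_zero] at h2
    rw [h k, SimpleGraph.dist_comm, h2]
    push_cast
    ring
  have e : busemann ξ x y = m - n := by
    have := busemann_eq (r := rayTo hT x ξ) (x := x) (y := y) (c := m - n)
      (by simpa only [hd] using key)
    rwa [rayTo_endpoint] at this
  rw [e]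
  exact Tendsto.congr' (key.mono fun _ h => h.symm) tendsto_const_nhds

lemma busemann_of_onRay (hT : T.IsTree) {ξ : Bdry T} {x y : V} (h : OnRay x ξ y) :
    busemann ξ x y = T.dist x y := by
  obtain ⟨r, h0, rfl, n, rfl⟩ := h
  refine busemann_eq ?_
  filter_upwards [eventually_ge_atTop n] with i hi
  have := r.onSegment hT hi
  rw [OnSegment, h0] at this
  rw [SimpleGraph.dist_comm (u := r.toFun i), ← this]
  push_cast
  ring

lemma Geod.busemann_fwd (hT : T.IsTree) (l : Geod T) (o : V) :
    busemann l.fwd (l.toFun 0) o = l.closestTime o - T.dist o (l.toFun (l.closestTime o)) := by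
  rw [← l.rayFrom_endpoint 0]
  refine busemann_eq ?_
  filter_upwards [eventually_ge_atTop (l.closestTime o).natAbs] with n hn
  rw [SimpleGraph.dist_comm (v := o), Geod.rayFrom_apply, l.dist_closestTime hT o, l.dist_eq hT]
  have e1 : ((0 + n : ℤ) - 0).natAbs = n := by simp
  have e2 : (((0 + n : ℤ) - l.closestTime o).natAbs : ℤ) = n - l.closestTime o := by omega
  have e3 : (((0 + n : ℤ) - l.closestTime o).natAbs : ℝ) = n - l.closestTime o := by
    rw [← Int.cast_natCast, e2]
    push_cast
    rfl
  rw [e1, Nat.cast_add, e3]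
  ring

lemma Geod.busemann_bwd (hT : T.IsTree) (l : Geod T) (o : V) :
    busemann l.bwd (l.toFun 0) o = -l.closestTime o - T.dist o (l.toFun (l.closestTime o)) := by
  have h : l.reverse.closestTime o = -l.closestTime o := by
    rw [l.reverse.closestTime_eq_iff hT]
    intro t
    simpa using l.closestTime_le o (-t)
  have := l.reverse.busemann_fwd hT o
  rw [h, Geod.reverse_fwd] at this
  simpa using this

lemma Geod.density_eq (hT : T.IsTree) (l : Geod T) (o : V) (δ : ℝ) :
    ENNReal.ofReal (1 / visualDist o l.bwd l.fwd ^ (2 * δ)) =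
      ENNReal.ofReal (Real.exp (-δ * busemann l.bwd (l.toFun 0) o)) *
        ENNReal.ofReal (Real.exp (-δ * busemann l.fwd (l.toFun 0) o)) := by
  rw [← ENNReal.ofReal_mul (Real.exp_nonneg _), ← Real.exp_add, l.busemann_fwd hT,
    l.busemann_bwd hT, l.visualDist_eq hT, ← Real.exp_mul, one_div, ← Real.exp_neg]
  congr 2
  ring

end Lines

/-! ### Measurability -/

/-- Measurability of a map to a discrete space. -/
def DiscMeas {α Y : Type*} [MeasurableSpace α] (f : α → Y) : Prop :=
  ∀ s : Set Y, MeasurableSet (f ⁻¹' s)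

section DiscMeas

variable {α β Y Z : Type*} [MeasurableSpace α] [MeasurableSpace β]

lemma DiscMeas.of_singleton [Countable Y] {f : α → Y} (h : ∀ y, MeasurableSet {a | f a = y}) :
    DiscMeas f := by
  intro s
  have : f ⁻¹' s = ⋃ y ∈ s, {a | f a = y} := by
    ext a
    simp
  rw [this]
  exact MeasurableSet.biUnion s.to_countable fun y _ => h y

lemma DiscMeas.map {f : α → Y} (hf : DiscMeas f) (g : Y → Z) : DiscMeas fun a => g (f a) :=
  fun s => hf (g ⁻¹' s)

lemma DiscMeas.comp {f : α → Y} (hf : DiscMeas f) {g : β → α} (hg : Measurable g) :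
    DiscMeas fun b => f (g b) :=
  fun s => hg (hf s)

lemma DiscMeas.pair [Countable Y] [Countable Z] {f : α → Y} {g : α → Z} (hf : DiscMeas f)
    (hg : DiscMeas g) : DiscMeas fun a => (f a, g a) := by
  refine DiscMeas.of_singleton fun y => ?_
  have : {a | (f a, g a) = y} = f ⁻¹' {y.1} ∩ g ⁻¹' {y.2} := by
    ext a
    simp [Prod.ext_iff]
  rw [this]
  exact (hf _).inter (hg _)

lemma DiscMeas.measurable [MeasurableSpace Y] {f : α → Y} (hf : DiscMeas f) : Measurable f :=
  fun s _ => hf s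

lemma DiscMeas.setOf {f : α → Y} (hf : DiscMeas f) (p : Y → Prop) : MeasurableSet {a | p (f a)} :=
  hf {y | p y}

lemma measurableSet_eventually {p : ℕ → α → Prop} (h : ∀ n, MeasurableSet {a | p n a}) :
    MeasurableSet {a | ∀ᶠ n in atTop, p n a} := by
  have : {a | ∀ᶠ n in atTop, p n a} = ⋃ N : ℕ, ⋂ n : ℕ, ⋂ _ : N ≤ n, {a | p n a} := by
    ext a
    simp [eventually_atTop]
  rw [this]
  exact MeasurableSet.iUnion fun N => MeasurableSet.iInter fun n => MeasurableSet.iInter fun _ => h n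

end DiscMeas

section Measurability

variable {V : Type*} {T : SimpleGraph V}

lemma finite_sphere (hT : T.IsTree) (hlf : ∀ x : V, (T.neighborSet x).Finite) (x : V) (n : ℕ) :
    {y | T.dist x y = n}.Finite := by
  induction n with
  | zero =>
    refine (Set.finite_singleton x).subset fun y hy => ?_
    exact ((dist_zero_iff hT).1 hy).symm
  | succ n ih =>
    refine (ih.biUnion fun y _ => hlf y).subset fun y hy => ?_
    have hne : x ≠ y := by
      rintro rfl
      simp at hy
    obtain ⟨z, hz, hzd⟩ := exists_parent hT hne
    simp only [mem_ofPred_eq] at hy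
    exact mem_biUnion (show T.dist x z = n by omega) hz.symm

lemma countable_of_locallyFinite (hT : T.IsTree) (hlf : ∀ x : V, (T.neighborSet x).Finite) :
    Countable V := by
  obtain ⟨x⟩ := hT.connected.nonempty
  have : (univ : Set V) = ⋃ n : ℕ, {y | T.dist x y = n} := by
    ext y
    simp
  rw [← Set.countable_univ_iff, this]
  exact Set.countable_iUnion fun n => (finite_sphere hT hlf x n).countable

lemma measurableSet_shadow (x y : V) : MeasurableSet (shadow T x y) :=
  MeasurableSpace.measurableSet_generateFrom ⟨x, y, rfl⟩

lemma Geod.measurableSet_eval (t : ℤ) (s : Set V) : MeasurableSet {l : Geod T | l.toFun t ∈ s} := by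
  let : MeasurableSpace V := ⊤
  exact ⟨{f | f t ∈ s}, measurable_pi_apply t trivial, rfl⟩

lemma Geod.discMeas_eval (t : ℤ) : DiscMeas fun l : Geod T => l.toFun t :=
  fun s => Geod.measurableSet_eval t s

lemma Geod.measurable_of_eval {α : Type*} [MeasurableSpace α] {f : α → Geod T}
    (h : ∀ t, DiscMeas fun a => (f a).toFun t) : Measurable f := by
  let : MeasurableSpace V := ⊤
  exact measurable_comap_iff.2 (measurable_pi_iff.2 fun t => (h t).measurable)

lemma Geod.measurable_shift (k : ℤ) : Measurable (Geod.shift (T := T) k) :=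
  Geod.measurable_of_eval fun t => Geod.discMeas_eval (t + k)

lemma Geod.measurable_smul (g : T ≃g T) : Measurable fun l : Geod T => g • l :=
  Geod.measurable_of_eval fun t => (Geod.discMeas_eval t).map g

lemma onRay_map_iff (g : T ≃g T) {x y : V} {ξ : Bdry T} :
    OnRay (g x) (Bdry.map g ξ) (g y) ↔ OnRay x ξ y := by
  have key : ∀ (g : T ≃g T) (x y : V) (ξ : Bdry T), OnRay x ξ y →
      OnRay (g x) (Bdry.map g ξ) (g y) := by
    rintro g x y _ ⟨r, rfl, rfl, n, rfl⟩
    exact ⟨r.map g, rfl, rfl, n, rfl⟩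
  refine ⟨fun h => ?_, key g x y ξ⟩
  have h1 := key g⁻¹ _ _ _ h
  have h2 : Bdry.map g⁻¹ (Bdry.map g ξ) = ξ := by
    obtain ⟨r, rfl⟩ := Quotient.exists_rep ξ
    refine Quotient.sound ⟨0, 0, fun k => ?_⟩
    exact g.symm_apply_apply _
  have h3 : ∀ z, g⁻¹ (g z) = z := fun z => g.symm_apply_apply z
  rwa [h2, h3, h3] at h1

lemma map_preimage_shadow (g : T ≃g T) (x y : V) :
    Bdry.map g ⁻¹' shadow T (g x) (g y) = shadow T x y := by
  ext ξ
  exact onRay_map_iff g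

lemma measurable_bdryMap (g : T ≃g T) : Measurable (Bdry.map g) := by
  refine measurable_generateFrom ?_
  rintro _ ⟨x, y, rfl⟩
  obtain ⟨x, rfl⟩ := g.surjective x
  obtain ⟨y, rfl⟩ := g.surjective y
  rw [map_preimage_shadow]
  exact measurableSet_shadow x y

variable [Countable V]

lemma discMeas_rayTo (hT : T.IsTree) (x : V) (n : ℕ) :
    DiscMeas fun ξ : Bdry T => (rayTo hT x ξ).toFun n := by
  refine DiscMeas.of_singleton fun y => ?_
  simp only [rayTo_eq_iff hT]
  by_cases h : T.dist x y = n
  · simp only [h, true_and]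
    exact measurableSet_shadow x y
  · simp [h]

lemma measurable_busemann (hT : T.IsTree) (x y : V) :
    Measurable fun ξ : Bdry T => busemann ξ x y :=
  measurable_of_tendsto_metrizable
    (f := fun (n : ℕ) (ξ : Bdry T) => (n : ℝ) - T.dist ((rayTo hT x ξ).toFun n) y)
    (fun n => ((discMeas_rayTo hT x n).map fun z => (n : ℝ) - T.dist z y).measurable)
    (tendsto_pi_nhds.2 fun ξ => tendsto_busemann hT ξ x y)

lemma Geod.measurableSet_ends_image (hT : T.IsTree) {x : V} {B : Set (Geod T)}
    (hB : MeasurableSet B) (hBx : B ⊆ {l | l.toFun 0 = x}) : MeasurableSet (Geod.ends '' B) := by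
  let U : Set (Bdry T × Bdry T) := {p | (rayTo hT x p.1).toFun 1 ≠ (rayTo hT x p.2).toFun 1}
  have hU : MeasurableSet U :=
    (((discMeas_rayTo hT x 1).comp measurable_fst).pair
      ((discMeas_rayTo hT x 1).comp measurable_snd)).setOf fun p => p.1 ≠ p.2
  have hex : ∀ p : U, ∃ l : Geod T, l.toFun 0 = x ∧ l.ends = p.1 :=
    fun p => exists_geod_of_rays hT p.2
  choose J hJ0 hJ using hex
  have hJm : Measurable J := by
    refine Geod.measurable_of_eval fun t => ?_
    rcases le_total 0 t with ht | ht
    · have : (fun p => (J p).toFun t) = fun p : U => (rayTo hT x p.1.2).toFun t.toNat := by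
        ext p
        have h2 := (J p).rayTo_fwd hT 0
        rw [hJ0, show (J p).fwd = p.1.2 from congrArg Prod.snd (hJ p)] at h2
        simp [h2, ht]
      rw [this]
      exact (discMeas_rayTo hT x _).comp (measurable_snd.comp measurable_subtype_coe)
    · have : (fun p => (J p).toFun t) = fun p : U => (rayTo hT x p.1.1).toFun (-t).toNat := by
        ext p
        have h2 := (J p).rayTo_bwd hT 0
        rw [hJ0, show (J p).bwd = p.1.1 from congrArg Prod.fst (hJ p)] at h2
        simp [h2, ht]
      rw [this]
      exact (discMeas_rayTo hT x _).comp (measurable_fst.comp measurable_subtype_coe)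
  have : Geod.ends '' B = Subtype.val '' (J ⁻¹' B) := by
    ext p
    constructor
    · rintro ⟨l, hl, rfl⟩
      have hlx : l.toFun 0 = x := hBx hl
      have hlU : l.ends ∈ U := by
        have := l.rays_ne hT
        rwa [hlx] at this
      refine ⟨⟨l.ends, hlU⟩, ?_, rfl⟩
      have : J ⟨l.ends, hlU⟩ = l := Geod.eq_of_ends hT ((hJ0 _).trans hlx.symm) (hJ _)
      rwa [mem_preimage, this]
    · rintro ⟨p, hp, rfl⟩
      exact ⟨J p, hp, hJ p⟩
  rw [this]
  exact hU.subtype_image (hJm hB)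

/-! ### The Bowen-Margulis measure -/

lemma IsPattersonSullivan.prod_eq (hT : T.IsTree) {Γ : Subgroup (T ≃g T)} {δ : ℝ}
    {μ : V → Measure (Bdry T)} (hμ : IsPattersonSullivan Γ δ μ) (x o : V) :
    (μ x).prod (μ x) = ((μ o).prod (μ o)).withDensity fun p =>
      ENNReal.ofReal (Real.exp (-δ * busemann p.1 x o)) *
        ENNReal.ofReal (Real.exp (-δ * busemann p.2 x o)) := by
  have := hμ.finite o
  have hm : Measurable fun ξ : Bdry T => ENNReal.ofReal (Real.exp (-δ * busemann ξ x o)) :=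
    (Real.measurable_exp.comp ((measurable_busemann hT x o).const_mul _)).ennreal_ofReal
  rw [hμ.conformal x o, prod_withDensity hm hm]

/-- The Bowen-Margulis measure on the set of geodesic lines with origin `x` is the image of the
restriction of `μ_x ⊗ μ_x`. -/
lemma bowenMargulis_apply (hT : T.IsTree) {Γ : Subgroup (T ≃g T)} {δ : ℝ}
    {μ : V → Measure (Bdry T)} (hμ : IsPattersonSullivan Γ δ μ) {o : V}
    (hne : bowenMargulis δ μ o ≠ 0) {x : V} {B : Set (Geod T)} (hB : MeasurableSet B)
    (hBx : B ⊆ {l | l.toFun 0 = x}) :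
    bowenMargulis δ μ o B = (μ x).prod (μ x) (Geod.ends '' B) := by
  have := hμ.finite o
  set D := ((μ o).prod (μ o)).withDensity fun p =>
      ENNReal.ofReal (1 / visualDist o p.1 p.2 ^ (2 * δ)) with hD
  have hc : Function.Injective (hopf (T := T) o) ∧
      ∀ s, MeasurableSet s → NullMeasurableSet (hopf o '' s) (D.prod Measure.count) := by
    by_contra hcon
    exact hne (Measure.comap_undef hcon)
  rw [bowenMargulis, ← hD, Measure.comap_apply₀ _ _ hc.1 hc.2 hB.nullMeasurableSet]
  have hE : ∀ t : ℤ, MeasurableSet (B ∩ {l | l.closestTime o = t}) := by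
    intro t
    refine hB.inter ?_
    simp only [Geod.closestTime_eq_iff hT, ofPred_forall]
    exact MeasurableSet.iInter fun s => ((Geod.discMeas_eval t).pair (Geod.discMeas_eval s)).setOf
      fun p => T.dist o p.1 ≤ T.dist o p.2
  have hEm : ∀ t : ℤ, MeasurableSet (Geod.ends '' (B ∩ {l | l.closestTime o = t})) :=
    fun t => Geod.measurableSet_ends_image hT (hE t) fun l hl => hBx hl.1
  have h1 : hopf o '' B =
      ⋃ t : ℤ, (Geod.ends '' (B ∩ {l | l.closestTime o = t})) ×ˢ ({t} : Set ℤ) := by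
    ext ⟨p, t⟩
    simp only [mem_image, mem_iUnion, mem_prod, mem_singleton_iff, hopf, Prod.mk.injEq]
    constructor
    · rintro ⟨l, hl, rfl, rfl⟩
      exact ⟨_, ⟨l, ⟨hl, rfl⟩, rfl⟩, rfl⟩
    · rintro ⟨_, ⟨l, ⟨hl, rfl⟩, rfl⟩, rfl⟩
      exact ⟨l, hl, rfl, rfl⟩
  have h2 : Geod.ends '' B = ⋃ t : ℤ, Geod.ends '' (B ∩ {l | l.closestTime o = t}) := by
    rw [← image_iUnion, ← inter_iUnion]
    congr 1
    ext l
    simp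
  have h3 : D (Geod.ends '' B) = (μ x).prod (μ x) (Geod.ends '' B) := by
    have hm := Geod.measurableSet_ends_image hT hB hBx
    rw [hμ.prod_eq hT x o, hD, withDensity_apply _ hm, withDensity_apply _ hm]
    refine setLIntegral_congr_fun hm ?_
    rintro _ ⟨l, hl, rfl⟩
    have := l.density_eq hT o δ
    rwa [show l.toFun 0 = x from hBx hl] at this
  rw [h1, measure_iUnion, ← h3, h2, measure_iUnion]
  · refine tsum_congr fun t => ?_
    rw [Measure.prod_prod, Measure.count_singleton, mul_one]
  · intro s t hst
    rw [Function.onFun, Set.disjoint_left]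
    rintro _ ⟨l, ⟨hl, hls⟩, rfl⟩ ⟨l', ⟨hl', hlt⟩, he⟩
    obtain rfl := Geod.eq_of_ends hT ((hBx hl').trans (hBx hl).symm) he
    exact hst (hls.symm.trans hlt)
  · exact hEm
  · intro s t hst
    rw [Function.onFun, Set.disjoint_left]
    rintro ⟨p, u⟩ ⟨-, hu⟩ ⟨-, hu'⟩
    exact hst ((mem_singleton_iff.1 hu).symm.trans (mem_singleton_iff.1 hu'))
  · exact fun t => (hEm t).prod (measurableSet_singleton t)

lemma bowenMargulis_smul_preimage (hT : T.IsTree) {Γ : Subgroup (T ≃g T)} {δ : ℝ}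
    {μ : V → Measure (Bdry T)} (hμ : IsPattersonSullivan Γ δ μ) {o : V}
    (hne : bowenMargulis δ μ o ≠ 0) {g : T ≃g T} (hg : g ∈ Γ) {x : V} {B : Set (Geod T)}
    (hB : MeasurableSet B) (hBx : B ⊆ {l | l.toFun 0 = g x}) :
    bowenMargulis δ μ o ((fun l => g • l) ⁻¹' B) = bowenMargulis δ μ o B := by
  have := hμ.finite x
  have hsub : (fun l => g • l) ⁻¹' B ⊆ {l : Geod T | l.toFun 0 = x} :=
    fun l hl => g.injective (hBx hl)
  rw [bowenMargulis_apply hT hμ hne hB hBx,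
    bowenMargulis_apply hT hμ hne (Geod.measurable_smul g hB) hsub, ← hμ.equivariant g hg x,
    Measure.map_prod_map _ _ (measurable_bdryMap g) (measurable_bdryMap g),
    Measure.map_apply ((measurable_bdryMap g).prodMap (measurable_bdryMap g))
      (Geod.measurableSet_ends_image hT hB hBx)]
  congr 1
  ext p
  constructor
  · rintro ⟨l, hl, rfl⟩
    exact ⟨g • l, hl, Geod.smul_ends g l⟩
  · rintro ⟨l, hl, he⟩
    refine ⟨g⁻¹ • l, ?_, ?_⟩
    · rwa [mem_preimage, smul_inv_smul]
    · have hi : Function.LeftInverse (Bdry.map g⁻¹) (Bdry.map g) := by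
        intro ξ
        obtain ⟨r, rfl⟩ := Quotient.exists_rep ξ
        exact Quotient.sound ⟨0, 0, fun k => g.symm_apply_apply _⟩
      rw [Geod.smul_ends, he]
      exact Prod.ext (hi _) (hi _)

end Measurability

/-! ### The action of the group -/

section Quotient

variable {V : Type*} {T : SimpleGraph V}

lemma dist_map (hT : T.IsTree) (g : T ≃g T) (x y : V) : T.dist (g x) (g y) = T.dist x y := by
  have key : ∀ (g : T ≃g T) (x y : V), T.dist (g x) (g y) ≤ T.dist x y := by
    intro g x y
    obtain ⟨p, hp⟩ := hT.connected.exists_walk_length_eq_dist x y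
    rw [← hp, ← p.length_map g.toHom]
    exact SimpleGraph.dist_le _
  refine le_antisymm (key g x y) ?_
  have h := key g.symm (g x) (g y)
  simpa using h

lemma onSegment_map (hT : T.IsTree) (g : T ≃g T) {x y z : V} :
    OnSegment T (g x) (g y) (g z) ↔ OnSegment T x y z := by
  simp only [OnSegment, dist_map hT]

lemma exists_finite_determining {Γ : Subgroup (T ≃g T)} (hdisc : IsDiscrete Γ) :
    ∃ I : Finset V, ∀ g h : Γ, (∀ i ∈ I, g • i = h • i) → g = h := by
  let tV : TopologicalSpace V := ⊥
  let tΓ : TopologicalSpace Γ :=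
    TopologicalSpace.induced (fun (g : Γ) (x : V) => (g : T ≃g T) x) inferInstance
  have : DiscreteTopology Γ := hdisc
  have h1 : IsOpen ({1} : Set Γ) := isOpen_discrete _
  obtain ⟨U, hU, hUe⟩ := isOpen_induced_iff.1 h1
  have h2 : (fun x : V => x) ∈ U := by
    have : (1 : Γ) ∈ (fun (g : Γ) (x : V) => (g : T ≃g T) x) ⁻¹' U := by rw [hUe]; rfl
    exact this
  obtain ⟨I, u, hu, hI⟩ := isOpen_pi_iff.1 hU _ h2
  refine ⟨I, fun g h hgh => ?_⟩
  have h3 : h⁻¹ * g ∈ (fun (g : Γ) (x : V) => (g : T ≃g T) x) ⁻¹' U := by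
    refine hI fun i hi => ?_
    have h4 : (h⁻¹ * g) • i = i := by rw [mul_smul, hgh i hi, inv_smul_smul]
    change (h⁻¹ * g) • i ∈ u i
    rw [h4]
    exact (hu i hi).2
  rw [hUe, mem_singleton_iff, inv_mul_eq_one] at h3
  exact h3.symm

lemma countable_of_isDiscrete [Countable V] {Γ : Subgroup (T ≃g T)} (hdisc : IsDiscrete Γ) :
    Countable Γ := by
  obtain ⟨I, hI⟩ := exists_finite_determining hdisc
  have : Function.Injective fun (g : Γ) (i : I) => g • (i : V) :=
    fun g h hgh => hI g h fun i hi => congrFun hgh ⟨i, hi⟩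
  exact this.countable

lemma finite_stabilizer (hT : T.IsTree) (hlf : ∀ x : V, (T.neighborSet x).Finite)
    {Γ : Subgroup (T ≃g T)} (hdisc : IsDiscrete Γ) (x : V) :
    Finite (MulAction.stabilizer Γ x) := by
  obtain ⟨I, hI⟩ := exists_finite_determining hdisc
  have : ∀ i : I, Finite {y // T.dist x y = T.dist x i} :=
    fun i => (finite_sphere hT hlf x (T.dist x i)).to_subtype
  let F : MulAction.stabilizer Γ x → ∀ i : I, {y // T.dist x y = T.dist x i} :=
    fun g i => ⟨g.1 • (i : V), by
      have := dist_map hT (g.1 : T ≃g T) x i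
      rwa [show (g.1 : T ≃g T) x = x from g.2] at this⟩
  refine Finite.of_injective F fun g h hgh => Subtype.ext (hI _ _ fun i hi => ?_)
  exact congrArg Subtype.val (congrFun hgh ⟨i, hi⟩)

lemma measurable_proj (Γ : Subgroup (T ≃g T)) : Measurable (proj Γ) := fun _ hs => hs

lemma proj_eq_iff {Γ : Subgroup (T ≃g T)} {l l' : Geod T} :
    proj Γ l = proj Γ l' ↔ ∃ g : Γ, g • l' = l :=
  Quotient.eq''

lemma proj_smul {Γ : Subgroup (T ≃g T)} (g : Γ) (l : Geod T) : proj Γ (g • l) = proj Γ l :=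
  proj_eq_iff.2 ⟨g, rfl⟩

lemma proj_preimage_image {Γ : Subgroup (T ≃g T)} {W : Set (Geod T)}
    (hW : ∀ g : Γ, ∀ l ∈ W, g • l ∈ W) : proj Γ ⁻¹' (proj Γ '' W) = W := by
  refine Subset.antisymm ?_ (subset_preimage_image _ _)
  rintro l ⟨l', hl', he⟩
  obtain ⟨g, rfl⟩ := proj_eq_iff.1 he.symm
  exact hW g l' hl'

lemma measurableSet_proj_image {Γ : Subgroup (T ≃g T)} {W : Set (Geod T)}
    (hW : ∀ g : Γ, ∀ l ∈ W, g • l ∈ W) (hm : MeasurableSet W) : MeasurableSet (proj Γ '' W) := by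
  change MeasurableSet (proj Γ ⁻¹' (proj Γ '' W))
  rwa [proj_preimage_image hW]

lemma flow_iterate (Γ : Subgroup (T ≃g T)) (N n : ℕ) (l : Geod T) :
    (flow Γ N)^[n] (proj Γ l) = proj Γ (l.shift (n * N)) := by
  induction n with
  | zero =>
    change proj Γ l = _
    congr 1
    rw [Geod.ext_iff_forall]
    simp
  | succ n ih =>
    rw [Function.iterate_succ_apply', ih]
    change proj Γ _ = _
    congr 1
    rw [Geod.ext_iff_forall]
    intro t
    simp only [Geod.shift_apply]
    congr 1
    push_cast
    ring

lemma quotientMeasure_apply (Γ : Subgroup (T ≃g T)) (m : Measure (Geod T))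
    {F : Set (GeodQuot Γ)} (hF : MeasurableSet F) :
    quotientMeasure Γ m F = ∑' c : MulAction.orbitRel.Quotient Γ V,
      ((Nat.card (MulAction.stabilizer Γ (Quotient.out c : V)) : ℝ≥0∞)⁻¹) *
        m (proj Γ ⁻¹' F ∩ {l | l.toFun 0 = (Quotient.out c : V)}) := by
  rw [quotientMeasure, Measure.sum_apply _ hF]
  refine tsum_congr fun c => ?_
  rw [Measure.smul_apply, Measure.map_apply (measurable_proj Γ) hF,
    Measure.restrict_apply (measurable_proj Γ hF), smul_eq_mul]

/-- Invariance of a measure on the space of geodesic lines. -/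
def IsInvariant (Γ : Subgroup (T ≃g T)) (m : Measure (Geod T)) : Prop :=
  ∀ g : Γ, MeasurePreserving (fun l : Geod T => g • l) m m

lemma IsInvariant.measure_preimage {Γ : Subgroup (T ≃g T)} {m : Measure (Geod T)}
    (hm : IsInvariant Γ m) (g : Γ) {B : Set (Geod T)} (hB : MeasurableSet B) :
    m ((fun l => g • l) ⁻¹' B) = m B :=
  (hm g).measure_preimage hB.nullMeasurableSet

/-- The mass of the set of the geodesic lines of an invariant set with a given origin does not
depend on the choice of this origin in its orbit. -/
lemma IsInvariant.measure_origin {Γ : Subgroup (T ≃g T)} {m : Measure (Geod T)}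
    (hm : IsInvariant Γ m) (g : Γ) (x : V) {F : Set (GeodQuot Γ)} (hF : MeasurableSet F) :
    m (proj Γ ⁻¹' F ∩ {l | l.toFun 0 = g • x}) = m (proj Γ ⁻¹' F ∩ {l | l.toFun 0 = x}) := by
  have hB : MeasurableSet (proj Γ ⁻¹' F ∩ {l | l.toFun 0 = g • x}) :=
    (measurable_proj Γ hF).inter (Geod.measurableSet_eval 0 {g • x})
  rw [← hm.measure_preimage g hB]
  congr 1
  ext l
  simp only [mem_preimage, mem_inter_iff, mem_ofPred_eq, proj_smul]
  refine and_congr_right fun _ => ?_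
  exact (g : T ≃g T).injective.eq_iff

lemma IsInvariant.measure_preimage_proj_eq_zero [Countable V] {Γ : Subgroup (T ≃g T)}
    {m : Measure (Geod T)} (hm : IsInvariant Γ m) {F : Set (GeodQuot Γ)} (hF : MeasurableSet F)
    (h0 : quotientMeasure Γ m F = 0) : m (proj Γ ⁻¹' F) = 0 := by
  rw [quotientMeasure_apply Γ m hF, ENNReal.tsum_eq_zero] at h0
  have hU : proj Γ ⁻¹' F = ⋃ x : V, proj Γ ⁻¹' F ∩ {l | l.toFun 0 = x} := by
    ext l
    simp
  rw [hU]
  refine measure_iUnion_null fun x => ?_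
  have h1 := h0 (Quotient.mk (MulAction.orbitRel Γ V) x)
  rw [mul_eq_zero, or_iff_right (ENNReal.inv_ne_zero.2 (ENNReal.natCast_ne_top _))] at h1
  obtain ⟨g, hg⟩ : x ∈ MulAction.orbit Γ (Quotient.out (Quotient.mk (MulAction.orbitRel Γ V) x)) :=
    (MulAction.orbitRel Γ V).symm (@Quotient.mk_out V (MulAction.orbitRel Γ V) x)
  rw [← hg]
  exact (hm.measure_origin g _ hF).trans h1

lemma isInvariant_restrict_bowenMargulis [Countable V] (hT : T.IsTree) {Γ : Subgroup (T ≃g T)}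
    {δ : ℝ} {μ : V → Measure (Bdry T)} (hμ : IsPattersonSullivan Γ δ μ) {o : V}
    (hne : bowenMargulis δ μ o ≠ 0) {V' : Set V} (hV' : ∀ g ∈ Γ, ∀ x ∈ V', g x ∈ V') :
    IsInvariant Γ ((bowenMargulis δ μ o).restrict (geodFrom T V')) := by
  intro g
  refine ⟨Geod.measurable_smul _, ?_⟩
  ext B hB
  have hV'g : ∀ x, (g : T ≃g T) x ∈ V' ↔ x ∈ V' := fun x => by
    refine ⟨fun h => ?_, hV' g g.2 x⟩
    have := hV' _ (inv_mem g.2) _ h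
    rwa [show (g : T ≃g T)⁻¹ ((g : T ≃g T) x) = x from (g : T ≃g T).symm_apply_apply x] at this
  have hVm : MeasurableSet (geodFrom T V') := Geod.measurableSet_eval 0 V'
  have hgm : Measurable fun l : Geod T => g • l := Geod.measurable_smul _
  rw [Measure.map_apply hgm hB, Measure.restrict_apply hB, Measure.restrict_apply (hgm hB)]
  have e : (fun l : Geod T => g • l) ⁻¹' B ∩ geodFrom T V' =
      (fun l : Geod T => g • l) ⁻¹' (B ∩ geodFrom T V') := by
    ext l
    exact and_congr_right fun _ => (hV'g _).symm
  rw [e]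
  set C := B ∩ geodFrom T V'
  have hC : MeasurableSet C := hB.inter hVm
  have hU : C = ⋃ x : V, C ∩ {l | l.toFun 0 = (g : T ≃g T) x} := by
    ext l
    simp only [mem_iUnion, mem_inter_iff, mem_ofPred_eq]
    exact ⟨fun h => ((g : T ≃g T).surjective (l.toFun 0)).imp fun x hx => ⟨h, hx.symm⟩,
      fun ⟨x, h⟩ => h.1⟩
  have hCm : ∀ x, MeasurableSet (C ∩ {l | l.toFun 0 = (g : T ≃g T) x}) :=
    fun x => hC.inter (Geod.measurableSet_eval 0 {(g : T ≃g T) x})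
  have hdis : Pairwise (Function.onFun Disjoint
      fun x : V => C ∩ {l | l.toFun 0 = (g : T ≃g T) x}) := by
    intro x y hxy
    rw [Function.onFun, Set.disjoint_left]
    rintro l ⟨-, h1⟩ ⟨-, h2⟩
    exact hxy ((g : T ≃g T).injective (h1.symm.trans h2))
  rw [hU, preimage_iUnion, measure_iUnion _ fun x => hgm (hCm x), measure_iUnion hdis hCm]
  · exact tsum_congr fun x =>
      bowenMargulis_smul_preimage hT hμ hne g.2 (hCm x) inter_subset_right
  · exact fun x y hxy => (hdis hxy).preimage _

/-! ### Recurrence -/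

lemma smul_mem_orbit {G X : Type*} [Group G] [MulAction G X] (g : G) {x y : X}
    (h : y ∈ MulAction.orbit G x) : g • y ∈ MulAction.orbit G x := by
  obtain ⟨k, rfl⟩ := h
  exact ⟨g * k, mul_smul g k x⟩


lemma IsMixing.measure_eq_one {α : Type*} [MeasurableSpace α] {f : α → α} {m : Measure α}
    [IsProbabilityMeasure m] (h : IsMixing f m) {E : Set α} (hE : MeasurableSet E)
    (hinv : f ⁻¹' E = E) (hpos : m E ≠ 0) : m E = 1 := by
  have h1 : ∀ n : ℕ, f^[n] ⁻¹' E = E := by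
    intro n
    induction n with
    | zero => rfl
    | succ n ih => rw [Function.iterate_succ, preimage_comp, ih, hinv]
  have h2 := h.2 E E hE hE
  simp only [h1, inter_self] at h2
  have h3 := tendsto_nhds_unique h2 tendsto_const_nhds
  have h4 : m E * m E = 1 * m E := by rw [one_mul]; exact h3
  exact (ENNReal.mul_left_inj hpos (measure_ne_top m E)).1 h4

lemma preimage_frequently {α : Type*} (f : α → α) (A : Set α) :
    f ⁻¹' {z | ∃ᶠ n : ℕ in atTop, f^[n] z ∈ A} = {z | ∃ᶠ n : ℕ in atTop, f^[n] z ∈ A} := by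
  ext z
  simp only [mem_preimage, mem_ofPred_eq, ← Function.iterate_succ_apply, frequently_atTop]
  constructor
  · intro h a
    obtain ⟨b, hb, h⟩ := h a
    exact ⟨b + 1, by omega, h⟩
  · intro h a
    obtain ⟨b, hb, h⟩ := h (a + 1)
    obtain ⟨b, rfl⟩ := Nat.exists_eq_add_of_le' (show 1 ≤ b by omega)
    exact ⟨b, by omega, h⟩

lemma measurableSet_frequently {α : Type*} [MeasurableSpace α] {f : α → α} (hf : Measurable f)
    {A : Set α} (hA : MeasurableSet A) : MeasurableSet {z | ∃ᶠ n : ℕ in atTop, f^[n] z ∈ A} :=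
  (measurableSet_eventually fun n => (hf.iterate n hA).compl).compl

lemma infinite_of_frequently {N : ℕ} (hN : 1 ≤ N) {P : ℤ → Prop}
    (h : ∃ᶠ n : ℕ in atTop, P (n * N)) : {t : ℤ | 0 < t ∧ P t}.Infinite := by
  rw [Nat.frequently_atTop_iff_infinite] at h
  have hinj : Function.Injective fun n : ℕ => (n * N : ℤ) := by
    intro a b hab
    have hN' : (N : ℤ) ≠ 0 := by omega
    exact_mod_cast mul_right_cancel₀ hN' hab
  refine ((h.sdiff (finite_singleton 0)).image hinj.injOn).mono ?_
  rintro _ ⟨n, ⟨hn, hn0⟩, rfl⟩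
  refine ⟨?_, hn⟩
  have : 0 < n := Nat.pos_of_ne_zero hn0
  positivity

lemma exists_recurrent [Countable V] {Γ : Subgroup (T ≃g T)} {V' : Set V} {N : ℕ} (hN : 1 ≤ N)
    {m : Measure (Geod T)} (hm : IsInvariant Γ m) (hsupp : m (geodFrom T V')ᶜ = 0)
    [IsProbabilityMeasure (quotientMeasure Γ m)] (hmix : IsMixing (flow Γ N) (quotientMeasure Γ m)) :
    ∃ x ∈ V', m (recurrent Γ V' x)ᶜ = 0 := by
  set Q := quotientMeasure Γ m with hQ
  have hWm : ∀ x : V, MeasurableSet {l : Geod T | l.toFun 0 ∈ MulAction.orbit Γ x} :=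
    fun x => Geod.measurableSet_eval 0 _
  have hWi : ∀ x : V, ∀ g : Γ, ∀ l ∈ {l : Geod T | l.toFun 0 ∈ MulAction.orbit Γ x},
      g • l ∈ {l : Geod T | l.toFun 0 ∈ MulAction.orbit Γ x} :=
    fun x g l hl => smul_mem_orbit g hl
  obtain ⟨x, hx, hpos⟩ : ∃ x ∈ V', m {l : Geod T | l.toFun 0 ∈ MulAction.orbit Γ x} ≠ 0 := by
    by_contra! hcon
    have h1 : m (geodFrom T V') = 0 := by
      have : geodFrom T V' ⊆ ⋃ x ∈ V', {l : Geod T | l.toFun 0 ∈ MulAction.orbit Γ x} :=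
        fun l hl => mem_biUnion hl (MulAction.mem_orbit_self _)
      exact measure_mono_null this
        ((measure_biUnion_null_iff V'.to_countable).2 hcon)
    have h2 : m = 0 := by
      rw [← Measure.measure_univ_eq_zero, ← union_compl_self (geodFrom T V')]
      exact measure_union_null h1 hsupp
    have h3 := measure_univ (μ := Q)
    rw [hQ, quotientMeasure_apply Γ m MeasurableSet.univ, h2] at h3
    simp at h3
  set W := {l : Geod T | l.toFun 0 ∈ MulAction.orbit Γ x} with hW
  set A := proj Γ '' W with hA
  have hAW : proj Γ ⁻¹' A = W := proj_preimage_image (hWi x)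
  have hAm : MeasurableSet A := measurableSet_proj_image (hWi x) (hWm x)
  have hQA : Q A ≠ 0 := by
    intro h0
    have := hm.measure_preimage_proj_eq_zero hAm h0
    rw [hAW] at this
    exact hpos this
  let b : GeodQuot Γ → GeodQuot Γ := Quotient.map (Geod.shift (-(N : ℤ))) (by
    rintro _ l ⟨g, rfl⟩
    exact ⟨g, rfl⟩)
  have hbi : ∀ (n : ℕ) (l : Geod T), b^[n] (proj Γ l) = proj Γ (l.shift (-(n * N))) := by
    intro n l
    induction n with
    | zero =>
      change proj Γ l = _
      congr 1
      rw [Geod.ext_iff_forall]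
      simp
    | succ n ih =>
      rw [Function.iterate_succ_apply', ih]
      change proj Γ _ = _
      congr 1
      rw [Geod.ext_iff_forall]
      intro t
      simp only [Geod.shift_apply]
      congr 1
      push_cast
      ring
  have hb : ∀ l : Geod T, b (proj Γ l) = proj Γ (l.shift (-N)) := fun l => rfl
  have hf : ∀ l : Geod T, flow Γ N (proj Γ l) = proj Γ (l.shift N) := fun l => rfl
  have hbf : ∀ z, b (flow Γ N z) = z := by
    intro z
    obtain ⟨l, rfl⟩ := Quotient.exists_rep z
    change b (flow Γ N (proj Γ l)) = proj Γ l
    rw [hf, hb]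
    congr 1
    rw [Geod.ext_iff_forall]
    simp
  have hbm : Measurable b := by
    refine measurable_from_quotient.2 ?_
    exact (measurable_proj Γ).comp (Geod.measurable_shift (-N))
  have hbp : MeasurePreserving b Q Q := by
    refine ⟨hbm, ?_⟩
    ext F hF
    rw [Measure.map_apply hbm hF, ← hmix.1.measure_preimage (hbm hF).nullMeasurableSet]
    congr 1
    ext z
    simp [hbf]
  set E₁ := {z | ∃ᶠ n : ℕ in atTop, (flow Γ N)^[n] z ∈ A} with hE₁
  set E₂ := {z | ∃ᶠ n : ℕ in atTop, b^[n] z ∈ A} with hE₂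
  have hE₁m : MeasurableSet E₁ := measurableSet_frequently hmix.1.measurable hAm
  have hE₂m : MeasurableSet E₂ := measurableSet_frequently hbm hAm
  have hE₁1 : Q E₁ = 1 := by
    refine hmix.measure_eq_one hE₁m (preimage_frequently _ _) fun h0 => hQA ?_
    rw [← hmix.1.conservative.measure_inter_frequently_image_mem_eq hAm.nullMeasurableSet]
    exact measure_mono_null inter_subset_right h0
  have hE₂1 : Q E₂ = 1 := by
    refine hmix.measure_eq_one hE₂m ?_ fun h0 => hQA ?_
    · have := preimage_frequently b A
      rw [← hE₂] at this
      conv_lhs => rw [← this]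
      ext z
      simp [hbf]
    · rw [← hbp.conservative.measure_inter_frequently_image_mem_eq hAm.nullMeasurableSet]
      exact measure_mono_null inter_subset_right h0
  have hn₁ := hm.measure_preimage_proj_eq_zero hE₁m.compl ((prob_compl_eq_zero_iff hE₁m).2 hE₁1)
  have hn₂ := hm.measure_preimage_proj_eq_zero hE₂m.compl ((prob_compl_eq_zero_iff hE₂m).2 hE₂1)
  have hAl : ∀ l : Geod T, proj Γ l ∈ A ↔ l.toFun 0 ∈ MulAction.orbit Γ x := fun l => by
    rw [← mem_preimage, hAW]
    rfl
  refine ⟨x, hx, measure_mono_null ?_ (measure_union_null hsupp (measure_union_null hn₁ hn₂))⟩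
  intro l hl
  by_contra hcon
  simp only [mem_union, not_or, mem_compl_iff, not_not, mem_preimage] at hcon
  obtain ⟨h0, h1, h2⟩ := hcon
  refine hl ⟨h0, ?_, ?_⟩
  · refine infinite_of_frequently hN (P := fun t => l.toFun t ∈ MulAction.orbit Γ x)
      (Frequently.mono h1 fun n hn => ?_)
    rw [flow_iterate, hAl] at hn
    simpa using hn
  · have := infinite_of_frequently hN (P := fun t => l.toFun (-t) ∈ MulAction.orbit Γ x)
      (Frequently.mono h2 fun n hn => by
        rw [hbi, hAl] at hn
        simpa using hn)
    refine (this.image neg_injective.injOn).mono ?_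
    rintro _ ⟨t, ⟨ht, h⟩, rfl⟩
    exact ⟨by omega, h⟩

end Quotient

/-! ### The section -/

lemma infinite_pos_iff {P : ℤ → Prop} :
    {t : ℤ | 0 < t ∧ P t}.Infinite ↔ ∀ M : ℕ, ∃ t : ℤ, M < t ∧ P t := by
  constructor
  · intro h M
    by_contra! hcon
    refine h ((finite_Ioc 0 (M : ℤ)).subset fun t ht => ⟨ht.1, ?_⟩)
    by_contra! hlt
    exact hcon t hlt ht.2
  · intro h
    refine infinite_of_not_bddAbove ?_
    rintro ⟨M, hM⟩
    obtain ⟨t, ht, hP⟩ := h M.toNat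
    have := hM (show t ∈ {t : ℤ | 0 < t ∧ P t} from ⟨by omega, hP⟩)
    omega

lemma infinite_neg_iff {P : ℤ → Prop} :
    {t : ℤ | t < 0 ∧ P t}.Infinite ↔ ∀ M : ℕ, ∃ t : ℤ, M < t ∧ P (-t) := by
  rw [← infinite_pos_iff (P := fun t => P (-t)),
    ← infinite_image_iff (f := fun t : ℤ => -t) neg_injective.injOn]
  congr! 1
  ext t
  constructor
  · rintro ⟨t, ⟨ht, h⟩, rfl⟩
    exact ⟨neg_pos.2 ht, by simpa using h⟩
  · rintro ⟨ht, h⟩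
    exact ⟨-t, ⟨by omega, h⟩, by simp⟩

section Section

variable {V : Type*} {T : SimpleGraph V} {Γ : Subgroup (T ≃g T)} {V' : Set V} {N : ℕ} {x₀ : V}

lemma mem_recurrent_iff {l : Geod T} : l ∈ recurrent Γ V' x₀ ↔ l.toFun 0 ∈ V' ∧
    (∀ M : ℕ, ∃ t : ℤ, M < t ∧ l.toFun t ∈ MulAction.orbit Γ x₀) ∧
    ∀ M : ℕ, ∃ t : ℤ, M < t ∧ l.toFun (-t) ∈ MulAction.orbit Γ x₀ :=
  and_congr_right fun _ => and_congr infinite_pos_iff infinite_neg_iff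

lemma measurableSet_recurrent : MeasurableSet (recurrent Γ V' x₀) := by
  have : recurrent Γ V' x₀ = {l : Geod T | l.toFun 0 ∈ V'} ∩
      ((⋂ M : ℕ, ⋃ t : ℤ, ⋃ _ : (M : ℤ) < t, {l | l.toFun t ∈ MulAction.orbit Γ x₀}) ∩
      ⋂ M : ℕ, ⋃ t : ℤ, ⋃ _ : (M : ℤ) < t, {l | l.toFun (-t) ∈ MulAction.orbit Γ x₀}) := by
    ext l
    simp [mem_recurrent_iff]
  rw [this]
  refine (Geod.measurableSet_eval 0 _).inter (MeasurableSet.inter ?_ ?_)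
  · exact MeasurableSet.iInter fun M => MeasurableSet.iUnion fun t => MeasurableSet.iUnion fun _ =>
      Geod.measurableSet_eval _ _
  · exact MeasurableSet.iInter fun M => MeasurableSet.iUnion fun t => MeasurableSet.iUnion fun _ =>
      Geod.measurableSet_eval _ _

lemma measurableSet_preSection : MeasurableSet (preSection Γ V' x₀) :=
  measurableSet_recurrent.inter (Geod.measurableSet_eval 0 (MulAction.orbit Γ x₀))

lemma IsAdapted.smul_mem (hV' : IsAdapted Γ N V') (g : Γ) {x : V} (hx : x ∈ V') : g • x ∈ V' :=
  hV'.1 g g.2 x hx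

lemma IsAdapted.orbit_subset (hV' : IsAdapted Γ N V') (hx₀ : x₀ ∈ V') :
    MulAction.orbit Γ x₀ ⊆ V' := by
  rintro _ ⟨g, rfl⟩
  exact hV'.smul_mem g hx₀

lemma IsAdapted.smul_mem_recurrent (hV' : IsAdapted Γ N V') (g : Γ) {l : Geod T}
    (hl : l ∈ recurrent Γ V' x₀) : g • l ∈ recurrent Γ V' x₀ := by
  rw [mem_recurrent_iff] at hl ⊢
  exact ⟨hV'.smul_mem g hl.1, fun M => (hl.2.1 M).imp fun t ht => ⟨ht.1, smul_mem_orbit g ht.2⟩,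
    fun M => (hl.2.2 M).imp fun t ht => ⟨ht.1, smul_mem_orbit g ht.2⟩⟩

lemma IsAdapted.smul_mem_preSection (hV' : IsAdapted Γ N V') (g : Γ) :
    ∀ l ∈ preSection Γ V' x₀, g • l ∈ preSection Γ V' x₀ :=
  fun _ hl => ⟨hV'.smul_mem_recurrent g hl.1, smul_mem_orbit g hl.2⟩

lemma IsAdapted.proj_mem_section (hV' : IsAdapted Γ N V') {l : Geod T} :
    proj Γ l ∈ section₀ Γ V' x₀ ↔ l ∈ preSection Γ V' x₀ := by
  have := proj_preimage_image (hV'.smul_mem_preSection (x₀ := x₀))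
  exact Set.ext_iff.1 this l

lemma IsAdapted.measurableSet_section (hV' : IsAdapted Γ N V') :
    MeasurableSet (section₀ Γ V' x₀) :=
  measurableSet_proj_image hV'.smul_mem_preSection measurableSet_preSection

lemma IsAdapted.exists_mul_eq (hV' : IsAdapted Γ N V') {l : Geod T} (hl : l.toFun 0 ∈ V') {t : ℤ}
    (ht : l.toFun t ∈ V') : ∃ n : ℤ, t = n * N := by
  obtain ⟨n, hn⟩ := (hV'.2 l hl t).1 ht
  refine ⟨n, ?_⟩
  have := l.inj hn
  omega

lemma shift_mem_recurrent {l : Geod T} (hl : l ∈ recurrent Γ V' x₀) {k : ℤ}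
    (hk : l.toFun k ∈ V') : l.shift k ∈ recurrent Γ V' x₀ := by
  rw [mem_recurrent_iff] at hl ⊢
  refine ⟨by simpa using hk, fun M => ?_, fun M => ?_⟩
  · obtain ⟨t, ht, h⟩ := hl.2.1 (M + k.natAbs)
    exact ⟨t - k, by omega, by simpa using h⟩
  · obtain ⟨t, ht, h⟩ := hl.2.2 (M + k.natAbs)
    exact ⟨t + k, by omega, by simpa using h⟩

lemma Geod.measurableSet_origin (x : V) : MeasurableSet {l : Geod T | l.toFun 0 = x} :=
  Geod.measurableSet_eval 0 {x}

/-- The mass of a subset of `Γ\𝒢T` made of geodesic lines with origin in the orbit of `x₀`. -/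
lemma IsInvariant.quotientMeasure_eq {m : Measure (Geod T)} (hm : IsInvariant Γ m)
    {F : Set (GeodQuot Γ)} (hF : MeasurableSet F)
    (hFx : ∀ l, proj Γ l ∈ F → l.toFun 0 ∈ MulAction.orbit Γ x₀) :
    quotientMeasure Γ m F = (Nat.card (MulAction.stabilizer Γ x₀) : ℝ≥0∞)⁻¹ *
      m (proj Γ ⁻¹' F ∩ {l | l.toFun 0 = x₀}) := by
  rw [quotientMeasure_apply Γ m hF,
    tsum_eq_single (Quotient.mk (MulAction.orbitRel Γ V) x₀ : MulAction.orbitRel.Quotient Γ V)]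
  · have hr : (MulAction.orbitRel Γ V) (Quotient.out (Quotient.mk (MulAction.orbitRel Γ V) x₀)) x₀ :=
      @Quotient.mk_out V (MulAction.orbitRel Γ V) x₀
    obtain ⟨g, hg⟩ := hr
    rw [Nat.card_congr (MulAction.stabilizerEquivStabilizerOfOrbitRel ⟨g, hg⟩).toEquiv, ← hg]
    congr 1
    exact hm.measure_origin g x₀ hF
  · intro c hc
    have : proj Γ ⁻¹' F ∩ {l | l.toFun 0 = (Quotient.out c : V)} = ∅ := by
      rw [Set.eq_empty_iff_forall_notMem]
      rintro l ⟨hl, hl0⟩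
      have h1 := hFx l hl
      rw [mem_ofPred_eq] at hl0
      rw [hl0] at h1
      apply hc
      rw [← @Quotient.out_eq V (MulAction.orbitRel Γ V) c]
      exact Quotient.sound h1
    rw [this, measure_empty, mul_zero]

lemma IsAdapted.sectionMeasure_apply (hV' : IsAdapted Γ N V') {m : Measure (Geod T)}
    (hm : IsInvariant Γ m) {E : Set (section₀ Γ V' x₀)} (hE : MeasurableSet E) :
    sectionMeasure Γ V' x₀ m E = (Nat.card (MulAction.stabilizer Γ x₀) : ℝ≥0∞)⁻¹ *
      m (proj Γ ⁻¹' (Subtype.val '' E) ∩ {l | l.toFun 0 = x₀}) := by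
  have hF : MeasurableSet (Subtype.val '' E) := hV'.measurableSet_section.subtype_image hE
  have hsub : proj Γ ⁻¹' (Subtype.val '' E) ⊆ preSection Γ V' x₀ := by
    rintro l ⟨z, hz, hzl⟩
    exact hV'.proj_mem_section.1 (hzl ▸ z.2)
  rw [sectionMeasure, comap_subtype_coe_apply hV'.measurableSet_section,
    ← hm.quotientMeasure_eq hF fun l hl => (hsub hl).2, quotientMeasure_apply _ _ hF,
    quotientMeasure_apply _ _ hF]
  refine tsum_congr fun c => ?_
  rw [Measure.restrict_apply' measurableSet_preSection, inter_eq_left.2]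
  exact inter_subset_left.trans hsub

/-- The recurrent geodesic lines with origin `x₀`. -/
def rooted (Γ : Subgroup (T ≃g T)) (V' : Set V) (x₀ : V) : Set (Geod T) :=
  {l | l ∈ recurrent Γ V' x₀ ∧ l.toFun 0 = x₀}

lemma measurableSet_rooted : MeasurableSet (rooted Γ V' x₀) :=
  measurableSet_recurrent.inter (Geod.measurableSet_eval 0 {x₀})

lemma preSection_inter : preSection Γ V' x₀ ∩ {l | l.toFun 0 = x₀} = rooted Γ V' x₀ := by
  ext l
  constructor
  · rintro ⟨h, h0⟩
    exact ⟨h.1, h0⟩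
  · rintro ⟨h, h0⟩
    exact ⟨⟨h, by rw [h0]; exact MulAction.mem_orbit_self x₀⟩, h0⟩

lemma IsAdapted.proj_preimage_section (hV' : IsAdapted Γ N V') :
    proj Γ ⁻¹' section₀ Γ V' x₀ = preSection Γ V' x₀ :=
  proj_preimage_image hV'.smul_mem_preSection

lemma IsAdapted.sectionMeasure_univ (hV' : IsAdapted Γ N V') {m : Measure (Geod T)}
    (hm : IsInvariant Γ m) : sectionMeasure Γ V' x₀ m univ =
      (Nat.card (MulAction.stabilizer Γ x₀) : ℝ≥0∞)⁻¹ * m (rooted Γ V' x₀) := by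
  rw [hV'.sectionMeasure_apply hm MeasurableSet.univ, image_univ, Subtype.range_coe,
    hV'.proj_preimage_section, preSection_inter]

lemma IsAdapted.measure_rooted_ne_zero [Countable V] (hN : 1 ≤ N) (hV' : IsAdapted Γ N V')
    {m : Measure (Geod T)} (hm : IsInvariant Γ m) [IsProbabilityMeasure (quotientMeasure Γ m)]
    (hflow : MeasurePreserving (flow Γ N) (quotientMeasure Γ m) (quotientMeasure Γ m))
    (hx₀ : x₀ ∈ V') (hrec : m (recurrent Γ V' x₀)ᶜ = 0) : m (rooted Γ V' x₀) ≠ 0 := by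
  intro h0
  have h1 : quotientMeasure Γ m (section₀ Γ V' x₀) = 0 := by
    rw [hm.quotientMeasure_eq (x₀ := x₀) hV'.measurableSet_section
      fun l hl => (hV'.proj_mem_section.1 hl).2, hV'.proj_preimage_section, preSection_inter, h0,
      mul_zero]
  have h2 : ∀ n : ℕ, m (proj Γ ⁻¹' ((flow Γ N)^[n] ⁻¹' section₀ Γ V' x₀)) = 0 := by
    intro n
    have hmeas := (hflow.iterate n).measurable (hV'.measurableSet_section (x₀ := x₀))
    refine hm.measure_preimage_proj_eq_zero hmeas ?_
    rw [(hflow.iterate n).measure_preimage hV'.measurableSet_section.nullMeasurableSet, h1]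
  have h3 : recurrent Γ V' x₀ ⊆
      ⋃ n : ℕ, proj Γ ⁻¹' ((flow Γ N)^[n] ⁻¹' section₀ Γ V' x₀) := by
    intro l hl
    obtain ⟨t, ht, hlt⟩ := (mem_recurrent_iff.1 hl).2.1 0
    obtain ⟨n, rfl⟩ := hV'.exists_mul_eq hl.1 (hV'.orbit_subset hx₀ hlt)
    have hn : 0 ≤ n := by
      by_contra! hneg
      have : n * (N : ℤ) ≤ 0 := mul_nonpos_of_nonpos_of_nonneg hneg.le (by omega)
      omega
    refine mem_iUnion.2 ⟨n.toNat, ?_⟩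
    rw [mem_preimage, mem_preimage, flow_iterate, hV'.proj_mem_section, Int.toNat_of_nonneg hn]
    exact ⟨shift_mem_recurrent hl (hV'.orbit_subset hx₀ hlt), by simpa using hlt⟩
  have h4 : m = 0 := by
    rw [← Measure.measure_univ_eq_zero, ← union_compl_self (recurrent Γ V' x₀)]
    exact measure_union_null (measure_mono_null h3 (measure_iUnion_null h2)) hrec
  have h5 := measure_univ (μ := quotientMeasure Γ m)
  rw [quotientMeasure_apply Γ m MeasurableSet.univ, h4] at h5
  simp at h5

end Section

/-! ### Shadows -/

section Shadows

variable {V : Type*} {T : SimpleGraph V}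

/-- If `v ∈ [u, z[`, then `z` has the same shadow seen from `u` and from `v`. -/
lemma shadow_eq (hT : T.IsTree) {u v z : V} (h : OnSegment T u z v) (hne : v ≠ z) :
    shadow T u z = shadow T v z := by
  ext ξ
  obtain ⟨r, rfl⟩ := Quotient.exists_rep ξ
  change OnRay u r.endpoint z ↔ OnRay v r.endpoint z
  rw [onRay_iff_eventually hT, onRay_iff_eventually hT]
  refine eventually_congr (Eventually.of_forall fun n => ⟨fun h' => ?_, fun h' => ?_⟩)
  · exact (h'.trans hT h).2
  · exact glue hT hne h h'

lemma OnRay.trans (hT : T.IsTree) {u v z : V} {ξ : Bdry T} (h : OnRay u ξ z)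
    (hv : OnSegment T u z v) : OnRay u ξ v := by
  obtain ⟨r, rfl⟩ := Quotient.exists_rep ξ
  change OnRay u r.endpoint v
  change OnRay u r.endpoint z at h
  rw [onRay_iff_eventually hT] at h ⊢
  exact h.mono fun n hn => (hn.trans hT hv).1

/-- The endpoints of the geodesic lines which pass through `y`, then `x` at time `0`, then `z`. -/
lemma ends_image_through (hT : T.IsTree) {x y z : V} (hyz : y ≠ z) (hx : OnSegment T y z x) :
    Geod.ends '' {l : Geod T | l.toFun 0 = x ∧ l.toFun (-T.dist x y) = y ∧
      l.toFun (T.dist x z) = z} = shadow T z y ×ˢ shadow T y z := by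
  have hsym : T.dist x y = T.dist y x := SimpleGraph.dist_comm
  ext ⟨ξ, η⟩
  constructor
  · rintro ⟨l, ⟨h0, h1, h2⟩, he⟩
    obtain ⟨rfl, rfl⟩ := Prod.mk.injEq _ _ _ _ ▸ he
    refine ⟨?_, ?_⟩
    · change OnRay z l.bwd y
      rw [← h2, ← h1]
      refine ⟨l.reverse.rayFrom (-T.dist x z), by simp, l.reverse.rayFrom_endpoint _,
        T.dist x z + T.dist x y, ?_⟩
      simp only [Geod.rayFrom_apply, Geod.reverse_apply]
      congr 1
      push_cast
      ring
    · change OnRay y l.fwd z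
      rw [← h1, ← h2]
      refine ⟨l.rayFrom (-T.dist x y), by simp, l.rayFrom_endpoint _,
        T.dist x y + T.dist x z, ?_⟩
      simp only [Geod.rayFrom_apply]
      congr 1
      push_cast
      ring
  · rintro ⟨hξ, hη⟩
    change OnRay z ξ y at hξ
    change OnRay y η z at hη
    have hd : T.dist z y = T.dist y z := SimpleGraph.dist_comm
    have hd0 : 0 < T.dist y z := hT.connected.pos_dist_of_ne hyz
    set r := rayTo hT z ξ with hr
    set q := rayTo hT y η with hq
    have hr0 : r.toFun 0 = z := by simp [hr]
    have hq0 : q.toFun 0 = y := by simp [hq]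
    have hrd : r.toFun (T.dist y z) = y := by rw [← hd]; exact (onRay_iff hT).1 hξ
    have hqd : q.toFun (T.dist y z) = z := (onRay_iff hT).1 hη
    have hry : rayTo hT y ξ = r.tail (T.dist y z) :=
      rayTo_eq hT (by simpa [Ray.tail] using hrd) ((r.tail_endpoint _).trans (by simp [hr]))
    have h1 : q.toFun 1 = r.toFun (T.dist y z - 1) := by
      have s1 := q.onSegment hT (show 1 ≤ T.dist y z from hd0)
      have s2 := r.onSegment hT (show T.dist y z - 1 ≤ T.dist y z by omega)
      rw [hq0, hqd] at s1
      rw [hr0, hrd] at s2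
      refine s1.eq_of_dist_eq hT s2.symm ?_
      have e1 := q.dist_zero hT 1
      have e2 := r.dist_add hT (T.dist y z - 1) 1
      rw [show T.dist y z - 1 + 1 = T.dist y z by omega, hrd, SimpleGraph.dist_comm] at e2
      rw [hq0] at e1
      rw [e1, e2]
    obtain ⟨l, hl0, hle⟩ := exists_geod_of_rays hT (x := y) (ξ := ξ) (η := η) (by
      rw [hry, ← hq, h1]
      intro h
      have := r.inj h
      omega)
    have hlq : ∀ n : ℕ, l.toFun n = q.toFun n := by
      intro n
      have := l.rayTo_fwd hT 0
      rw [hl0, show l.fwd = η from congrArg Prod.snd hle, ← hq] at this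
      rw [this]
      simp
    have hlx : l.toFun (T.dist y x) = x := by
      have s1 := q.onSegment hT hx.dist_le
      rw [hq0, hqd] at s1
      rw [hlq]
      refine s1.eq_of_dist_eq hT hx ?_
      have := q.dist_zero hT (T.dist y x)
      rwa [hq0] at this
    refine ⟨l.shift (T.dist y x), ⟨by simpa using hlx, ?_, ?_⟩, ?_⟩
    · simp [hsym, hl0]
    · have : (T.dist x z : ℤ) + T.dist y x = T.dist y z := by
        unfold OnSegment at hx
        omega
      rw [Geod.shift_apply, this, hlq, hqd]
    · rw [← hle]
      simp [Geod.ends]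

end Shadows

section Conformal

variable {V : Type*} {T : SimpleGraph V} {Γ : Subgroup (T ≃g T)} {δ : ℝ}
  {μ : V → Measure (Bdry T)}

lemma IsPattersonSullivan.apply_of_onRay (hT : T.IsTree) (hμ : IsPattersonSullivan Γ δ μ)
    {x y : V} {E : Set (Bdry T)} (hE : MeasurableSet E) (h : ∀ ξ ∈ E, OnRay x ξ y) :
    μ x E = ENNReal.ofReal (Real.exp (-δ * T.dist x y)) * μ y E := by
  rw [hμ.conformal x y, withDensity_apply _ hE, ← setLIntegral_const]
  refine setLIntegral_congr_fun hE fun ξ hξ => ?_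
  simp only [busemann_of_onRay hT (h ξ hξ)]

lemma IsPattersonSullivan.absolutelyContinuous (hμ : IsPattersonSullivan Γ δ μ) (x y : V) :
    μ x ≪ μ y := by
  rw [hμ.conformal x y]
  exact withDensity_absolutelyContinuous _ _

lemma IsPattersonSullivan.shadow_smul (hμ : IsPattersonSullivan Γ δ μ) (g : Γ) (x u v : V) :
    μ (g • x) (shadow T (g • u) (g • v)) = μ x (shadow T u v) := by
  change μ ((g : T ≃g T) x) (shadow T ((g : T ≃g T) u) ((g : T ≃g T) v)) = _
  rw [← hμ.equivariant g g.2 x, Measure.map_apply (measurable_bdryMap _) (measurableSet_shadow _ _),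
    map_preimage_shadow]

/-- If `x ∈ [y, z]`, the product of the masses of the shadows of `y` seen from `z` and of `z` seen
from `y` is the same for `μ_x` and for `μ_y`. -/
lemma IsPattersonSullivan.shadow_mul_shadow (hT : T.IsTree) (hμ : IsPattersonSullivan Γ δ μ)
    {x y z : V} (hx : OnSegment T y z x) :
    μ x (shadow T z y) * μ x (shadow T y z) = μ y (shadow T z y) * μ y (shadow T y z) := by
  rw [hμ.apply_of_onRay hT (y := y) (measurableSet_shadow z y) (x := x),
    hμ.apply_of_onRay hT (x := y) (y := x) (measurableSet_shadow y z), SimpleGraph.dist_comm]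
  · ring
  · exact fun ξ hξ => OnRay.trans hT hξ hx
  · intro ξ hξ
    rcases eq_or_ne x y with rfl | hne
    · exact ⟨rayTo hT x ξ, by simp, by simp, 0, by simp⟩
    · have := shadow_eq hT hx.symm hne
      rwa [this] at hξ

lemma IsPattersonSullivan.shadow_smul_eq (hT : T.IsTree) (hμ : IsPattersonSullivan Γ δ μ) (g : Γ)
    {x z : V} (hx : OnSegment T x (g • z) (g • x)) (hne : x ≠ z) :
    μ x (shadow T x (g • z)) =
      ENNReal.ofReal (Real.exp (-δ * T.dist x (g • x))) * μ x (shadow T x z) := by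
  rw [hμ.apply_of_onRay hT (y := g • x) (measurableSet_shadow _ _)
    fun ξ hξ => OnRay.trans hT hξ hx, shadow_eq hT hx fun h => hne (MulAction.injective g h),
    hμ.shadow_smul]

lemma bowenMargulis_through [Countable V] (hT : T.IsTree) (hμ : IsPattersonSullivan Γ δ μ) {o : V}
    (hne : bowenMargulis δ μ o ≠ 0) {x y z : V} (hyz : y ≠ z) (hx : OnSegment T y z x) :
    bowenMargulis δ μ o {l : Geod T | l.toFun 0 = x ∧ l.toFun (-T.dist x y) = y ∧
      l.toFun (T.dist x z) = z} = μ x (shadow T z y) * μ x (shadow T y z) := by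
  have := hμ.finite x
  have hm : MeasurableSet {l : Geod T | l.toFun 0 = x ∧ l.toFun (-T.dist x y) = y ∧
      l.toFun (T.dist x z) = z} :=
    (Geod.measurableSet_eval 0 {x}).inter ((Geod.measurableSet_eval (-T.dist x y) {y}).inter
      (Geod.measurableSet_eval (T.dist x z) {z}))
  rw [bowenMargulis_apply hT hμ hne hm fun l hl => hl.1, ends_image_through hT hyz hx,
    Measure.prod_prod]

lemma bowenMargulis_origin_lt_top [Countable V] (hT : T.IsTree) (hμ : IsPattersonSullivan Γ δ μ)
    {o : V} (hne : bowenMargulis δ μ o ≠ 0) (x : V) :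
    bowenMargulis δ μ o {l : Geod T | l.toFun 0 = x} < ∞ := by
  have := hμ.finite x
  rw [bowenMargulis_apply hT hμ hne (Geod.measurableSet_origin x) Subset.rfl]
  exact measure_lt_top _ _

lemma shadow_ne_zero_of_origin [Countable V] (hT : T.IsTree) (hμ : IsPattersonSullivan Γ δ μ)
    {o : V} (hne : bowenMargulis δ μ o ≠ 0) {x y : V}
    (hy : bowenMargulis δ μ o {l : Geod T | l.toFun 0 = y} ≠ 0) (z : V) :
    μ z (shadow T x y) ≠ 0 := by
  have := hμ.finite y
  intro h0
  have h1 := hμ.absolutelyContinuous y z h0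
  apply hy
  rw [bowenMargulis_apply hT hμ hne (Geod.measurableSet_origin y) Subset.rfl]
  have hsub : Geod.ends '' {l : Geod T | l.toFun 0 = y} ⊆
      shadow T x y ×ˢ univ ∪ univ ×ˢ shadow T x y := by
    rintro _ ⟨l, rfl, rfl⟩
    rcases le_total (l.closestTime x) 0 with h | h
    · exact Or.inr ⟨trivial, l.onRay_fwd_of_ge hT x h⟩
    · exact Or.inl ⟨l.onRay_bwd_of_le hT x h, trivial⟩
  refine measure_mono_null hsub (measure_union_null ?_ ?_)
  · rw [Measure.prod_prod, h1, zero_mul]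
  · rw [Measure.prod_prod, h1, mul_zero]

end Conformal

/-! ### Partial products of bi-infinite sequences -/

section Cocycle

variable {G : Type*} [Group G]

/-- The sequence `g : ℤ → G` such that `g 0 = 1` and `g (i + 1) = g i * s i`. -/
def cocycle (s : ℤ → G) : ℤ → G
  | Int.ofNat n => Nat.rec 1 (fun k g => g * s k) n
  | Int.negSucc n => Nat.rec (s (-1))⁻¹ (fun k g => g * (s (-(k : ℤ) - 2))⁻¹) n

@[simp] lemma cocycle_zero (s : ℤ → G) : cocycle s 0 = 1 := rfl

lemma cocycle_add_one (s : ℤ → G) (i : ℤ) : cocycle s (i + 1) = cocycle s i * s i := by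
  match i with
  | Int.ofNat n => rfl
  | Int.negSucc 0 =>
    change 1 = (s (-1))⁻¹ * s (-1)
    simp
  | Int.negSucc (n + 1) =>
    have h1 : cocycle s (Int.negSucc (n + 1)) =
      cocycle s (Int.negSucc n) * (s (-(n : ℤ) - 2))⁻¹ := rfl
    have h2 : Int.negSucc (n + 1) + 1 = Int.negSucc n := by omega
    have h3 : Int.negSucc (n + 1) = -(n : ℤ) - 2 := by omega
    rw [h2, h1, h3, inv_mul_cancel_right]

lemma cocycle_congr {s : ℤ → G} {g : ℤ → G} {a b : ℤ} (ha : a ≤ 0) (hb : 0 ≤ b) (h0 : g 0 = 1)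
    (h : ∀ i, a ≤ i → i < b → g (i + 1) = g i * s i) {i : ℤ} (hai : a ≤ i) (hib : i ≤ b) :
    g i = cocycle s i := by
  have key : ∀ n : ℕ, (n ≤ b → g n = cocycle s n) ∧ (a ≤ -n → g (-n) = cocycle s (-n)) := by
    intro n
    induction n with
    | zero => simp [h0]
    | succ n ih =>
      push_cast
      constructor
      · intro hn
        rw [h _ (by omega) (by omega), cocycle_add_one, ih.1 (by omega)]
      · intro hn
        have h1 := h (-(n + 1 : ℤ)) (by omega) (by omega)
        have h2 := cocycle_add_one s (-(n + 1 : ℤ))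
        rw [show -(n + 1 : ℤ) + 1 = -n by ring] at h1 h2
        rw [ih.2 (by omega), h2] at h1
        exact (mul_right_cancel h1).symm
  rcases le_total 0 i with hi | hi
  · have := (key i.toNat).1 (by omega)
    rwa [Int.toNat_of_nonneg hi] at this
  · have := (key (-i).toNat).2 (by omega)
    rwa [show -((-i).toNat : ℤ) = i by omega] at this

lemma cocycle_unique {s : ℤ → G} {g : ℤ → G} (h0 : g 0 = 1) (h : ∀ i, g (i + 1) = g i * s i) :
    g = cocycle s := by
  funext i
  exact cocycle_congr (a := -|i|) (b := |i|) (by simp) (by simp) h0 (fun i _ _ => h i)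
    (neg_abs_le i) (le_abs_self i)

lemma cocycle_shift (s : ℤ → G) (i : ℤ) :
    cocycle (fun i => s (i + 1)) i = (s 0)⁻¹ * cocycle s (i + 1) := by
  have h1 : cocycle s 1 = s 0 := by
    have := cocycle_add_one s 0
    simpa using this
  refine (congrFun (cocycle_unique (g := fun i => (s 0)⁻¹ * cocycle s (i + 1)) ?_ ?_) i).symm
  · simp [h1]
  · intro i
    rw [cocycle_add_one s (i + 1), mul_assoc]

lemma discMeas_cocycle {α : Type*} [MeasurableSpace α] [Countable G] {s : α → ℤ → G}
    (hs : ∀ i, DiscMeas fun a => s a i) (i : ℤ) : DiscMeas fun a => cocycle (s a) i := by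
  have key : ∀ n : ℕ, DiscMeas (fun a => cocycle (s a) n) ∧
      DiscMeas (fun a => cocycle (s a) (-n)) := by
    intro n
    induction n with
    | zero =>
      have : DiscMeas fun _ : α => (1 : G) := fun t => MeasurableSet.const (1 ∈ t)
      exact ⟨this, this⟩
    | succ n ih =>
      push_cast
      constructor
      · simp only [cocycle_add_one]
        exact (ih.1.pair (hs n)).map fun p => p.1 * p.2
      · have : ∀ a, cocycle (s a) (-(n + 1 : ℤ)) = cocycle (s a) (-n) * (s a (-(n + 1 : ℤ)))⁻¹ := by
          intro a
          have h2 := cocycle_add_one (s a) (-(n + 1 : ℤ))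
          rw [show -(n + 1 : ℤ) + 1 = -n by ring] at h2
          rw [h2, mul_inv_cancel_right]
        simp only [this]
        exact (ih.2.pair (hs _)).map fun p => p.1 * p.2⁻¹
  rcases le_total 0 i with hi | hi
  · have := (key i.toNat).1
    rwa [Int.toNat_of_nonneg hi] at this
  · have := (key (-i).toNat).2
    rwa [show -((-i).toNat : ℤ) = i by omega] at this

end Cocycle

/-! ### Chains of vertices on a geodesic line -/

section Chain

variable {V : Type*} {T : SimpleGraph V}

/-- The sequence of vertices `y` is locally monotone on a geodesic between the times `a` and `b`. -/
structure IsChain (T : SimpleGraph V) (y : ℤ → V) (a b : ℤ) : Prop where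
  ne : ∀ i, a ≤ i → i < b → y i ≠ y (i + 1)
  seg : ∀ i, a ≤ i → i + 2 ≤ b → OnSegment T (y i) (y (i + 2)) (y (i + 1))

lemma IsChain.onSegment (hT : T.IsTree) {y : ℤ → V} {a b : ℤ} (h : IsChain T y a b) {i j k : ℤ}
    (hi : a ≤ i) (hij : i ≤ j) (hjk : j ≤ k) (hk : k ≤ b) : OnSegment T (y i) (y k) (y j) := by
  have key : ∀ i : ℤ, ∀ n : ℕ, a ≤ i → i + n + 1 ≤ b →
      OnSegment T (y i) (y (i + n + 1)) (y (i + n)) := by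
    intro i n hi hn
    induction n with
    | zero => simpa using onSegment_left _ _
    | succ n ih =>
      push_cast at hn ⊢
      rw [show i + ((n : ℤ) + 1) + 1 = i + n + 2 by ring, ← add_assoc]
      exact glue hT (h.ne (i + n) (by omega) (by omega)) (ih (by omega))
        (h.seg (i + n) (by omega) (by omega))
  obtain ⟨n, rfl⟩ : ∃ n : ℕ, k = j + n := ⟨(k - j).toNat, by omega⟩
  induction n with
  | zero => simpa using onSegment_right _ _
  | succ n ih =>
    push_cast at hk ⊢
    have h1 := key i (j - i + n).toNat hi (by omega)
    have h2 := key j n (by omega) (by omega)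
    rw [show i + ((j - i + n).toNat : ℤ) = j + n by omega] at h1
    rw [← add_assoc]
    have h3 := ih (by omega) (by omega)
    unfold OnSegment at *
    omega

lemma IsChain.le_dist (hT : T.IsTree) {y : ℤ → V} {a b : ℤ} (h : IsChain T y a b) {i k : ℤ}
    (hi : a ≤ i) (hik : i ≤ k) (hk : k ≤ b) : k - i ≤ T.dist (y i) (y k) := by
  obtain ⟨n, rfl⟩ : ∃ n : ℕ, k = i + n := ⟨(k - i).toNat, by omega⟩
  induction n with
  | zero => simp
  | succ n ih =>
    push_cast at hk ⊢
    rw [← add_assoc]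
    have h1 := h.onSegment hT (j := i + n) (k := i + n + 1) hi (by omega) (by omega) (by omega)
    have h2 := hT.connected.pos_dist_of_ne (h.ne (i + n) (by omega) (by omega))
    have h3 := ih (by omega) (by omega)
    unfold OnSegment at h1
    omega

/-- The signed distance from `y 0` to `y i`. -/
noncomputable def arcTime (T : SimpleGraph V) (y : ℤ → V) (i : ℤ) : ℤ :=
  if 0 ≤ i then T.dist (y 0) (y i) else -T.dist (y i) (y 0)

@[simp] lemma arcTime_zero (y : ℤ → V) : arcTime T y 0 = 0 := by simp [arcTime]

lemma IsChain.arcTime_sub (hT : T.IsTree) {y : ℤ → V} {a b : ℤ} (h : IsChain T y a b)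
    (ha : a ≤ 0) (hb : 0 ≤ b) {i j : ℤ} (hi : a ≤ i) (hij : i ≤ j) (hj : j ≤ b) :
    arcTime T y j - arcTime T y i = T.dist (y i) (y j) := by
  unfold arcTime
  rcases le_or_gt 0 i with h0i | h0i
  · rw [if_pos (show 0 ≤ j by omega), if_pos h0i]
    have := h.onSegment hT ha h0i hij hj
    unfold OnSegment at this
    omega
  · rw [if_neg (show ¬ 0 ≤ i by omega)]
    rcases le_or_gt 0 j with h0j | h0j
    · rw [if_pos h0j]
      have := h.onSegment hT hi h0i.le h0j hj
      unfold OnSegment at this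
      omega
    · rw [if_neg (show ¬ 0 ≤ j by omega)]
      have := h.onSegment hT hi hij h0j.le hb
      unfold OnSegment at this
      omega

lemma IsChain.le_arcTime_sub (hT : T.IsTree) {y : ℤ → V} {a b : ℤ} (h : IsChain T y a b)
    (ha : a ≤ 0) (hb : 0 ≤ b) {i j : ℤ} (hi : a ≤ i) (hij : i ≤ j) (hj : j ≤ b) :
    j - i ≤ arcTime T y j - arcTime T y i := by
  rw [h.arcTime_sub hT ha hb hi hij hj]
  exact h.le_dist hT hi hij hj

lemma Geod.eq_of_frequently_eq (hT : T.IsTree) {l l' : Geod T} {u v : ℕ → ℤ}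
    (hu : ∀ n : ℕ, (n : ℤ) ≤ u n) (hv : ∀ n : ℕ, v n ≤ -(n : ℤ))
    (h : ∀ n, l.toFun (u n) = l'.toFun (u n)) (h' : ∀ n, l.toFun (v n) = l'.toFun (v n)) :
    l = l' := by
  rw [Geod.ext_iff_forall]
  intro t
  have h1 := hu t.natAbs
  have h2 := hv t.natAbs
  have s1 := l.onSegment hT (a := v t.natAbs) (b := t) (c := u t.natAbs) (by omega) (by omega)
  have s2 := l'.onSegment hT (a := v t.natAbs) (b := t) (c := u t.natAbs) (by omega) (by omega)
  rw [h, h'] at s1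
  refine s1.eq_of_dist_eq hT s2 ?_
  rw [← h', l.dist_eq hT, h', l'.dist_eq hT]

/-- A bi-infinite chain. -/
def IsBiChain (T : SimpleGraph V) (y : ℤ → V) : Prop := ∀ a b : ℤ, IsChain T y a b

/-- The point at time `t` of the geodesic line through the vertices of a bi-infinite chain. -/
noncomputable def chainPt (hT : T.IsTree) (y : ℤ → V) (t : ℤ) : V :=
  segPt hT (y (-|t|)) (y |t|) (t - arcTime T y (-|t|)).toNat

lemma IsBiChain.chainPt_dist (hT : T.IsTree) {y : ℤ → V} (h : IsBiChain T y) {t J : ℤ}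
    (hJ : |t| ≤ J) : (T.dist (y (-J)) (chainPt hT y t) : ℤ) = t - arcTime T y (-J) ∧
      (T.dist (chainPt hT y t) (y J) : ℤ) = arcTime T y J - t := by
  have hJ0 : 0 ≤ J := (abs_nonneg t).trans hJ
  have ht0 := abs_nonneg t
  have ht1 := neg_abs_le t
  have ht2 := le_abs_self t
  have c := h (-J) J
  have d1 := c.arcTime_sub hT (by omega) hJ0 (i := -|t|) (j := |t|) (by omega) (by omega) hJ
  have d2 := c.arcTime_sub hT (by omega) hJ0 (i := -J) (j := -|t|) (by omega) (by omega) (by omega)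
  have d3 := c.arcTime_sub hT (by omega) hJ0 (i := |t|) (j := J) (by omega) (by omega) (by omega)
  have d4 := c.arcTime_sub hT (by omega) hJ0 (i := -J) (j := J) (by omega) (by omega) (by omega)
  have e1 := c.le_arcTime_sub hT (by omega) hJ0 (i := -|t|) (j := 0) (by omega) (by omega) (by omega)
  have e2 := c.le_arcTime_sub hT (by omega) hJ0 (i := 0) (j := |t|) (by omega) (by omega) (by omega)
  rw [arcTime_zero] at e1 e2
  obtain ⟨s1, s2⟩ := segPt_spec hT (x := y (-|t|)) (y := y |t|)
    (n := (t - arcTime T y (-|t|)).toNat) (by omega)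
  have f1 := dist_tri hT (y (-J)) (y (-|t|)) (chainPt hT y t)
  have f2 := dist_tri hT (chainPt hT y t) (y |t|) (y J)
  have f3 := dist_tri hT (y (-J)) (chainPt hT y t) (y J)
  unfold OnSegment at s1
  unfold chainPt at *
  omega

lemma IsBiChain.dist_chainPt (hT : T.IsTree) {y : ℤ → V} (h : IsBiChain T y) {t u : ℤ}
    (htu : t ≤ u) : (T.dist (chainPt hT y t) (chainPt hT y u) : ℤ) = u - t := by
  obtain ⟨J, hJt, hJu⟩ : ∃ J, |t| ≤ J ∧ |u| ≤ J := ⟨_, le_max_left _ _, le_max_right _ _⟩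
  have hJ0 : 0 ≤ J := (abs_nonneg t).trans hJt
  obtain ⟨a1, a2⟩ := h.chainPt_dist hT hJt
  obtain ⟨b1, b2⟩ := h.chainPt_dist hT hJu
  have d4 := (h (-J) J).arcTime_sub hT (by omega) hJ0 (i := -J) (j := J)
    (by omega) (by omega) (by omega)
  have s1 : OnSegment T (y (-J)) (y J) (chainPt hT y t) := by
    unfold OnSegment; omega
  have s2 : OnSegment T (y (-J)) (y J) (chainPt hT y u) := by
    unfold OnSegment; omega
  have s3 := s2.dist_between hT s1 (by omega)
  unfold OnSegment at s3
  omega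

/-- The geodesic line through the vertices of a bi-infinite chain. -/
noncomputable def chainLine (hT : T.IsTree) {y : ℤ → V} (h : IsBiChain T y) : Geod T where
  toFun := chainPt hT y
  adj n := by
    have := h.dist_chainPt hT (show n ≤ n + 1 by omega)
    rw [← SimpleGraph.dist_eq_one_iff_adj]
    omega
  inj a b hab := by
    rcases le_total a b with hle | hle
    · have := h.dist_chainPt hT hle
      rw [hab, SimpleGraph.dist_self] at this
      omega
    · have := h.dist_chainPt hT hle
      rw [hab, SimpleGraph.dist_self] at this
      omega

lemma IsBiChain.strictMono_arcTime (hT : T.IsTree) {y : ℤ → V} (h : IsBiChain T y) :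
    StrictMono (arcTime T y) := by
  intro i j hij
  have := (h (min i 0) (max j 0)).le_arcTime_sub hT (min_le_right _ _) (le_max_right _ _)
    (min_le_left _ _) hij.le (le_max_left _ _)
  omega

lemma IsBiChain.le_arcTime (hT : T.IsTree) {y : ℤ → V} (h : IsBiChain T y) (i : ℤ) :
    (0 ≤ i → i ≤ arcTime T y i) ∧ (i ≤ 0 → arcTime T y i ≤ i) := by
  constructor
  · intro hi
    have := (h 0 i).le_arcTime_sub hT le_rfl hi le_rfl hi le_rfl
    rw [arcTime_zero] at this
    omega
  · intro hi
    have := (h i 0).le_arcTime_sub hT hi le_rfl le_rfl hi le_rfl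
    rw [arcTime_zero] at this
    omega

lemma chainLine_arcTime (hT : T.IsTree) {y : ℤ → V} (h : IsBiChain T y) (i : ℤ) :
    (chainLine hT h).toFun (arcTime T y i) = y i := by
  obtain ⟨J, hJi, hJt⟩ : ∃ J, |i| ≤ J ∧ |arcTime T y i| ≤ J := ⟨_, le_max_left _ _, le_max_right _ _⟩
  have hJ0 : 0 ≤ J := (abs_nonneg i).trans hJi
  have h1 := neg_abs_le i
  have h2 := le_abs_self i
  obtain ⟨a1, a2⟩ := h.chainPt_dist hT hJt
  have d1 := (h (-J) J).arcTime_sub hT (by omega) hJ0 (i := -J) (j := i)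
    (by omega) (by omega) (by omega)
  have d4 := (h (-J) J).arcTime_sub hT (by omega) hJ0 (i := -J) (j := J)
    (by omega) (by omega) (by omega)
  have s1 : OnSegment T (y (-J)) (y J) (chainPt hT y (arcTime T y i)) := by
    unfold OnSegment; omega
  exact s1.eq_of_dist_eq hT ((h (-J) J).onSegment hT (by omega) (by omega) (by omega) le_rfl)
    (by omega)

lemma chainLine_zero (hT : T.IsTree) {y : ℤ → V} (h : IsBiChain T y) :
    (chainLine hT h).toFun 0 = y 0 := by
  have := chainLine_arcTime hT h 0
  rwa [arcTime_zero] at this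

lemma eq_chainLine (hT : T.IsTree) {y : ℤ → V} (h : IsBiChain T y) {l : Geod T} {τ : ℤ → ℤ}
    (hτ : StrictMono τ) (hτ0 : τ 0 = 0) (hl : ∀ i, l.toFun (τ i) = y i) : l = chainLine hT h := by
  have key : ∀ i, arcTime T y i = τ i := by
    intro i
    have hm := hτ.le_iff_le (a := 0) (b := i)
    rw [hτ0] at hm
    unfold arcTime
    rw [← hl 0, ← hl i, l.dist_eq hT, l.dist_eq hT, hτ0]
    split_ifs with hi
    · have := hm.2 hi
      omega
    · have : ¬ 0 ≤ τ i := fun hh => hi (hm.1 hh)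
      omega
  refine Geod.eq_of_frequently_eq hT (u := fun n => arcTime T y n) (v := fun n => arcTime T y (-n))
    (fun n => (h.le_arcTime hT n).1 (by omega)) (fun n => (h.le_arcTime hT (-n)).2 (by omega))
    (fun n => ?_) (fun n => ?_)
  · rw [chainLine_arcTime, key, hl]
  · rw [chainLine_arcTime, key, hl]

lemma exists_between_of_strictMono {τ : ℤ → ℤ} (hτ : StrictMono τ) (h0 : τ 0 = 0) (t : ℤ) :
    ∃ i, τ i ≤ t ∧ t < τ (i + 1) := by
  have key : ∀ n : ℕ, (n : ℤ) ≤ τ n ∧ τ (-n) ≤ -n := by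
    intro n
    induction n with
    | zero => simp [h0]
    | succ n ih =>
      have h1 := hτ (show (n : ℤ) < (n + 1 : ℕ) by push_cast; omega)
      have h2 := hτ (show (-(n + 1 : ℕ) : ℤ) < -n by push_cast; omega)
      push_cast at h1 h2 ⊢
      omega
  obtain ⟨i, hi, hmax⟩ := Int.exists_greatest_of_bdd (P := fun i => τ i ≤ t)
    ⟨t.natAbs, fun z hz => by
      by_contra! hlt
      have h1 := hτ hlt
      have h2 := (key t.natAbs).1
      omega⟩ ⟨-t.natAbs, by have := (key t.natAbs).2; omega⟩
  refine ⟨i, hi, ?_⟩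
  by_contra! hlt
  have := hmax _ hlt
  omega

end Chain

/-! ### The coding -/

section Coding

variable {V : Type*} {T : SimpleGraph V} {Γ : Subgroup (T ≃g T)} {V' : Set V} {N : ℕ} {x₀ : V}

lemma onSegment_smul (hT : T.IsTree) (g : Γ) {x y z : V} :
    OnSegment T (g • x) (g • y) (g • z) ↔ OnSegment T x y z :=
  onSegment_map hT (g : T ≃g T)

/-- The vertices `g_i x₀` associated with a sequence of letters `g_i⁻¹ g_{i+1}`. -/
def pathPt (s : ℤ → Alphabet Γ x₀) (i : ℤ) : V := cocycle (fun j => (s j).1) i • x₀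

@[simp] lemma pathPt_zero (s : ℤ → Alphabet Γ x₀) : pathPt s 0 = x₀ := by simp [pathPt]

lemma pathPt_mem_orbit (s : ℤ → Alphabet Γ x₀) (i : ℤ) : pathPt s i ∈ MulAction.orbit Γ x₀ :=
  MulAction.mem_orbit _ _

lemma pathPt_add_one (s : ℤ → Alphabet Γ x₀) (i : ℤ) :
    pathPt s (i + 1) = cocycle (fun j => (s j).1) i • (s i).1 • x₀ := by
  rw [pathPt, cocycle_add_one, mul_smul]

lemma Alphabet.smul_ne (a : Alphabet Γ x₀) : a.1 • x₀ ≠ x₀ := a.2.1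

lemma isChain_pathPt (hT : T.IsTree) {s : ℤ → Alphabet Γ x₀} {a b : ℤ}
    (h : ∀ i, a ≤ i → i + 1 < b → Allowed (s i) (s (i + 1))) : IsChain T (pathPt s) a b where
  ne i _ _ := by
    rw [pathPt_add_one]
    exact fun he => (s i).smul_ne (MulAction.injective _ he.symm)
  seg i hi hib := by
    have h1 := (onSegment_smul hT (cocycle (fun j => (s j).1) (i + 1))).2 (h i hi (by omega))
    rw [smul_smul, smul_smul, ← cocycle_add_one (fun j => (s j).1) (i + 1),
      cocycle_add_one (fun j => (s j).1) i, mul_inv_cancel_right, add_assoc] at h1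
    rw [← cocycle_add_one (fun j => (s j).1) i] at h1
    exact h1

lemma notMem_orbit_of_between (hT : T.IsTree) (s : ℤ → Alphabet Γ x₀) {i : ℤ} {z : V}
    (h : OnSegment T (pathPt s i) (pathPt s (i + 1)) z) (h1 : z ≠ pathPt s i)
    (h2 : z ≠ pathPt s (i + 1)) : z ∉ MulAction.orbit Γ x₀ := by
  set g := cocycle (fun j => (s j).1) i with hg
  obtain ⟨z, rfl⟩ : ∃ w, g • w = z := ⟨g⁻¹ • z, smul_inv_smul _ _⟩
  rw [pathPt_add_one, ← hg] at h h2
  rw [pathPt, ← hg] at h h1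
  intro hz
  refine (s i).2.2 z ((onSegment_smul hT g).1 h) (fun e => h1 (by rw [e])) (fun e => h2 (by rw [e]))
    ?_
  have := smul_mem_orbit g⁻¹ hz
  rwa [inv_smul_smul] at this

lemma isBiChain_pathPt (hT : T.IsTree) (s : Subshift (Allowed (Γ := Γ) (x₀ := x₀))) :
    IsBiChain T (pathPt s.1) :=
  fun _ _ => isChain_pathPt hT fun i _ _ => s.2 i

/-- The geodesic line with origin `x₀` coded by an element of the subshift. -/
noncomputable def codedLine (hT : T.IsTree) (s : Subshift (Allowed (Γ := Γ) (x₀ := x₀))) :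
    Geod T :=
  chainLine hT (isBiChain_pathPt hT s)

/-- The passages of the geodesic line `l` in the orbit of `x₀` are the times `τ i`, in increasing
order and with `τ 0 = 0`. -/
structure IsVisits (Γ : Subgroup (T ≃g T)) (x₀ : V) (l : Geod T) (τ : ℤ → ℤ) : Prop where
  strictMono : StrictMono τ
  zero : τ 0 = 0
  mem_iff : ∀ t, l.toFun t ∈ MulAction.orbit Γ x₀ ↔ ∃ i, τ i = t

lemma IsVisits.mem {l : Geod T} {τ : ℤ → ℤ} (h : IsVisits Γ x₀ l τ) (i : ℤ) :
    l.toFun (τ i) ∈ MulAction.orbit Γ x₀ := (h.mem_iff _).2 ⟨i, rfl⟩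

lemma IsVisits.notMem {l : Geod T} {τ : ℤ → ℤ} (h : IsVisits Γ x₀ l τ) {i t : ℤ} (h1 : τ i < t)
    (h2 : t < τ (i + 1)) : l.toFun t ∉ MulAction.orbit Γ x₀ := by
  rw [h.mem_iff]
  rintro ⟨j, rfl⟩
  have := h.strictMono.lt_iff_lt.1 h1
  have := h.strictMono.lt_iff_lt.1 h2
  omega

lemma codedLine_arcTime (hT : T.IsTree) (s : Subshift (Allowed (Γ := Γ) (x₀ := x₀))) (i : ℤ) :
    (codedLine hT s).toFun (arcTime T (pathPt s.1) i) = pathPt s.1 i :=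
  chainLine_arcTime hT _ i

lemma isVisits_codedLine (hT : T.IsTree) (s : Subshift (Allowed (Γ := Γ) (x₀ := x₀))) :
    IsVisits Γ x₀ (codedLine hT s) (arcTime T (pathPt s.1)) where
  strictMono := (isBiChain_pathPt hT s).strictMono_arcTime hT
  zero := arcTime_zero _
  mem_iff t := by
    constructor
    · intro ht
      have hτ := (isBiChain_pathPt hT s).strictMono_arcTime hT
      obtain ⟨i, h1, h2⟩ := exists_between_of_strictMono hτ (arcTime_zero _) t
      refine ⟨i, ?_⟩
      by_contra hne
      have hseg := (codedLine hT s).onSegment hT h1 h2.le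
      rw [codedLine_arcTime, codedLine_arcTime] at hseg
      refine notMem_orbit_of_between hT s.1 hseg ?_ ?_ ht
      · rw [← codedLine_arcTime hT s i]
        exact fun e => hne ((codedLine hT s).inj e).symm
      · rw [← codedLine_arcTime hT s (i + 1)]
        exact fun e => h2.ne ((codedLine hT s).inj e)
    · rintro ⟨i, rfl⟩
      rw [codedLine_arcTime]
      exact pathPt_mem_orbit _ _

lemma IsVisits.mem_recurrent {l : Geod T} {τ : ℤ → ℤ} (h : IsVisits Γ x₀ l τ)
    (h0 : l.toFun 0 ∈ V') : l ∈ recurrent Γ V' x₀ := by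
  have key : ∀ n : ℕ, (n : ℤ) ≤ τ n ∧ τ (-n) ≤ -n := by
    intro n
    induction n with
    | zero => simp [h.zero]
    | succ n ih =>
      have h1 := h.strictMono (show (n : ℤ) < (n + 1 : ℕ) by push_cast; omega)
      have h2 := h.strictMono (show (-(n + 1 : ℕ) : ℤ) < -n by push_cast; omega)
      push_cast at h1 h2 ⊢
      omega
  refine mem_recurrent_iff.2 ⟨h0, fun M => ?_, fun M => ?_⟩
  · have := (key (M + 1)).1
    exact ⟨τ (M + 1 : ℕ), by omega, h.mem _⟩
  · have := (key (M + 1)).2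
    exact ⟨-τ (-(M + 1 : ℕ)), by omega, by rw [neg_neg]; exact h.mem _⟩

lemma codedLine_zero (hT : T.IsTree) (s : Subshift (Allowed (Γ := Γ) (x₀ := x₀))) :
    (codedLine hT s).toFun 0 = x₀ :=
  (chainLine_zero hT _).trans (pathPt_zero _)

lemma codedLine_mem_rooted (hT : T.IsTree) (hx₀ : x₀ ∈ V')
    (s : Subshift (Allowed (Γ := Γ) (x₀ := x₀))) : codedLine hT s ∈ rooted Γ V' x₀ :=
  ⟨(isVisits_codedLine hT s).mem_recurrent (by rwa [codedLine_zero]), codedLine_zero hT s⟩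

lemma codedLine_shift (hT : T.IsTree) (s : Subshift (Allowed (Γ := Γ) (x₀ := x₀))) :
    ((s.1 0).1)⁻¹ • (codedLine hT s).shift (arcTime T (pathPt s.1) 1) = codedLine hT s.shift := by
  have hv := isVisits_codedLine hT s
  refine eq_chainLine hT _
    (τ := fun i => arcTime T (pathPt s.1) (i + 1) - arcTime T (pathPt s.1) 1) ?_ ?_ ?_
  · intro i j hij
    have := hv.strictMono (show i + 1 < j + 1 by omega)
    change _ - _ < _ - _
    omega
  · simp
  · intro i
    change ((s.1 0).1)⁻¹ • (codedLine hT s).toFun _ = cocycle (fun j => (s.1 (j + 1)).1) i • x₀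
    rw [sub_add_cancel, codedLine_arcTime, cocycle_shift (fun j => (s.1 j).1), mul_smul]
    rfl

/-- The coding map. -/
noncomputable def coding (hT : T.IsTree) (hx₀ : x₀ ∈ V')
    (s : Subshift (Allowed (Γ := Γ) (x₀ := x₀))) : section₀ Γ V' x₀ :=
  ⟨proj Γ (codedLine hT s), mem_image_of_mem _
    ⟨(codedLine_mem_rooted hT hx₀ s).1, by
      rw [codedLine_zero]; exact MulAction.mem_orbit_self x₀⟩⟩

lemma IsAdapted.firstReturn_eq (hV' : IsAdapted Γ N V') (hN : 1 ≤ N) (hx₀ : x₀ ∈ V') {l : Geod T}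
    (hl : l ∈ rooted Γ V' x₀) {τ : ℤ → ℤ} (hτ : IsVisits Γ x₀ l τ) :
    firstReturn (flow Γ N) (section₀ Γ V' x₀) (proj Γ l) = proj Γ (l.shift (τ 1)) := by
  have hN0 : (0 : ℤ) < N := by omega
  have hmem : ∀ k : ℕ, (flow Γ N)^[k] (proj Γ l) ∈ section₀ Γ V' x₀ ↔
      ∃ i, τ i = k * N := by
    intro k
    rw [flow_iterate, hV'.proj_mem_section, ← hτ.mem_iff]
    constructor
    · intro h
      simpa using h.2
    · intro h
      exact ⟨shift_mem_recurrent hl.1 (hV'.orbit_subset hx₀ h), by simpa using h⟩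
  have hτ1 : 0 < τ 1 := by
    have := hτ.strictMono (show (0 : ℤ) < 1 by omega)
    rwa [hτ.zero] at this
  obtain ⟨n, hn⟩ := hV'.exists_mul_eq hl.1.1 (hV'.orbit_subset hx₀ (hτ.mem 1))
  have hn0 : 0 < n := by
    rw [hn] at hτ1
    exact pos_of_mul_pos_left hτ1 hN0.le
  have hleast : IsLeast {k : ℕ | 0 < k ∧ (flow Γ N)^[k] (proj Γ l) ∈ section₀ Γ V' x₀} n.toNat := by
    constructor
    · refine ⟨by omega, (hmem _).2 ⟨1, ?_⟩⟩
      rw [Int.toNat_of_nonneg hn0.le, hn]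
    · rintro k ⟨hk, hk'⟩
      obtain ⟨i, hi⟩ := (hmem k).1 hk'
      have h1 : 0 < τ i := by rw [hi]; positivity
      rw [← hτ.zero] at h1
      have h2 := hτ.strictMono.lt_iff_lt.1 h1
      have h3 := hτ.strictMono.monotone (show 1 ≤ i by omega)
      rw [hi, hn] at h3
      have := le_of_mul_le_mul_right h3 hN0
      omega
  rw [firstReturn, hleast.csInf_eq, flow_iterate, Int.toNat_of_nonneg hn0.le, hn]

lemma coding_shift (hT : T.IsTree) (hV' : IsAdapted Γ N V') (hN : 1 ≤ N) (hx₀ : x₀ ∈ V')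
    (s : Subshift (Allowed (Γ := Γ) (x₀ := x₀))) :
    (coding hT hx₀ s.shift : GeodQuot Γ) =
      firstReturn (flow Γ N) (section₀ Γ V' x₀) (coding hT hx₀ s) := by
  change proj Γ _ = firstReturn _ _ (proj Γ _)
  rw [hV'.firstReturn_eq hN hx₀ (codedLine_mem_rooted hT hx₀ s) (isVisits_codedLine hT s),
    ← codedLine_shift, proj_smul]

lemma Subshift.discMeas_apply {S : Type*} [MeasurableSpace S] [DiscreteMeasurableSpace S]
    {A : S → S → Prop} (i : ℤ) : DiscMeas fun s : Subshift A => s.1 i :=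
  fun t => (measurable_pi_apply i).comp measurable_subtype_coe (MeasurableSet.of_discrete (s := t))

instance : DiscreteMeasurableSpace (Alphabet Γ x₀) := ⟨fun _ => trivial⟩

lemma measurable_codedLine [Countable Γ] (hT : T.IsTree) :
    Measurable (codedLine hT : Subshift (Allowed (Γ := Γ) (x₀ := x₀)) → Geod T) := by
  have hc : ∀ i, DiscMeas fun s : Subshift (Allowed (Γ := Γ) (x₀ := x₀)) =>
      cocycle (fun j => (s.1 j).1) i :=
    discMeas_cocycle fun i =>
      (Subshift.discMeas_apply (S := Alphabet Γ x₀) (A := Allowed) i).map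
        fun a : Alphabet Γ x₀ => a.1
  refine Geod.measurable_of_eval fun t => ?_
  have h := ((hc (-|t|)).pair (hc |t|)).map fun p : Γ × Γ => segPt hT (p.1 • x₀) (p.2 • x₀)
    (t - if 0 ≤ -|t| then (T.dist x₀ (p.1 • x₀) : ℤ) else -T.dist (p.1 • x₀) x₀).toNat
  have e : (fun s : Subshift (Allowed (Γ := Γ) (x₀ := x₀)) => (codedLine hT s).toFun t) =
      fun s => segPt hT (pathPt s.1 (-|t|)) (pathPt s.1 |t|)
        (t - arcTime T (pathPt s.1) (-|t|)).toNat := rfl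
  rw [e]
  simp only [arcTime, pathPt_zero]
  exact h

lemma measurable_coding [Countable Γ] (hT : T.IsTree) (hx₀ : x₀ ∈ V') :
    Measurable (coding hT hx₀ : Subshift (Allowed (Γ := Γ) (x₀ := x₀)) → section₀ Γ V' x₀) :=
  Measurable.subtype_mk ((measurable_proj Γ).comp (measurable_codedLine hT))

/-! ### The successive visits of an orbit -/

/-- The `i`-th visit of the orbit of `x₀`, for `i : ℤ`. -/
noncomputable def visitTime (Γ : Subgroup (T ≃g T)) (x₀ : V) (l : Geod T) (i : ℤ) : ℤ :=
  if 0 ≤ i then Nat.nth (fun n : ℕ => l.toFun n ∈ MulAction.orbit Γ x₀) i.toNat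
  else -Nat.nth (fun n : ℕ => l.toFun (-n) ∈ MulAction.orbit Γ x₀) (-i).toNat

lemma infinite_pos_visits {l : Geod T} (hl : l ∈ rooted Γ V' x₀) :
    {n : ℕ | l.toFun n ∈ MulAction.orbit Γ x₀}.Infinite := by
  rw [← Nat.frequently_atTop_iff_infinite, frequently_atTop]
  intro M
  obtain ⟨t, ht, h⟩ := (mem_recurrent_iff.1 hl.1).2.1 M
  refine ⟨t.toNat, by omega, ?_⟩
  rwa [Int.toNat_of_nonneg (by omega)]

lemma infinite_neg_visits {l : Geod T} (hl : l ∈ rooted Γ V' x₀) :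
    {n : ℕ | l.toFun (-n) ∈ MulAction.orbit Γ x₀}.Infinite := by
  rw [← Nat.frequently_atTop_iff_infinite, frequently_atTop]
  intro M
  obtain ⟨t, ht, h⟩ := (mem_recurrent_iff.1 hl.1).2.2 M
  refine ⟨t.toNat, by omega, ?_⟩
  rwa [Int.toNat_of_nonneg (by omega)]

lemma isVisits_visitTime {l : Geod T} (hl : l ∈ rooted Γ V' x₀) :
    IsVisits Γ x₀ l (visitTime Γ x₀ l) := by
  have hp := infinite_pos_visits hl
  have hn := infinite_neg_visits hl
  have hp0 : Nat.nth (fun n : ℕ => l.toFun n ∈ MulAction.orbit Γ x₀) 0 = 0 :=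
    Nat.nth_zero_of_zero (by simp [hl.2])
  have hn0 : Nat.nth (fun n : ℕ => l.toFun (-n) ∈ MulAction.orbit Γ x₀) 0 = 0 :=
    Nat.nth_zero_of_zero (by simp [hl.2])
  have hpm := Nat.nth_strictMono hp
  have hnm := Nat.nth_strictMono hn
  refine ⟨fun i j hij => ?_, by simp [visitTime, hp0], fun t => ⟨fun ht => ?_, ?_⟩⟩
  · unfold visitTime
    rcases le_or_gt 0 i with hi | hi
    · rw [if_pos hi, if_pos (hi.trans hij.le)]
      exact_mod_cast hpm (show i.toNat < j.toNat by omega)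
    · rw [if_neg (not_le.2 hi)]
      have h1 := hnm (show 0 < (-i).toNat by omega)
      rw [hn0] at h1
      rcases le_or_gt 0 j with hj | hj
      · rw [if_pos hj]
        omega
      · rw [if_neg (not_le.2 hj)]
        have := hnm (show (-j).toNat < (-i).toNat by omega)
        omega
  · rcases le_or_gt 0 t with h | h
    · obtain ⟨k, -, hk⟩ := Nat.exists_lt_card_nth_eq
        (p := fun n : ℕ => l.toFun n ∈ MulAction.orbit Γ x₀) (x := t.toNat)
        (by rwa [Int.toNat_of_nonneg h])
      refine ⟨k, ?_⟩
      rw [visitTime, if_pos (by omega), Int.toNat_natCast, hk, Int.toNat_of_nonneg h]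
    · obtain ⟨k, -, hk⟩ := Nat.exists_lt_card_nth_eq
        (p := fun n : ℕ => l.toFun (-n) ∈ MulAction.orbit Γ x₀) (x := (-t).toNat)
        (by rwa [show -((-t).toNat : ℤ) = t by omega])
      have hk0 : k ≠ 0 := by
        rintro rfl
        omega
      refine ⟨-k, ?_⟩
      rw [visitTime, if_neg (by omega), neg_neg, Int.toNat_natCast, hk]
      omega
  · rintro ⟨i, rfl⟩
    unfold visitTime
    split_ifs
    · exact Nat.nth_mem_of_infinite hp _
    · exact Nat.nth_mem_of_infinite hn _

open Classical in
lemma discMeas_nth {α : Type*} [MeasurableSpace α] {P : α → ℕ → Prop}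
    (hP : ∀ n, MeasurableSet {a | P a n}) (hinf : ∀ a, {n | P a n}.Infinite) (k : ℕ) :
    DiscMeas fun a => Nat.nth (P a) k := by
  have hPd : ∀ n, DiscMeas fun a => P a n := fun n =>
    DiscMeas.of_singleton fun q => by
      by_cases hq : q
      · simpa [hq] using hP n
      · have : {a | P a n = q} = {a | P a n}ᶜ := by
          ext a
          simp [hq]
        rw [this]
        exact (hP n).compl
  have hcount : ∀ n, DiscMeas fun a => Nat.count (P a) n := by
    intro n
    induction n with
    | zero =>
      simp only [Nat.count_zero]
      exact fun t => MeasurableSet.const (0 ∈ t)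
    | succ n ih =>
      simp only [Nat.count_succ]
      exact (ih.pair (hPd n)).map fun p => p.1 + if p.2 then 1 else 0
  refine DiscMeas.of_singleton fun n => ?_
  have : {a | Nat.nth (P a) k = n} = {a | P a n} ∩ {a | Nat.count (P a) n = k} := by
    ext a
    constructor
    · rintro rfl
      exact ⟨Nat.nth_mem_of_infinite (hinf a) k, Nat.count_nth_of_infinite (hinf a) k⟩
    · rintro ⟨h1, rfl⟩
      exact Nat.nth_count h1
  rw [this]
  exact (hP n).inter ((hcount n).setOf fun c => c = k)

lemma discMeas_visitTime (i : ℤ) :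
    DiscMeas fun l : rooted Γ V' x₀ => visitTime Γ x₀ l.1 i := by
  have hP : ∀ t : ℤ, MeasurableSet {l : rooted Γ V' x₀ | l.1.toFun t ∈ MulAction.orbit Γ x₀} :=
    fun t => measurable_subtype_coe (Geod.measurableSet_eval t (MulAction.orbit Γ x₀))
  unfold visitTime
  split_ifs
  · exact (discMeas_nth (fun n => hP n) (fun l => infinite_pos_visits l.2) _).map Nat.cast
  · exact (discMeas_nth (fun n => hP (-n)) (fun l => infinite_neg_visits l.2) _).map
      fun n : ℕ => -(n : ℤ)

lemma discMeas_visitPt [Countable V] (i : ℤ) :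
    DiscMeas fun l : rooted Γ V' x₀ => l.1.toFun (visitTime Γ x₀ l.1 i) := by
  refine DiscMeas.of_singleton fun v => ?_
  have : {l : rooted Γ V' x₀ | l.1.toFun (visitTime Γ x₀ l.1 i) = v} =
      ⋃ t : ℤ, {l | visitTime Γ x₀ l.1 i = t} ∩ {l | l.1.toFun t = v} := by
    ext l
    simp
  rw [this]
  exact MeasurableSet.iUnion fun t => ((discMeas_visitTime i).setOf fun u => u = t).inter
    (measurable_subtype_coe (Geod.measurableSet_eval t {v}))

end Coding

/-! ### The Markov measure -/

section Markov

variable {V : Type*} {T : SimpleGraph V} {Γ : Subgroup (T ≃g T)} {V' : Set V} {N : ℕ} {x₀ : V}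

open Classical in
/-- An element of the group which maps `x₀` to a given vertex of its orbit. -/
noncomputable def orbitLift (Γ : Subgroup (T ≃g T)) (x₀ v : V) : Γ :=
  if h : ∃ g : Γ, g • x₀ = v then h.choose else 1

lemma orbitLift_smul {v : V} (h : v ∈ MulAction.orbit Γ x₀) : orbitLift Γ x₀ v • x₀ = v := by
  have h' : ∃ g : Γ, g • x₀ = v := h
  rw [orbitLift, dif_pos h']
  exact h'.choose_spec

open Classical in
/-- Elements of the group which map `x₀` to the successive visits of its orbit by `l`, depending on
the choice of a sequence of elements of the stabiliser of `x₀`. -/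
noncomputable def frame (l : Geod T) (h : ℤ → MulAction.stabilizer Γ x₀) (i : ℤ) : Γ :=
  if i = 0 then 1 else orbitLift Γ x₀ (l.toFun (visitTime Γ x₀ l i)) * (h i).1

lemma frame_zero (l : Geod T) (h : ℤ → MulAction.stabilizer Γ x₀) : frame l h 0 = 1 := if_pos rfl

lemma frame_smul {l : Geod T} (hl : l ∈ rooted Γ V' x₀) (h : ℤ → MulAction.stabilizer Γ x₀)
    (i : ℤ) : frame l h i • x₀ = l.toFun (visitTime Γ x₀ l i) := by
  rcases eq_or_ne i 0 with rfl | hi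
  · rw [frame_zero, one_smul, (isVisits_visitTime hl).zero, hl.2]
  · rw [frame, if_neg hi, mul_smul, show (h i).1 • x₀ = x₀ from (h i).2,
      orbitLift_smul ((isVisits_visitTime hl).mem i)]

lemma frame_letter_mem (hT : T.IsTree) {l : Geod T} (hl : l ∈ rooted Γ V' x₀)
    (h : ℤ → MulAction.stabilizer Γ x₀) (i : ℤ) :
    (frame l h i)⁻¹ * frame l h (i + 1) ∉ MulAction.stabilizer Γ x₀ ∧
    ∀ z : V, OnSegment T x₀ (((frame l h i)⁻¹ * frame l h (i + 1)) • x₀) z → z ≠ x₀ →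
      z ≠ ((frame l h i)⁻¹ * frame l h (i + 1)) • x₀ → z ∉ MulAction.orbit Γ x₀ := by
  have hv := isVisits_visitTime hl
  have hlt := hv.strictMono (show i < i + 1 by omega)
  set g := frame l h i with hg
  have e1 : g • x₀ = l.toFun (visitTime Γ x₀ l i) := frame_smul hl h i
  have e2 : g • ((g⁻¹ * frame l h (i + 1)) • x₀) = l.toFun (visitTime Γ x₀ l (i + 1)) := by
    rw [smul_smul, mul_inv_cancel_left, frame_smul hl h]
  constructor
  · intro hs
    rw [MulAction.mem_stabilizer_iff] at hs
    rw [hs, e1] at e2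
    exact hlt.ne (l.inj e2)
  · intro z hz h1 h2 hzo
    rw [← onSegment_smul hT g, e1, e2] at hz
    set t := visitTime Γ x₀ l i + T.dist (l.toFun (visitTime Γ x₀ l i)) (g • z) with ht
    have hle := hz.dist_le
    rw [l.dist_eq hT] at hle
    have hlz : l.toFun t = g • z := by
      refine (l.onSegment hT (a := visitTime Γ x₀ l i) (b := t) (c := visitTime Γ x₀ l (i + 1))
        (by omega) (by omega)).eq_of_dist_eq hT hz ?_
      rw [l.dist_eq hT]
      omega
    have ht1 : t ≠ visitTime Γ x₀ l i := by
      intro he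
      rw [he, ← e1] at hlz
      exact h1 (MulAction.injective g hlz).symm
    have ht2 : t ≠ visitTime Γ x₀ l (i + 1) := by
      intro he
      rw [he, ← e2] at hlz
      exact h2 (MulAction.injective g hlz).symm
    refine hv.notMem (i := i) (t := t) (by omega) (by omega) ?_
    rw [hlz]
    exact smul_mem_orbit g hzo

lemma frame_letter_allowed (hT : T.IsTree) {l : Geod T} (hl : l ∈ rooted Γ V' x₀)
    (h : ℤ → MulAction.stabilizer Γ x₀) (i : ℤ) :
    OnSegment T (((frame l h i)⁻¹ * frame l h (i + 1))⁻¹ • x₀)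
      (((frame l h (i + 1))⁻¹ * frame l h (i + 1 + 1)) • x₀) x₀ := by
  have hv := (isVisits_visitTime hl).strictMono
  rw [← onSegment_smul hT (frame l h (i + 1)), smul_smul, smul_smul, mul_inv_cancel_left,
    mul_inv_rev, inv_inv, mul_inv_cancel_left, frame_smul hl, frame_smul hl, frame_smul hl]
  exact l.onSegment hT (hv (by omega)).le (hv (by omega)).le

/-- The code of a recurrent geodesic line with origin `x₀`, depending on the choice of a sequence of
elements of the stabiliser of `x₀`. -/
noncomputable def code (hT : T.IsTree) (p : rooted Γ V' x₀ × (ℤ → MulAction.stabilizer Γ x₀)) :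
    Subshift (Allowed (Γ := Γ) (x₀ := x₀)) :=
  ⟨fun i => ⟨(frame p.1.1 p.2 i)⁻¹ * frame p.1.1 p.2 (i + 1), frame_letter_mem hT p.1.2 p.2 i⟩,
    fun i => frame_letter_allowed hT p.1.2 p.2 i⟩

lemma frame_eq_cocycle (hT : T.IsTree) (p : rooted Γ V' x₀ × (ℤ → MulAction.stabilizer Γ x₀)) :
    frame p.1.1 p.2 = cocycle fun i => ((code hT p).1 i).1 :=
  cocycle_unique (frame_zero _ _) fun i => by
    change _ = _ * ((frame p.1.1 p.2 i)⁻¹ * frame p.1.1 p.2 (i + 1))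
    rw [mul_inv_cancel_left]

lemma codedLine_code (hT : T.IsTree) (p : rooted Γ V' x₀ × (ℤ → MulAction.stabilizer Γ x₀)) :
    codedLine hT (code hT p) = p.1.1 := by
  have hv := isVisits_visitTime p.1.2
  refine (eq_chainLine hT _ hv.strictMono hv.zero fun i => ?_).symm
  rw [pathPt, ← frame_eq_cocycle, frame_smul p.1.2]

lemma coding_code (hT : T.IsTree) (hx₀ : x₀ ∈ V')
    (p : rooted Γ V' x₀ × (ℤ → MulAction.stabilizer Γ x₀)) :
    (coding hT hx₀ (code hT p) : section₀ Γ V' x₀).1 = proj Γ p.1.1 :=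
  congrArg (proj Γ) (codedLine_code hT p)

lemma surjective_coding (hT : T.IsTree) (hV' : IsAdapted Γ N V') (hx₀ : x₀ ∈ V') :
    Function.Surjective (coding hT hx₀ : Subshift (Allowed (Γ := Γ) (x₀ := x₀)) →
      section₀ Γ V' x₀) := by
  rintro ⟨_, l, hl, rfl⟩
  obtain ⟨g, hg⟩ : ∃ g : Γ, g • x₀ = l.toFun 0 := hl.2
  have hl' : g⁻¹ • l ∈ rooted Γ V' x₀ := by
    refine ⟨hV'.smul_mem_recurrent g⁻¹ hl.1, ?_⟩
    change g⁻¹ • l.toFun 0 = x₀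
    rw [← hg, inv_smul_smul]
  refine ⟨code hT (⟨g⁻¹ • l, hl'⟩, fun _ => 1), Subtype.ext ?_⟩
  rw [coding_code]
  exact proj_smul _ _

lemma IsVisits.eq_of_consecutive {l : Geod T} {σ τ : ℤ → ℤ} (hσ : IsVisits Γ x₀ l σ) {a b : ℤ}
    (ha : a ≤ 0) (hb : 0 ≤ b) (h0 : τ 0 = 0)
    (hmem : ∀ i, a ≤ i → i ≤ b → l.toFun (τ i) ∈ MulAction.orbit Γ x₀)
    (hlt : ∀ i, a ≤ i → i < b → τ i < τ (i + 1))
    (hno : ∀ i, a ≤ i → i < b → ∀ t, τ i < t → t < τ (i + 1) →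
      l.toFun t ∉ MulAction.orbit Γ x₀) {i : ℤ} (hai : a ≤ i) (hib : i ≤ b) : σ i = τ i := by
  have key : ∀ i j, a ≤ j → j < b → (σ i = τ j → σ (i + 1) = τ (j + 1)) ∧
      (σ (i + 1) = τ (j + 1) → σ i = τ j) := by
    intro i j hj hjb
    obtain ⟨u, hu⟩ := (hσ.mem_iff _).1 (hmem j hj hjb.le)
    obtain ⟨v, hv⟩ := (hσ.mem_iff _).1 (hmem (j + 1) (by omega) (by omega))
    have h1 := hlt j hj hjb
    rw [← hu, ← hv, hσ.strictMono.lt_iff_lt] at h1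
    have h2 : v = u + 1 := by
      by_contra hne
      refine hno j hj hjb (σ (u + 1)) ?_ ?_ (hσ.mem _)
      · rw [← hu]
        exact hσ.strictMono (by omega)
      · rw [← hv]
        exact hσ.strictMono (by omega)
    rw [← hu, ← hv, h2]
    constructor
    · intro h
      rw [hσ.strictMono.injective h]
    · intro h
      rw [add_right_cancel (hσ.strictMono.injective h)]
  have main : ∀ n : ℕ, (n ≤ b → σ n = τ n) ∧ (a ≤ -n → σ (-n) = τ (-n)) := by
    intro n
    induction n with
    | zero => simp [h0, hσ.zero]
    | succ n ih =>
      push_cast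
      constructor
      · intro hn
        exact (key n n (by omega) (by omega)).1 (ih.1 (by omega))
      · intro hn
        have h1 := (key (-(n + 1 : ℤ)) (-(n + 1 : ℤ)) (by omega) (by omega)).2
        rw [show -(n + 1 : ℤ) + 1 = -n by ring] at h1
        exact h1 (ih.2 (by omega))
  rcases le_total 0 i with hi | hi
  · have := (main i.toNat).1 (by omega)
    rwa [Int.toNat_of_nonneg hi] at this
  · have := (main (-i).toNat).2 (by omega)
    rwa [show -((-i).toNat : ℤ) = i by omega] at this

/-- The visits of `l` between the indices `a` and `b` are prescribed by a word if and only if `l`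
passes through the two extreme points given by this word. -/
lemma visits_eq_iff (hT : T.IsTree) {l : Geod T} (hl : l ∈ rooted Γ V' x₀)
    {w : ℤ → Alphabet Γ x₀} {a b : ℤ} (ha : a ≤ 0) (hb : 0 ≤ b)
    (hA : ∀ i, a ≤ i → i + 1 < b → Allowed (w i) (w (i + 1))) :
    (∀ i, a ≤ i → i ≤ b → l.toFun (visitTime Γ x₀ l i) = pathPt w i) ↔
      l.toFun (-T.dist x₀ (pathPt w a)) = pathPt w a ∧
        l.toFun (T.dist x₀ (pathPt w b)) = pathPt w b := by
  have hv := isVisits_visitTime hl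
  constructor
  · intro h
    have h1 := h a le_rfl (ha.trans hb)
    have h2 := h b (ha.trans hb) le_rfl
    have m1 := hv.strictMono.monotone ha
    have m2 := hv.strictMono.monotone hb
    rw [hv.zero] at m1 m2
    have d1 := l.dist_eq hT 0 (visitTime Γ x₀ l a)
    have d2 := l.dist_eq hT 0 (visitTime Γ x₀ l b)
    rw [h1, hl.2] at d1
    rw [h2, hl.2] at d2
    rw [d1, d2]
    constructor
    · convert h1 using 2
      omega
    · convert h2 using 2
      omega
  · rintro ⟨h1, h2⟩ i hai hib
    have hc : IsChain T (pathPt w) a b := isChain_pathPt hT hA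
    have hsub := fun {i j : ℤ} => hc.arcTime_sub hT ha hb (i := i) (j := j)
    have da := hsub le_rfl ha hb
    have db := hsub ha hb le_rfl
    rw [arcTime_zero, pathPt_zero] at da db
    rw [SimpleGraph.dist_comm] at da
    rw [show -(T.dist x₀ (pathPt w a) : ℤ) = arcTime T (pathPt w) a by omega] at h1
    rw [show (T.dist x₀ (pathPt w b) : ℤ) = arcTime T (pathPt w) b by omega] at h2
    have key : ∀ i, a ≤ i → i ≤ b → l.toFun (arcTime T (pathPt w) i) = pathPt w i := by
      intro i hai hib
      have e1 := hsub le_rfl hai hib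
      have e2 := hsub hai hib le_rfl
      have s1 := l.onSegment hT (a := arcTime T (pathPt w) a) (b := arcTime T (pathPt w) i)
        (c := arcTime T (pathPt w) b) (by omega) (by omega)
      rw [h1, h2] at s1
      refine s1.eq_of_dist_eq hT (hc.onSegment hT le_rfl hai hib le_rfl) ?_
      rw [← h1, l.dist_eq hT, h1]
      omega
    rw [hv.eq_of_consecutive (τ := arcTime T (pathPt w)) ha hb (arcTime_zero _) ?_ ?_ ?_ hai hib,
      key i hai hib]
    · intro i hai hib
      rw [key i hai hib]
      exact pathPt_mem_orbit _ _
    · intro i hai hib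
      have := hc.le_arcTime_sub hT ha hb hai (show i ≤ i + 1 by omega) (by omega)
      omega
    · intro i hai hib t ht1 ht2
      have hseg := l.onSegment hT ht1.le ht2.le
      have k1 := key i hai hib.le
      have k2 := key (i + 1) (by omega) (by omega)
      rw [k1, k2] at hseg
      refine notMem_orbit_of_between hT w hseg ?_ ?_
      · rw [← k1]
        exact fun e => ht1.ne (l.inj e).symm
      · rw [← k2]
        exact fun e => ht2.ne (l.inj e)

/-- The element of the stabiliser of `x₀` which relates a partial product of a sequence of letters
to the chosen element of the group with the same action on `x₀`. -/
noncomputable def stabPart (w : ℤ → Alphabet Γ x₀) (i : ℤ) : MulAction.stabilizer Γ x₀ :=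
  ⟨(orbitLift Γ x₀ (pathPt w i))⁻¹ * cocycle (fun j => (w j).1) i, by
    rw [MulAction.mem_stabilizer_iff, mul_smul, inv_smul_eq_iff,
      orbitLift_smul (pathPt_mem_orbit w i)]
    rfl⟩

lemma frame_eq_iff {l : Geod T} (hl : l ∈ rooted Γ V' x₀) (h : ℤ → MulAction.stabilizer Γ x₀)
    (w : ℤ → Alphabet Γ x₀) (i : ℤ) : frame l h i = cocycle (fun j => (w j).1) i ↔
      l.toFun (visitTime Γ x₀ l i) = pathPt w i ∧ (i ≠ 0 → h i = stabPart w i) := by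
  rcases eq_or_ne i 0 with rfl | hi
  · simp [frame_zero, (isVisits_visitTime hl).zero, hl.2]
  · constructor
    · intro he
      have h1 : l.toFun (visitTime Γ x₀ l i) = pathPt w i := by
        rw [← frame_smul hl h, he]
        rfl
      refine ⟨h1, fun _ => Subtype.ext ?_⟩
      rw [frame, if_neg hi, h1] at he
      exact eq_inv_mul_of_mul_eq he
    · rintro ⟨h1, h2⟩
      rw [frame, if_neg hi, h1, h2 hi]
      exact mul_inv_cancel_left _ _

lemma code_eq_iff (hT : T.IsTree) (p : rooted Γ V' x₀ × (ℤ → MulAction.stabilizer Γ x₀))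
    {w : ℤ → Alphabet Γ x₀} {a b : ℤ} (ha : a ≤ 0) (hb : 0 ≤ b) :
    (∀ i, a ≤ i → i < b → (code hT p).1 i = w i) ↔
      ∀ i, a ≤ i → i ≤ b → frame p.1.1 p.2 i = cocycle (fun j => (w j).1) i := by
  constructor
  · intro h i hai hib
    refine cocycle_congr ha hb (frame_zero _ _) (fun i hai hib => ?_) hai hib
    rw [← h i hai hib]
    exact (mul_inv_cancel_left _ _).symm
  · intro h i hai hib
    refine Subtype.ext ?_
    change (frame p.1.1 p.2 i)⁻¹ * frame p.1.1 p.2 (i + 1) = (w i).1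
    rw [h i hai hib.le, h (i + 1) (by omega) (by omega), cocycle_add_one, inv_mul_cancel_left]

instance : MeasurableSpace (MulAction.stabilizer Γ x₀) := ⊤

instance : DiscreteMeasurableSpace (MulAction.stabilizer Γ x₀) := ⟨fun _ => trivial⟩

lemma measurable_code [Countable V] [Countable Γ] [Countable (Alphabet Γ x₀)] (hT : T.IsTree) :
    Measurable (code hT :
      rooted Γ V' x₀ × (ℤ → MulAction.stabilizer Γ x₀) → Subshift (Allowed (Γ := Γ) (x₀ := x₀))) := by
  have hf : ∀ i, DiscMeas fun p : rooted Γ V' x₀ × (ℤ → MulAction.stabilizer Γ x₀) =>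
      frame p.1.1 p.2 i := by
    intro i
    have h1 := (discMeas_visitPt (Γ := Γ) (V' := V') (x₀ := x₀) i).comp
      (measurable_fst (α := rooted Γ V' x₀) (β := ℤ → MulAction.stabilizer Γ x₀))
    have h2 : DiscMeas fun p : rooted Γ V' x₀ × (ℤ → MulAction.stabilizer Γ x₀) => p.2 i :=
      fun t => (measurable_pi_apply i).comp measurable_snd (MeasurableSet.of_discrete (s := t))
    unfold frame
    split_ifs
    · exact fun t => MeasurableSet.const (1 ∈ t)
    · exact (h1.pair h2).map fun p => orbitLift Γ x₀ p.1 * p.2.1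
  refine Measurable.subtype_mk (measurable_pi_iff.2 fun i => DiscMeas.measurable ?_)
  refine DiscMeas.of_singleton fun a => ?_
  have h := ((hf i).pair (hf (i + 1))).setOf fun q => q.1⁻¹ * q.2 = a.1
  convert h using 1
  ext p
  exact Subtype.ext_iff

/-- The uniform probability on the stabiliser of `x₀`. -/
noncomputable def stabUniform (Γ : Subgroup (T ≃g T)) (x₀ : V) :
    Measure (MulAction.stabilizer Γ x₀) :=
  (Nat.card (MulAction.stabilizer Γ x₀) : ℝ≥0∞)⁻¹ • Measure.count

instance [Finite (MulAction.stabilizer Γ x₀)] : IsProbabilityMeasure (stabUniform Γ x₀) := by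
  refine ⟨?_⟩
  have : Fintype (MulAction.stabilizer Γ x₀) := Fintype.ofFinite _
  rw [stabUniform, Measure.smul_apply, smul_eq_mul, Measure.count_univ, ENat.card_eq_coe_natCard]
  exact ENNReal.inv_mul_cancel (Nat.cast_ne_zero.2 Nat.card_pos.ne') (by simp)

lemma stabUniform_singleton (g : MulAction.stabilizer Γ x₀) :
    stabUniform Γ x₀ {g} = (Nat.card (MulAction.stabilizer Γ x₀) : ℝ≥0∞)⁻¹ := by
  rw [stabUniform, Measure.smul_apply, Measure.count_singleton, smul_eq_mul, mul_one]

/-- The normalised restriction of a measure to the recurrent geodesic lines with origin `x₀`. -/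
noncomputable def rootedProb (Γ : Subgroup (T ≃g T)) (V' : Set V) (x₀ : V) (m : Measure (Geod T)) :
    Measure (rooted Γ V' x₀) :=
  (m (rooted Γ V' x₀))⁻¹ • m.comap Subtype.val

lemma rootedProb_apply (m : Measure (Geod T)) (B : Set (rooted Γ V' x₀)) :
    rootedProb Γ V' x₀ m B = (m (rooted Γ V' x₀))⁻¹ * m (Subtype.val '' B) := by
  rw [rootedProb, Measure.smul_apply, comap_subtype_coe_apply measurableSet_rooted, smul_eq_mul]

lemma isProbabilityMeasure_rootedProb {m : Measure (Geod T)} (h0 : m (rooted Γ V' x₀) ≠ 0)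
    (h1 : m (rooted Γ V' x₀) ≠ ∞) : IsProbabilityMeasure (rootedProb Γ V' x₀ m) :=
  ⟨by rw [rootedProb_apply, image_univ, Subtype.range_coe, ENNReal.inv_mul_cancel h0 h1]⟩

/-- The Markov measure on the subshift: the image by the coding of the normalised measure on the
recurrent geodesic lines with origin `x₀`, with a uniform choice of elements of the stabiliser. -/
noncomputable def markovMeasure [Finite (MulAction.stabilizer Γ x₀)] (hT : T.IsTree) (V' : Set V)
    (m : Measure (Geod T)) :
    Measure (Subshift (Allowed (Γ := Γ) (x₀ := x₀))) :=
  ((rootedProb Γ V' x₀ m).prod (Measure.infinitePi fun _ : ℤ => stabUniform Γ x₀)).map (code hT)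

variable [Countable V] [Countable Γ] [Countable (Alphabet Γ x₀)]
  [Finite (MulAction.stabilizer Γ x₀)]

/-- The mass of a cylinder for a word whose consecutive letters are allowed. -/
lemma markovMeasure_cylinder (hT : T.IsTree) {m : Measure (Geod T)}
    [IsProbabilityMeasure (rootedProb Γ V' x₀ m)] {w : ℤ → Alphabet Γ x₀} {a b : ℤ} (ha : a ≤ 0)
    (hb : 0 ≤ b) (hA : ∀ i, a ≤ i → i + 1 < b → Allowed (w i) (w (i + 1))) :
    markovMeasure hT V' m {s | ∀ i, a ≤ i → i < b → s.1 i = w i} =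
      (m (rooted Γ V' x₀))⁻¹ * m (rooted Γ V' x₀ ∩
        {l | l.toFun (-T.dist x₀ (pathPt w a)) = pathPt w a ∧
          l.toFun (T.dist x₀ (pathPt w b)) = pathPt w b}) *
      (Nat.card (MulAction.stabilizer Γ x₀) : ℝ≥0∞)⁻¹ ^ (b - a).toNat := by
  have hcyl : MeasurableSet {s : Subshift (Allowed (Γ := Γ) (x₀ := x₀)) |
      ∀ i, a ≤ i → i < b → s.1 i = w i} := by
    simp only [ofPred_forall]
    exact MeasurableSet.iInter fun i => MeasurableSet.iInter fun _ => MeasurableSet.iInter fun _ =>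
      (Subshift.discMeas_apply i).setOf fun c => c = w i
  rw [markovMeasure, Measure.map_apply (measurable_code hT) hcyl]
  have hpre : code hT ⁻¹' {s : Subshift (Allowed (Γ := Γ) (x₀ := x₀)) |
      ∀ i, a ≤ i → i < b → s.1 i = w i} =
      {l : rooted Γ V' x₀ | l.1.toFun (-T.dist x₀ (pathPt w a)) = pathPt w a ∧
          l.1.toFun (T.dist x₀ (pathPt w b)) = pathPt w b} ×ˢ
        (((Finset.Icc a b).erase 0 : Finset ℤ) : Set ℤ).pi fun i => {stabPart w i} := by
    ext p
    rw [mem_preimage, mem_ofPred_eq, code_eq_iff hT p ha hb, mem_prod, mem_ofPred_eq,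
      ← visits_eq_iff hT p.1.2 ha hb hA]
    simp only [frame_eq_iff p.1.2, Set.mem_pi, Finset.mem_coe, Finset.mem_erase, Finset.mem_Icc,
      mem_singleton_iff]
    constructor
    · exact fun h => ⟨fun i h1 h2 => (h i h1 h2).1, fun i hi => (h i hi.2.1 hi.2.2).2 hi.1⟩
    · exact fun h i h1 h2 => ⟨h.1 i h1 h2, fun h0 => h.2 i ⟨h0, h1, h2⟩⟩
  rw [hpre, Measure.prod_prod, rootedProb_apply,
    Measure.infinitePi_pi _ fun i _ => measurableSet_singleton _]
  simp only [stabUniform_singleton, Finset.prod_const]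
  congr 2
  · congr 1
    ext l
    constructor
    · rintro ⟨l, hl, rfl⟩
      exact ⟨l.2, hl⟩
    · rintro ⟨hl, h⟩
      exact ⟨⟨l, hl⟩, h, rfl⟩
  · rw [Finset.card_erase_of_mem (by simp [ha, hb]), Int.card_Icc]
    omega

/-- The image of the Markov measure by the coding map. -/
lemma map_coding_markovMeasure (hT : T.IsTree) (hV' : IsAdapted Γ N V') (hx₀ : x₀ ∈ V')
    {m : Measure (Geod T)} (hm : IsInvariant Γ m) [IsProbabilityMeasure (rootedProb Γ V' x₀ m)] :
    (markovMeasure hT V' m).map (coding hT hx₀) = sectionProb Γ V' x₀ m := by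
  have hn0 : (Nat.card (MulAction.stabilizer Γ x₀) : ℝ≥0∞) ≠ 0 :=
    Nat.cast_ne_zero.2 Nat.card_pos.ne'
  have hnt : (Nat.card (MulAction.stabilizer Γ x₀) : ℝ≥0∞) ≠ ∞ := by simp
  ext E hE
  have hF : MeasurableSet (proj Γ ⁻¹' (Subtype.val '' E)) :=
    measurable_proj Γ (hV'.measurableSet_section.subtype_image hE)
  have hpre : code hT ⁻¹' (coding hT hx₀ ⁻¹' E) =
      {l : rooted Γ V' x₀ | l.1 ∈ proj Γ ⁻¹' (Subtype.val '' E)} ×ˢ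
        (univ : Set (ℤ → MulAction.stabilizer Γ x₀)) := by
    ext p
    simp only [mem_preimage, mem_prod, mem_univ, and_true, mem_ofPred_eq]
    rw [← coding_code hT hx₀ p]
    exact (Subtype.val_injective.mem_set_image).symm
  rw [Measure.map_apply (measurable_coding hT hx₀) hE, markovMeasure,
    Measure.map_apply (measurable_code hT) (measurable_coding hT hx₀ hE), hpre, Measure.prod_prod,
    measure_univ, mul_one, rootedProb_apply, sectionProb, Measure.smul_apply, smul_eq_mul,
    hV'.sectionMeasure_univ hm, hV'.sectionMeasure_apply hm hE,
    ENNReal.mul_inv (Or.inl (ENNReal.inv_ne_zero.2 hnt)) (Or.inl (ENNReal.inv_ne_top.2 hn0)),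
    inv_inv]
  have himg : Subtype.val '' {l : rooted Γ V' x₀ | l.1 ∈ proj Γ ⁻¹' (Subtype.val '' E)} =
      proj Γ ⁻¹' (Subtype.val '' E) ∩ {l | l.toFun 0 = x₀} := by
    ext l
    constructor
    · rintro ⟨l, hl, rfl⟩
      exact ⟨hl, l.2.2⟩
    · rintro ⟨hl, h0⟩
      refine ⟨⟨l, ⟨?_, h0⟩⟩, hl, rfl⟩
      obtain ⟨z, -, hz⟩ := hl
      exact (hV'.proj_mem_section.1 (hz ▸ z.2)).1
  rw [himg]
  calc (m (rooted Γ V' x₀))⁻¹ * m (proj Γ ⁻¹' (Subtype.val '' E) ∩ {l | l.toFun 0 = x₀})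
      = ((Nat.card (MulAction.stabilizer Γ x₀) : ℝ≥0∞) *
          (Nat.card (MulAction.stabilizer Γ x₀) : ℝ≥0∞)⁻¹) * ((m (rooted Γ V' x₀))⁻¹ *
          m (proj Γ ⁻¹' (Subtype.val '' E) ∩ {l | l.toFun 0 = x₀})) := by
        rw [ENNReal.mul_inv_cancel hn0 hnt, one_mul]
    _ = _ := by ring

end Markov

/-! ### Measures on a subshift -/

section Subshift

variable {S : Type*} [MeasurableSpace S] [DiscreteMeasurableSpace S]
  {A : S → S → Prop}

lemma Subshift.measurable_shift : Measurable (Subshift.shift (A := A)) :=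
  have h : Measurable fun s : Subshift A => fun i : ℤ => s.1 (i + 1) :=
    measurable_pi_iff.2 fun i => (Subshift.discMeas_apply (i + 1)).measurable
  h.subtype_mk

lemma Subshift.measurableSet_cylinder (a b : ℤ) (w : ℤ → S) :
    MeasurableSet {s : Subshift A | ∀ i, a ≤ i → i < b → s.1 i = w i} := by
  simp only [ofPred_forall]
  exact MeasurableSet.iInter fun i => MeasurableSet.iInter fun _ => MeasurableSet.iInter fun _ =>
    (Subshift.discMeas_apply i).setOf fun c => c = w i

variable [Countable S]

/-- Two probability measures on a subshift are equal as soon as they coincide on the cylinders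
whose window contains `-1` and `0`. -/
lemma Subshift.ext_of_cylinder {P Q : Measure (Subshift A)} [IsProbabilityMeasure P]
    [IsProbabilityMeasure Q]
    (h : ∀ (n : ℕ) (w : ℤ → S), 1 ≤ n →
      P {s | ∀ i : ℤ, -n ≤ i → i < n → s.1 i = w i} =
        Q {s | ∀ i : ℤ, -n ≤ i → i < n → s.1 i = w i}) : P = Q := by
  let C : Set (Set (Subshift A)) := {B | ∃ (n : ℕ) (w : ℤ → S), 1 ≤ n ∧
    B = {s | ∀ i : ℤ, -n ≤ i → i < n → s.1 i = w i}}
  refine ext_of_generate_finite C ?_ ?_ ?_ (by simp)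
  · refine le_antisymm ?_ ?_
    · have key : ∀ i : ℤ, @Measurable _ _ (MeasurableSpace.generateFrom C) _
          fun s : Subshift A => s.1 i := by
        intro i
        refine @measurable_to_countable' _ _ _ _ (MeasurableSpace.generateFrom C) _ fun v => ?_
        set n := i.natAbs + 1 with hn
        have hU : (fun s : Subshift A => s.1 i) ⁻¹' {v} =
            ⋃ u : {u : (Finset.Ico (-n : ℤ) n) → S // ∀ h, u ⟨i, h⟩ = v}, {s : Subshift A |
              ∀ j : ℤ, -n ≤ j → j < n → s.1 j =
                if h : j ∈ Finset.Ico (-n : ℤ) n then u.1 ⟨j, h⟩ else v} := by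
          ext s
          simp only [mem_preimage, mem_singleton_iff, mem_iUnion, mem_ofPred_eq]
          constructor
          · intro hs
            refine ⟨⟨fun j => s.1 j, fun _ => hs⟩, fun j h1 h2 => ?_⟩
            rw [dif_pos (Finset.mem_Ico.2 ⟨h1, h2⟩)]
          · rintro ⟨u, hu⟩
            have hi : i ∈ Finset.Ico (-n : ℤ) n := Finset.mem_Ico.2 ⟨by omega, by omega⟩
            rw [hu i (by omega) (by omega), dif_pos hi, u.2 hi]
        rw [hU]
        refine @MeasurableSet.iUnion _ _ (MeasurableSpace.generateFrom C) _ _ fun u => ?_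
        exact MeasurableSpace.measurableSet_generateFrom ⟨n, _, by omega, rfl⟩
      rintro _ ⟨D, hD, rfl⟩
      exact (@measurable_pi_iff _ _ _ (MeasurableSpace.generateFrom C) _ _).2 key hD
    · refine MeasurableSpace.generateFrom_le ?_
      rintro _ ⟨n, w, -, rfl⟩
      exact Subshift.measurableSet_cylinder _ _ _
  · rintro _ ⟨n, w, hn, rfl⟩ _ ⟨n', w', hn', rfl⟩ ⟨s, hs, hs'⟩
    refine ⟨max n n', s.1, by omega, ?_⟩
    ext r
    simp only [mem_inter_iff, mem_ofPred_eq] at hs hs' ⊢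
    constructor
    · rintro ⟨h1, h2⟩ i hi hi'
      rcases le_total n n' with hle | hle
      · rw [max_eq_right hle] at hi hi'
        rw [h2 i hi hi', hs' i hi hi']
      · rw [max_eq_left hle] at hi hi'
        rw [h1 i hi hi', hs i hi hi']
    · intro hr
      exact ⟨fun i hi hi' => (hr i (by omega) (by omega)).trans (hs i hi hi'),
        fun i hi hi' => (hr i (by omega) (by omega)).trans (hs' i hi hi')⟩
  · rintro _ ⟨n, w, hn, rfl⟩
    exact h n w hn

end Subshift

section Formula

variable {V : Type*} {T : SimpleGraph V} {Γ : Subgroup (T ≃g T)} {V' : Set V} {N : ℕ} {x₀ : V}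
  {δ : ℝ} {μ : V → Measure (Bdry T)}

lemma inv_mul_cocycle_smul (w : ℤ → Alphabet Γ x₀) (a b : ℤ) :
    ((cocycle (fun j => (w j).1) a)⁻¹ * cocycle (fun j => (w j).1) b) • x₀ =
      (cocycle (fun j => (w j).1) a)⁻¹ • pathPt w b := mul_smul _ _ _

/-- The product of the masses of the two shadows defined by a word. -/
lemma IsPattersonSullivan.shadow_mul_shadow_word (hT : T.IsTree) (hμ : IsPattersonSullivan Γ δ μ)
    {w : ℤ → Alphabet Γ x₀} {a b : ℤ} (ha : a ≤ 0) (hb : 0 ≤ b) (hab : a < b)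
    (hA : ∀ i, a ≤ i → i + 1 < b → Allowed (w i) (w (i + 1))) :
    μ x₀ (shadow T (pathPt w b) (pathPt w a)) * μ x₀ (shadow T (pathPt w a) (pathPt w b)) =
      μ x₀ (shadow T ((w a).1 • x₀) x₀) * μ x₀ (shadow T x₀
        (((cocycle (fun j => (w j).1) a)⁻¹ * cocycle (fun j => (w j).1) b) • x₀)) := by
  have hc : IsChain T (pathPt w) a b := isChain_pathPt hT hA
  have hx := hc.onSegment hT le_rfl ha hb le_rfl
  rw [pathPt_zero] at hx
  rw [hμ.shadow_mul_shadow hT hx, inv_mul_cocycle_smul]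
  set g := cocycle (fun j => (w j).1) a with hg
  have e1 : pathPt w (a + 1) = g • (w a).1 • x₀ := pathPt_add_one w a
  have h1 : shadow T (pathPt w b) (pathPt w a) = shadow T (pathPt w (a + 1)) (pathPt w a) := by
    refine shadow_eq hT (hc.onSegment hT le_rfl (show a ≤ a + 1 by omega) (by omega) le_rfl).symm ?_
    exact (hc.ne a le_rfl hab).symm
  have e2 : pathPt w a = g • x₀ := rfl
  have e3 : pathPt w b = g • g⁻¹ • pathPt w b := (smul_inv_smul _ _).symm
  rw [h1, e1, e2]
  conv_lhs => rw [e3]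
  rw [hμ.shadow_smul, hμ.shadow_smul]

lemma transProb_of_allowed {a b : Alphabet Γ x₀} (h : Allowed a b) :
    transProb Γ μ x₀ a b = μ x₀ (shadow T (a.1 • x₀) ((a.1 * b.1) • x₀)) /
      ((Nat.card (MulAction.stabilizer Γ x₀) : ℝ≥0∞) * μ x₀ (shadow T x₀ (a.1 • x₀))) :=
  if_pos h

lemma transProb_of_not_allowed {a b : Alphabet Γ x₀} (h : ¬ Allowed a b) :
    transProb Γ μ x₀ a b = 0 := if_neg h

lemma Allowed.onSegment (hT : T.IsTree) {a b : Alphabet Γ x₀} (h : Allowed a b) :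
    OnSegment T x₀ ((a.1 * b.1) • x₀) (a.1 • x₀) := by
  have := (onSegment_smul hT a.1).2 h
  rwa [smul_inv_smul, smul_smul] at this

lemma Allowed.ne (hT : T.IsTree) {a b : Alphabet Γ x₀} (h : Allowed a b) :
    x₀ ≠ (a.1 * b.1) • x₀ := by
  intro he
  have h1 := h.onSegment hT
  rw [← he] at h1
  unfold OnSegment at h1
  rw [SimpleGraph.dist_self] at h1
  exact a.smul_ne ((dist_zero_iff hT).1 (show T.dist x₀ (a.1 • x₀) = 0 by omega)).symm

lemma Allowed.smul_ne {a b : Alphabet Γ x₀} (_h : Allowed a b) :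
    a.1 • x₀ ≠ (a.1 * b.1) • x₀ := by
  rw [mul_smul]
  exact fun h => b.smul_ne (MulAction.injective a.1 h.symm)

/-- The mass of a shadow defined by a word, as a product of transition probabilities. -/
lemma word_formula [Finite (MulAction.stabilizer Γ x₀)] (hT : T.IsTree)
    (hμ : IsPattersonSullivan Γ δ μ) {M : ℝ≥0∞}
    (hpos : ∀ a : Alphabet Γ x₀, μ x₀ (shadow T x₀ (a.1 • x₀)) ≠ 0) (w : ℤ → Alphabet Γ x₀)
    (a : ℤ) (k : ℕ) (hA : ∀ i, a ≤ i → i < a + k → Allowed (w i) (w (i + 1))) :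
    M * μ x₀ (shadow T x₀ (((cocycle (fun j => (w j).1) a)⁻¹ *
        cocycle (fun j => (w j).1) (a + k + 1)) • x₀)) *
        (Nat.card (MulAction.stabilizer Γ x₀) : ℝ≥0∞)⁻¹ ^ k =
      M * μ x₀ (shadow T x₀ ((w a).1 • x₀)) *
        ∏ j ∈ Finset.range k, transProb Γ μ x₀ (w (a + j)) (w (a + j + 1)) := by
  have := hμ.finite x₀
  set n := (Nat.card (MulAction.stabilizer Γ x₀) : ℝ≥0∞) with hn
  have hn0 : n ≠ 0 := Nat.cast_ne_zero.2 Nat.card_pos.ne'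
  have hnt : n ≠ ∞ := by simp [hn]
  induction k with
  | zero => simp [cocycle_add_one]
  | succ k ih =>
    rw [Finset.prod_range_succ, ← mul_assoc, ← ih fun i h1 h2 => hA i h1 (by push_cast; omega)]
    push_cast at hA ⊢
    set c := cocycle (fun j => (w j).1) with hc
    have hal : Allowed (w (a + k)) (w (a + k + 1)) := hA _ (by omega) (by omega)
    have hch : IsChain T (pathPt w) a (a + k + 2) :=
      isChain_pathPt hT fun i h1 h2 => hA i h1 (by omega)
    set K := (c a)⁻¹ * c (a + k) with hK
    have e1 : (c a)⁻¹ * c (a + k + 1) = K * (w (a + k)).1 := by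
      rw [hc, cocycle_add_one, hK, mul_assoc]
    have e2 : (c a)⁻¹ * c (a + (k + 1) + 1) = K * ((w (a + k)).1 * (w (a + k + 1)).1) := by
      rw [← add_assoc, hc, cocycle_add_one, ← hc, ← mul_assoc, e1, mul_assoc]
    have f1 : pathPt w a = c a • x₀ := rfl
    have f2 : pathPt w (a + k) = c a • K • x₀ := by
      rw [smul_smul, hK, mul_inv_cancel_left]
      rfl
    have f3 : pathPt w (a + k + 1) = c a • K • (w (a + k)).1 • x₀ := by
      rw [← mul_smul K, ← e1, smul_smul, mul_inv_cancel_left]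
      rfl
    have f4 : pathPt w (a + k + 2) = c a • K • ((w (a + k)).1 * (w (a + k + 1)).1) • x₀ := by
      rw [← mul_smul K, ← e2, smul_smul, mul_inv_cancel_left, show a + (k : ℤ) + 2 = a + (k + 1) + 1 by ring]
      rfl
    have s1 := hch.onSegment hT (i := a) (j := a + k) (k := a + k + 1) le_rfl (by omega) (by omega)
      (by omega)
    have s2 := hch.onSegment hT (i := a) (j := a + k) (k := a + k + 2) le_rfl (by omega) (by omega)
      (by omega)
    rw [f1, f2, f3, onSegment_smul hT] at s1
    rw [f1, f2, f4, onSegment_smul hT] at s2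
    rw [e1, e2, mul_smul K, mul_smul K, hμ.shadow_smul_eq hT K s1 (w (a + k)).smul_ne.symm,
      hμ.shadow_smul_eq hT K s2 (hal.ne hT), transProb_of_allowed hal, ← hn,
      ← shadow_eq hT (hal.onSegment hT) hal.smul_ne]
    set R := μ x₀ (shadow T x₀ ((w (a + k)).1 • x₀)) with hR
    have hR0 : R ≠ 0 := hpos _
    have hRt : R ≠ ∞ := measure_ne_top _ _
    set Q := μ x₀ (shadow T x₀ (((w (a + k)).1 * (w (a + k + 1)).1) • x₀))
    set d := ENNReal.ofReal (Real.exp (-δ * T.dist x₀ (K • x₀)))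
    rw [div_eq_mul_inv, ENNReal.mul_inv (Or.inl hn0) (Or.inl hnt), pow_succ]
    calc M * (d * Q) * (n⁻¹ ^ k * n⁻¹) = M * (d * Q) * (n⁻¹ ^ k * n⁻¹) * (R * R⁻¹) := by
          rw [ENNReal.mul_inv_cancel hR0 hRt, mul_one]
      _ = _ := by ring

end Formula

section Formula

variable {V : Type*} {T : SimpleGraph V} {Γ : Subgroup (T ≃g T)} {V' : Set V} {N : ℕ} {x₀ : V}
  {δ : ℝ} {μ : V → Measure (Bdry T)} {o : V}

lemma measure_rooted_inter [Countable V] (hT : T.IsTree) (hμ : IsPattersonSullivan Γ δ μ)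
    (hne : bowenMargulis δ μ o ≠ 0) (hx₀ : x₀ ∈ V')
    (hrec : (bowenMargulis δ μ o).restrict (geodFrom T V') (recurrent Γ V' x₀)ᶜ = 0) {y z : V}
    (hyz : y ≠ z) (hx : OnSegment T y z x₀) :
    (bowenMargulis δ μ o).restrict (geodFrom T V') (rooted Γ V' x₀ ∩
      {l | l.toFun (-T.dist x₀ y) = y ∧ l.toFun (T.dist x₀ z) = z}) =
      μ x₀ (shadow T z y) * μ x₀ (shadow T y z) := by
  rw [← bowenMargulis_through hT hμ hne hyz hx]
  set Z := {l : Geod T | l.toFun 0 = x₀ ∧ l.toFun (-T.dist x₀ y) = y ∧ l.toFun (T.dist x₀ z) = z}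
    with hZ
  have hZm : MeasurableSet Z := (Geod.measurableSet_eval 0 {x₀}).inter
    ((Geod.measurableSet_eval (-T.dist x₀ y) {y}).inter
      (Geod.measurableSet_eval (T.dist x₀ z) {z}))
  have h1 : (bowenMargulis δ μ o).restrict (geodFrom T V') Z = bowenMargulis δ μ o Z := by
    rw [Measure.restrict_apply hZm, inter_eq_left.2]
    rintro l ⟨h0, -⟩
    change l.toFun 0 ∈ V'
    rwa [h0]
  rw [← h1]
  refine le_antisymm (measure_mono fun l hl => ⟨hl.1.2, hl.2⟩) ?_
  refine (measure_mono (t := (rooted Γ V' x₀ ∩ {l | l.toFun (-T.dist x₀ y) = y ∧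
    l.toFun (T.dist x₀ z) = z}) ∪ (recurrent Γ V' x₀)ᶜ) fun l hl => ?_).trans
    ((measure_union_le _ _).trans (by rw [hrec, add_zero]))
  by_cases hlr : l ∈ recurrent Γ V' x₀
  · exact Or.inl ⟨⟨hlr, hl.1⟩, hl.2⟩
  · exact Or.inr hlr

lemma markovMeasure_eq_prod [Countable V] [Countable Γ] [Countable (Alphabet Γ x₀)]
    [Finite (MulAction.stabilizer Γ x₀)] (hT : T.IsTree) (hμ : IsPattersonSullivan Γ δ μ)
    (hne : bowenMargulis δ μ o ≠ 0) (hV' : IsAdapted Γ N V') (hx₀ : x₀ ∈ V') {m : Measure (Geod T)}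
    (hmeq : m = (bowenMargulis δ μ o).restrict (geodFrom T V')) (hm : IsInvariant Γ m)
    [IsProbabilityMeasure (rootedProb Γ V' x₀ m)]
    (hrec : m (recurrent Γ V' x₀)ᶜ = 0)
    (hpos : ∀ a : Alphabet Γ x₀, μ x₀ (shadow T x₀ (a.1 • x₀)) ≠ 0) (w : ℤ → Alphabet Γ x₀)
    {a : ℤ} (k : ℕ) (ha : a ≤ 0) (hak : 0 ≤ a + k + 1) :
    markovMeasure hT V' m {s | ∀ i, a ≤ i → i < a + k + 1 → s.1 i = w i} =
      statWeight Γ μ V' x₀ m (w a) *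
        ∏ j ∈ Finset.range k, transProb Γ μ x₀ (w (a + j)) (w (a + j + 1)) := by
  by_cases hA : ∀ i, a ≤ i → i < a + k → Allowed (w i) (w (i + 1))
  · have hA' : ∀ i, a ≤ i → i + 1 < a + k + 1 → Allowed (w i) (w (i + 1)) :=
      fun i h1 h2 => hA i h1 (by omega)
    have hc : IsChain T (pathPt w) a (a + k + 1) := isChain_pathPt hT hA'
    have hx := hc.onSegment hT le_rfl ha hak le_rfl
    rw [pathPt_zero] at hx
    have hd := hc.le_dist hT le_rfl (show a ≤ a + k + 1 by omega) le_rfl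
    have hyz : pathPt w a ≠ pathPt w (a + k + 1) := by
      intro he
      rw [← he, SimpleGraph.dist_self] at hd
      omega
    have hn0 : (Nat.card (MulAction.stabilizer Γ x₀) : ℝ≥0∞) ≠ 0 :=
      Nat.cast_ne_zero.2 Nat.card_pos.ne'
    have hnt : (Nat.card (MulAction.stabilizer Γ x₀) : ℝ≥0∞) ≠ ∞ := by simp
    rw [markovMeasure_cylinder hT ha hak hA']
    conv_lhs => rw [hmeq]
    rw [measure_rooted_inter hT hμ hne hx₀ (hmeq ▸ hrec) hyz hx,
      hμ.shadow_mul_shadow_word hT ha hak (by omega) hA', ← hmeq,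
      show (a + k + 1 - a).toNat = k + 1 by omega, statWeight, hV'.sectionMeasure_univ hm]
    set n := (Nat.card (MulAction.stabilizer Γ x₀) : ℝ≥0∞) with hn
    set q := μ x₀ (shadow T ((w a).1 • x₀) x₀)
    set ρ := m (rooted Γ V' x₀)
    have hwf := word_formula hT hμ (M := ρ⁻¹ * q * n⁻¹) hpos w a k hA
    have e : n ^ 2 * (n⁻¹ * ρ) = n * ρ := by
      rw [pow_two, mul_assoc, ← mul_assoc n n⁻¹, ENNReal.mul_inv_cancel hn0 hnt, one_mul]
    rw [e, div_eq_mul_inv, ENNReal.mul_inv (Or.inl hn0) (Or.inl hnt), pow_succ]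
    calc _ = ρ⁻¹ * q * n⁻¹ * μ x₀ (shadow T x₀ (((cocycle (fun j => (w j).1) a)⁻¹ *
          cocycle (fun j => (w j).1) (a + k + 1)) • x₀)) * n⁻¹ ^ k := by ring
      _ = _ := hwf
      _ = _ := by ring
  · push Not at hA
    obtain ⟨i, h1, h2, h3⟩ := hA
    have hL : {s : Subshift (Allowed (Γ := Γ) (x₀ := x₀)) |
        ∀ i, a ≤ i → i < a + k + 1 → s.1 i = w i} = ∅ := by
      rw [Set.eq_empty_iff_forall_notMem]
      intro s hs
      apply h3
      rw [← hs i h1 (by omega), ← hs (i + 1) (by omega) (by omega)]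
      exact s.2 i
    rw [hL, measure_empty, Finset.prod_eq_zero (i := (i - a).toNat), mul_zero]
    · rw [Finset.mem_range]
      omega
    · rw [show a + ((i - a).toNat : ℤ) = i by omega]
      exact transProb_of_not_allowed h3

/-- A shift invariance criterion and the resulting stochasticity, from the masses of the cylinders
whose window is close to `0`. -/
lemma markov_of_cylinders {S : Type*} [MeasurableSpace S] [DiscreteMeasurableSpace S] [Countable S]
    {A : S → S → Prop} {P : Measure (Subshift A)} [IsProbabilityMeasure P] {ν : S → ℝ≥0∞}
    {π : S → S → ℝ≥0∞} (hν : ∀ a, ν a ≠ 0)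
    (h : ∀ (w : ℤ → S) (a : ℤ) (k : ℕ), a ≤ 0 → 0 ≤ a + k + 1 →
      P {s | ∀ i, a ≤ i → i < a + k + 1 → s.1 i = w i} =
        ν (w a) * ∏ j ∈ Finset.range k, π (w (a + j)) (w (a + j + 1))) :
    IsMarkovMeasure π ν P ∧ IsStochasticStationary π ν := by
  have hsh : MeasurePreserving Subshift.shift P P := by
    refine ⟨Subshift.measurable_shift, ?_⟩
    have : IsProbabilityMeasure (P.map Subshift.shift) :=
      Measure.isProbabilityMeasure_map Subshift.measurable_shift.aemeasurable
    refine Subshift.ext_of_cylinder fun n w hn => ?_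
    rw [Measure.map_apply Subshift.measurable_shift (Subshift.measurableSet_cylinder _ _ _)]
    have h1 := h w (-n) (2 * n - 1) (by omega) (by omega)
    have h2 := h (fun i => w (i - 1)) (-n + 1) (2 * n - 1) (by omega) (by omega)
    have e1 : (-n : ℤ) + (2 * n - 1 : ℕ) + 1 = n := by omega
    have e2 : (-n : ℤ) + 1 + (2 * n - 1 : ℕ) + 1 = n + 1 := by omega
    rw [e1] at h1
    rw [e2] at h2
    have e3 : Subshift.shift ⁻¹' {s : Subshift A | ∀ i : ℤ, -n ≤ i → i < n → s.1 i = w i} =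
        {s | ∀ i : ℤ, -n + 1 ≤ i → i < n + 1 → s.1 i = w (i - 1)} := by
      ext s
      constructor
      · intro hs i hi hi'
        have := hs (i - 1) (by omega) (by omega)
        change s.1 (i - 1 + 1) = _ at this
        rwa [sub_add_cancel] at this
      · intro hs i hi hi'
        have := hs (i + 1) (by omega) (by omega)
        rwa [add_sub_cancel_right] at this
    rw [e3, h1, h2]
    congr 1
    · congr 1
      congr 1
      ring
    · refine Finset.prod_congr rfl fun j _ => ?_
      congr 2 <;> ring
  have hsing : ∀ a, P {s | s.1 0 = a} = ν a := by
    intro a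
    have h1 := h (fun _ => a) 0 0 le_rfl (by simp)
    simp only [Finset.range_zero, Finset.prod_empty, mul_one] at h1
    rw [← h1]
    congr 1
    ext s
    constructor
    · intro hs i hi hi'
      obtain rfl : i = 0 := by push_cast at hi'; omega
      exact hs
    · intro hs
      exact hs 0 le_rfl (by simp)
  have hpair : ∀ a b, P ({s | s.1 0 = a} ∩ {s | s.1 1 = b}) = ν a * π a b := by
    intro a b
    have h1 := h (fun i => if i = 0 then a else b) 0 1 le_rfl (by simp)
    simp only [Finset.range_one, Finset.prod_singleton, Nat.cast_zero, zero_add, one_ne_zero,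
      if_true, if_false] at h1
    rw [← h1]
    congr 1
    ext s
    constructor
    · rintro ⟨hs, hs'⟩ i hi hi'
      push_cast at hi'
      have : i = 0 ∨ i = 1 := by omega
      rcases this with rfl | rfl
      · simpa using hs
      · simpa using hs'
    · intro hs
      exact ⟨by simpa using hs 0 le_rfl (by simp), by simpa using hs 1 (by simp) (by simp)⟩
  have hm : ∀ (i : ℤ) (a : S), MeasurableSet {s : Subshift A | s.1 i = a} :=
    fun i a => (Subshift.discMeas_apply i).setOf fun c => c = a
  have htot : ∀ (i : ℤ) (B : Set (Subshift A)), MeasurableSet B →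
      ∑' a, P (B ∩ {s | s.1 i = a}) = P B := by
    intro i B hB
    rw [← measure_iUnion _ fun a => hB.inter (hm i a), ← inter_iUnion]
    · congr 1
      ext s
      simp
    · intro a b hab
      rw [Function.onFun, Set.disjoint_left]
      rintro s ⟨-, h1⟩ ⟨-, h2⟩
      exact hab (h1.symm.trans h2)
  have hνt : ∀ a, ν a ≠ ∞ := fun a => by
    rw [← hsing]
    exact measure_ne_top _ _
  refine ⟨⟨inferInstance, hsh, fun k w => ?_⟩, fun a => ?_, ?_, fun b => ?_⟩
  · have h1 := h (fun i => if hi : i.toNat < k + 1 then w ⟨i.toNat, hi⟩ else w 0) 0 k le_rfl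
      (by omega)
    have e : {s : Subshift A | ∀ i : Fin (k + 1), s.1 ((i : ℕ) : ℤ) = w i} =
        {s | ∀ i : ℤ, 0 ≤ i → i < 0 + k + 1 →
          s.1 i = if hi : i.toNat < k + 1 then w ⟨i.toNat, hi⟩ else w 0} := by
      ext s
      constructor
      · intro hs i hi hi'
        rw [dif_pos (by omega)]
        have := hs ⟨i.toNat, by omega⟩
        simpa [hi] using this
      · intro hs i
        have := hs ((i : ℕ) : ℤ) (by omega) (by omega)
        rw [dif_pos (by rw [Int.toNat_natCast]; exact i.2)] at this
        simpa using this
    rw [e, h1, ← Fin.prod_univ_eq_prod_range (fun j : ℕ => π _ _)]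
    congr 1
    refine Finset.prod_congr rfl fun j _ => ?_
    have hj := j.2
    rw [dif_pos (show ((0 : ℤ) + (j : ℕ)).toNat < k + 1 by omega),
      dif_pos (show ((0 : ℤ) + (j : ℕ) + 1).toNat < k + 1 by omega)]
    congr 2
    · ext
      simp
    · ext
      simp
  · have h1 := htot 1 _ (hm 0 a)
    simp only [hpair, hsing] at h1
    rw [ENNReal.tsum_mul_left] at h1
    have h2 : ν a * ∑' b, π a b = ν a * 1 := by rw [h1, mul_one]
    exact (ENNReal.mul_right_inj (hν a) (hνt a)).1 h2
  · have h1 := htot 0 _ MeasurableSet.univ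
    simpa only [univ_inter, hsing, measure_univ] using h1
  · have h1 := htot 0 _ (hm 1 b)
    have h2 := hsh.measure_preimage (hm 0 b).nullMeasurableSet
    have h3 : Subshift.shift ⁻¹' {s : Subshift A | s.1 0 = b} = {s | s.1 1 = b} := rfl
    rw [h3, hsing] at h2
    simp only [inter_comm {s : Subshift A | s.1 1 = b}, hpair] at h1
    rw [h1, h2]

end Formula

theorem exists_markov_coding {V : Type*} (T : SimpleGraph V) (hT : T.IsTree)
    (hlf : ∀ x : V, (T.neighborSet x).Finite)
    (Γ : Subgroup (T ≃g T))
    (hdisc : IsDiscrete Γ)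
    (δ : ℝ) (μ : V → Measure (Bdry T))
    (hμ : IsPattersonSullivan Γ δ μ)
    (N : ℕ) (hN : 1 ≤ N) (V' : Set V) (hV' : IsAdapted Γ N V')
    (o : V) (mBM : Measure (Geod T))
    (hmBM : mBM = (bowenMargulis δ μ o).restrict (geodFrom T V'))
    (hprob : IsProbabilityMeasure (quotientMeasure Γ mBM))
    (hmix : IsMixing (flow Γ N) (quotientMeasure Γ mBM)) :
    (∃ x₀ ∈ V', mBM (recurrent Γ V' x₀)ᶜ = 0) ∧
    ∀ x₀ ∈ V', mBM (recurrent Γ V' x₀)ᶜ = 0 →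
      IsProbabilityMeasure (sectionProb Γ V' x₀ mBM) ∧
      (∀ a : Alphabet Γ x₀, 0 < statWeight Γ μ V' x₀ mBM a) ∧
      (∀ a b : Alphabet Γ x₀,
        0 < transProb Γ μ x₀ a b ↔ Allowed a b) ∧
      IsStochasticStationary (transProb Γ μ x₀)
        (statWeight Γ μ V' x₀ mBM) ∧
      Countable (Alphabet Γ x₀) ∧
      ∃ P : Measure (Subshift (Allowed (Γ := Γ) (x₀ := x₀))),
        IsMarkovMeasure (transProb Γ μ x₀)
          (statWeight Γ μ V' x₀ mBM) P ∧
        ∃ Θ : Subshift (Allowed (Γ := Γ) (x₀ := x₀)) →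
            section₀ Γ V' x₀,
          Measurable Θ ∧ Function.Surjective Θ ∧
          (∀ s, (Θ s.shift : GeodQuot Γ) =
            firstReturn (flow Γ N) (section₀ Γ V' x₀) (Θ s)) ∧
          P.map Θ = sectionProb Γ V' x₀ mBM := by
  have hcV : Countable V := countable_of_locallyFinite hT hlf
  have hcΓ : Countable Γ := countable_of_isDiscrete hdisc
  have hBM : bowenMargulis δ μ o ≠ 0 := by
    intro h0
    have h1 := measure_univ (μ := quotientMeasure Γ mBM)
    rw [quotientMeasure_apply Γ mBM MeasurableSet.univ, hmBM, h0] at h1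
    simp at h1
  have hm : IsInvariant Γ mBM := by
    rw [hmBM]
    exact isInvariant_restrict_bowenMargulis hT hμ hBM hV'.1
  have hsupp : mBM (geodFrom T V')ᶜ = 0 := by
    have hV'm : MeasurableSet (geodFrom T V') := Geod.measurableSet_eval 0 V'
    rw [hmBM, Measure.restrict_apply hV'm.compl, compl_inter_self, measure_empty]
  refine ⟨exists_recurrent hN hm hsupp hmix, fun x₀ hx₀ hrec => ?_⟩
  have hle : ∀ B, mBM B ≤ bowenMargulis δ μ o B := fun B => by
    rw [hmBM]
    exact Measure.restrict_apply_le _ _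
  have hfin : Finite (MulAction.stabilizer Γ x₀) := finite_stabilizer hT hlf hdisc x₀
  have hcA : Countable (Alphabet Γ x₀) := Subtype.countable
  have hμf := hμ.finite x₀
  have hR0 : mBM (rooted Γ V' x₀) ≠ 0 := hV'.measure_rooted_ne_zero hN hm hmix.1 hx₀ hrec
  have hRt : mBM (rooted Γ V' x₀) ≠ ∞ :=
    ((measure_mono fun l hl => hl.2).trans (hle _)).trans_lt
      (bowenMargulis_origin_lt_top hT hμ hBM x₀) |>.ne
  have hRp := isProbabilityMeasure_rootedProb hR0 hRt
  have horigin : ∀ g : Γ, bowenMargulis δ μ o {l : Geod T | l.toFun 0 = g • x₀} ≠ 0 := by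
    intro g h0
    have h1 := hm.measure_origin g x₀ (F := univ) MeasurableSet.univ
    rw [preimage_univ, univ_inter, univ_inter] at h1
    refine hR0 (measure_mono_null (fun l hl => hl.2) (h1.symm.trans ?_))
    exact le_antisymm ((hle _).trans h0.le) zero_le
  have hpos : ∀ x : V, ∀ g : Γ, μ x₀ (shadow T x (g • x₀)) ≠ 0 :=
    fun x g => shadow_ne_zero_of_origin hT hμ hBM (horigin g) x₀
  have hpos1 : ∀ a : Alphabet Γ x₀, μ x₀ (shadow T (a.1 • x₀) x₀) ≠ 0 := fun a => by
    simpa using hpos (a.1 • x₀) 1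
  have hstat : ∀ a : Alphabet Γ x₀, 0 < statWeight Γ μ V' x₀ mBM a := by
    intro a
    refine ENNReal.div_pos (mul_ne_zero (hpos1 a) (hpos _ _)) ?_
    rw [hV'.sectionMeasure_univ hm]
    exact ENNReal.mul_ne_top (by simp) (ENNReal.mul_ne_top
      (ENNReal.inv_ne_top.2 (Nat.cast_ne_zero.2 Nat.card_pos.ne')) hRt)
  have hPp : IsProbabilityMeasure (markovMeasure (x₀ := x₀) hT V' mBM) :=
    Measure.isProbabilityMeasure_map (measurable_code (Γ := Γ) (x₀ := x₀) hT).aemeasurable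
  have hmap := map_coding_markovMeasure hT hV' hx₀ hm
  obtain ⟨hMarkov, hStoch⟩ := markov_of_cylinders (P := markovMeasure (x₀ := x₀) hT V' mBM)
    (π := transProb Γ μ x₀) (fun a => (hstat a).ne') fun w a k ha hak =>
      markovMeasure_eq_prod hT hμ hBM hV' hx₀ hmBM hm hrec (fun a => hpos _ _) w k ha hak
  refine ⟨?_, hstat, fun a b => ⟨fun h => ?_, fun h => ?_⟩, hStoch, hcA,
    markovMeasure hT V' mBM, hMarkov, coding hT hx₀, measurable_coding hT hx₀,
    surjective_coding hT hV' hx₀, coding_shift hT hV' hN hx₀, hmap⟩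
  · rw [← hmap]
    exact Measure.isProbabilityMeasure_map (measurable_coding hT hx₀).aemeasurable
  · by_contra hcon
    rw [transProb_of_not_allowed hcon] at h
    exact lt_irrefl _ h
  · rw [transProb_of_allowed h]
    exact ENNReal.div_pos (hpos _ _) (ENNReal.mul_ne_top (by simp) (measure_ne_top _ _))

end TreeCoding

theorem mainTheorem6 {V : Type*} (T : SimpleGraph V) (hT : T.IsTree)
    (hlf : ∀ x : V, (T.neighborSet x).Finite)
    (Γ : Subgroup (T ≃g T)) (hinv : TreeCoding.WithoutInversion Γ)
    (hdisc : TreeCoding.IsDiscrete Γ) (hne : TreeCoding.NonElementary Γ)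
    (δ : ℝ) (hδ : 0 < δ) (μ : V → Measure (TreeCoding.Bdry T))
    (hμ : TreeCoding.IsPattersonSullivan Γ δ μ)
    (hfix : ∀ g ∈ Γ, g ≠ 1 → (∃ x : V, g x = x) →
      ∀ x : V, μ x {ξ | TreeCoding.Bdry.map g ξ = ξ} = 0)
    (N : ℕ) (hN : 1 ≤ N) (V' : Set V) (hV' : TreeCoding.IsAdapted Γ N V')
    (o : V) (mBM : Measure (TreeCoding.Geod T))
    (hmBM : mBM = (TreeCoding.bowenMargulis δ μ o).restrict (TreeCoding.geodFrom T V'))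
    (hprob : IsProbabilityMeasure (TreeCoding.quotientMeasure Γ mBM))
    (hmix : TreeCoding.IsMixing (TreeCoding.flow Γ N) (TreeCoding.quotientMeasure Γ mBM)) :
    (∃ x₀ ∈ V', mBM (TreeCoding.recurrent Γ V' x₀)ᶜ = 0) ∧
    ∀ x₀ ∈ V', mBM (TreeCoding.recurrent Γ V' x₀)ᶜ = 0 →
      IsProbabilityMeasure (TreeCoding.sectionProb Γ V' x₀ mBM) ∧
      (∀ a : TreeCoding.Alphabet Γ x₀, 0 < TreeCoding.statWeight Γ μ V' x₀ mBM a) ∧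
      (∀ a b : TreeCoding.Alphabet Γ x₀,
        0 < TreeCoding.transProb Γ μ x₀ a b ↔ TreeCoding.Allowed a b) ∧
      TreeCoding.IsStochasticStationary (TreeCoding.transProb Γ μ x₀)
        (TreeCoding.statWeight Γ μ V' x₀ mBM) ∧
      Countable (TreeCoding.Alphabet Γ x₀) ∧
      ∃ P : Measure (TreeCoding.Subshift (TreeCoding.Allowed (Γ := Γ) (x₀ := x₀))),
        TreeCoding.IsMarkovMeasure (TreeCoding.transProb Γ μ x₀)
          (TreeCoding.statWeight Γ μ V' x₀ mBM) P ∧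
        ∃ Θ : TreeCoding.Subshift (TreeCoding.Allowed (Γ := Γ) (x₀ := x₀)) →
            TreeCoding.section₀ Γ V' x₀,
          Measurable Θ ∧ Function.Surjective Θ ∧
          (∀ s, (Θ s.shift : TreeCoding.GeodQuot Γ) =
            TreeCoding.firstReturn (TreeCoding.flow Γ N) (TreeCoding.section₀ Γ V' x₀) (Θ s)) ∧
          P.map Θ = TreeCoding.sectionProb Γ V' x₀ mBM := by
  exact TreeCoding.exists_markov_coding T hT hlf Γ hdisc δ μ hμ N hN V' hV' o mBM hmBM hprob hmix
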